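/- Let $\mathbb F$ be a field of characteristic zero. Points of the phase space $\mathbb F^4$ are written $(\boldsymbol x,\boldsymbol X)=(x_1,x_2,X_1,X_2)$, and parameters are $p=(c_1,c_2,a_1,a_2,a_3)$, $q=(d_1,d_2,b_1,b_2,b_3)\in\mathbb F^5$ with all $a_i,b_i$ nonzero. Let $$R_{p,q}:\big((x_1,x_2,X_1,X_2),(y_1,y_2,Y_1,Y_2)\big)\mapsto\big((u_1,u_2,U_1,U_2),(v_1,v_2,V_1,V_2)\big)$$ be given by $$(u_1,u_2)=\tfrac{b_3}{a_3}(y_1,y_2)+\tfrac{b_3}{a_3}\tfrac{C_1}{D_1}\big(\tfrac{a_3}{b_1}x_1-y_1,\ \tfrac{a_3}{b_2}x_2-y_2\big),$$ $$(v_1,v_2)=\big(\tfrac{a_1}{b_1}x_1,\tfrac{a_2}{b_2}x_2\big)-b_1\tfrac{C_2}{D_2}\big(a_1(\tfrac{a_3}{b_1}x_1-y_1),\ a_2(\tfrac{a_3}{b_2}x_2-y_2)\big),$$ $$U_i=\frac{(a_ix_i-b_iv_i)X_i+(a_iy_i-a_3v_i)Y_i}{a_iu_i-b_3v_i},\qquad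 V_i=\frac{(b_iu_i-b_3x_i)X_i+(a_3u_i-b_3y_i)Y_i}{a_iu_i-b_3v_i}\qquad(i=1,2),$$ where $$C_1=a_2a_3b_1(d_1-2d_2)-b_1b_2b_3(c_1-2c_2),\qquad C_2=\tfrac{b_2b_3}{a_3}(c_1+c_2)-a_2(d_1+d_2),$$ $$D_1=a_2a_3b_2b_3(a_3x_1-b_1y_1)Y_1+a_2a_3b_1b_3(a_3x_2-b_2y_2)Y_2+C_1+3a_2a_3b_1d_2,$$ $$D_2=a_2b_1b_2b_3(a_3x_1-b_1y_1)X_1+a_2b_1b_2b_3(a_3x_2-b_2y_2)X_2-C_1-3a_2a_3b_1d_2.$$ The map is regarded as defined where $D_1$, $D_2$, $a_1u_1-b_3v_1$ and $a_2u_2-b_3v_2$ are nonzero. Let $L(\boldsymbol x,\boldsymbol X,p,\lambda)$ be the matrix $$\begin{pmatrix}\frac{a_1(c_1+c_2)}{a_2a_3}-a_1x_1X_1-\lambda a_1&-a_2x_2X_1&X_1\\-a_1x_1X_2&\frac{c_1+c_2}{a_3}-a_2x_2X_2-\lambda a_2&X_2\\ \frac{3a_1c_2x_1}{a_2}-a_1a_3x_1S&3c_2x_2-a_2a_3x_2S&\frac{c_1-2c_2}{a_2}+a_3S-\lambda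 a_3\end{pmatrix},\quad S=x_1X_1+x_2X_2.$$ Then, for all such parameters $p,q,r$: 1. $R$ is a parametric birational Yang–Baxter map: $R_{p,q}$ is a birational map of $\mathbb F^4\times\mathbb F^4$ to itself, and $$R^{12}_{p,q}\circ R^{13}_{p,r}\circ R^{23}_{q,r}=R^{23}_{q,r}\circ R^{13}_{p,r}\circ R^{12}_{p,q}$$ wherever both sides are defined, which is the case on a nonempty Zariski open subset of $(\mathbb F^4)^3$. If moreover neither of $\frac{c_1+c_2}{a_2a_3},\frac{c_1-2c_2}{a_2a_3}$ (the roots of $\det L(\boldsymbol x,\boldsymbol X,p,\lambda)$ in $\lambda$) equals either of $\frac{d_1+d_2}{b_2b_3},\frac{d_1-2d_2}{b_2b_3}$, then $R_{p,q}$ is quadrirational: for every fixed $(\boldsymbol y,\boldsymbol Y)$ the map $(\boldsymbol x,\boldsymbol X)\mapsto(\boldsymbol u,\boldsymbol U)$, and for every fixed $(\boldsymbol x,\boldsymbol X)$ the map $(\boldsymbol y,\boldsymbol Y)\mapsto(\boldsymbol v,\boldsymbol V)$, is a birational map of $\mathbb F^4$ to itself. 2. $L$ is a strong Lax matrix of $R_{p,q}$: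 wherever $R_{p,q}$ is defined, its value satisfies $$L(\boldsymbol u,\boldsymbol U,p,\lambda)L(\boldsymbol v,\boldsymbol V,q,\lambda)=L(\boldsymbol y,\boldsymbol Y,q,\lambda)L(\boldsymbol x,\boldsymbol X,p,\lambda)\quad\text{for all }\lambda\in\mathbb F,$$ and, if $(c_2,\boldsymbol X)\neq(0,0)$ and $(d_2,\boldsymbol Y)\ne(0,0)$, it is the only $\big((\boldsymbol u,\boldsymbol U),(\boldsymbol v,\boldsymbol V)\big)\in\mathbb F^4\times\mathbb F^4$ that does. 3. $R_{p,q}$ is symplectic with respect to $\omega=dx_1\wedge dX_1+dx_2\wedge dX_2+dy_1\wedge dY_1+dy_2\wedge dY_2$: as rational differential forms, $$du_1\wedge dU_1+du_2\wedge dU_2+dv_1\wedge dV_1+dv_2\wedge dV_2=\omega .$$ -/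

import Mathlib

open scoped KaehlerDifferential

noncomputable section

namespace YangBaxter

/-! ### Rational maps between affine spaces, through their rational points -/

/-- A property of points of the affine space `σ → F` holds generically if it holds on a nonempty
principal Zariski open set. -/
def Generically {F σ : Type*} [Field F] (S : Set (σ → F)) : Prop :=
  ∃ Q : MvPolynomial σ F, Q ≠ 0 ∧ ∀ z, MvPolynomial.eval z Q ≠ 0 → z ∈ S

/-- On the principal open set `Q ≠ 0`, every coordinate of `f` is a quotient of two polynomials
whose denominator has no zero there. -/
def IsRationalOn {F σ τ : Type*} [Field F] (Q : MvPolynomial σ F) (f : (σ → F) → (τ → F)) : Prop :=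
  ∀ j, ∃ N D : MvPolynomial σ F, ∀ z, MvPolynomial.eval z Q ≠ 0 →
    MvPolynomial.eval z D ≠ 0 ∧ f z j = MvPolynomial.eval z N / MvPolynomial.eval z D

/-- The map `f`, which is meaningful on the set `dom`, is a birational isomorphism: it restricts to
a bijection between two nonempty principal open sets, the first one inside `dom`, and both this
bijection and its inverse are given by rational functions. -/
def IsBirational {F σ τ : Type*} [Field F] (dom : Set (σ → F)) (f : (σ → F) → (τ → F)) : Prop :=
  ∃ (Q : MvPolynomial σ F) (Q' : MvPolynomial τ F) (g : (τ → F) → (σ → F)),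
    Q ≠ 0 ∧ Q' ≠ 0 ∧
    (∀ z, MvPolynomial.eval z Q ≠ 0 → z ∈ dom) ∧
    IsRationalOn Q f ∧ IsRationalOn Q' g ∧
    (∀ z, MvPolynomial.eval z Q ≠ 0 → MvPolynomial.eval (f z) Q' ≠ 0 ∧ g (f z) = z) ∧
    (∀ w, MvPolynomial.eval w Q' ≠ 0 → MvPolynomial.eval (g w) Q ≠ 0 ∧ f (g w) = w)

/-- A partially defined map `R : (x, y) ↦ (u, v)` is birational, as a map of the affine space with
the coordinates of `x` and `y`. -/
def IsBirationalPair {F σ : Type*} [Field F] (dom : Set ((σ → F) × (σ → F)))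
    (R : (σ → F) × (σ → F) → (σ → F) × (σ → F)) : Prop :=
  IsBirational {w : σ ⊕ σ → F | (w ∘ Sum.inl, w ∘ Sum.inr) ∈ dom}
    (fun w => Sum.elim (R (w ∘ Sum.inl, w ∘ Sum.inr)).1 (R (w ∘ Sum.inl, w ∘ Sum.inr)).2)

/-- A partially defined map `R : (x, y) ↦ (u, v)` is quadrirational: `R` is birational, the map
`x ↦ u(x, y)` is birational for each fixed `y`, and the map `y ↦ v(x, y)` is birational for each
fixed `x`. -/
def IsQuadrirational {F σ : Type*} [Field F] (dom : Set ((σ → F) × (σ → F)))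
    (R : (σ → F) × (σ → F) → (σ → F) × (σ → F)) : Prop :=
  IsBirationalPair dom R ∧
    (∀ y, IsBirational {x | (x, y) ∈ dom} (fun x => (R (x, y)).1)) ∧
    (∀ x, IsBirational {y | (x, y) ∈ dom} (fun y => (R (x, y)).2))

/-! ### The Yang-Baxter equation for partially defined maps -/

/-- `R` acting on the factors 1 and 2 of `X × X × X`. -/
def act12 {X : Type*} (R : X × X → X × X) (w : X × X × X) : X × X × X :=
  ((R (w.1, w.2.1)).1, (R (w.1, w.2.1)).2, w.2.2)

/-- `R` acting on the factors 1 and 3 of `X × X × X`. -/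
def act13 {X : Type*} (R : X × X → X × X) (w : X × X × X) : X × X × X :=
  ((R (w.1, w.2.2)).1, w.2.1, (R (w.1, w.2.2)).2)

/-- `R` acting on the factors 2 and 3 of `X × X × X`. -/
def act23 {X : Type*} (R : X × X → X × X) (w : X × X × X) : X × X × X :=
  (w.1, (R (w.2.1, w.2.2)).1, (R (w.2.1, w.2.2)).2)

/-- The triples at which `R¹²_{p,q} ∘ R¹³_{p,r} ∘ R²³_{q,r}` and
`R²³_{q,r} ∘ R¹³_{p,r} ∘ R¹²_{p,q}` are both defined, `dom p q` being the domain of `R p q`. -/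
def tripleDomain {X P : Type*} (dom : P → P → Set (X × X)) (R : P → P → X × X → X × X)
    (p q r : P) : Set (X × X × X) :=
  {w | (w.2.1, w.2.2) ∈ dom q r ∧
    ((act23 (R q r) w).1, (act23 (R q r) w).2.2) ∈ dom p r ∧
    ((act13 (R p r) (act23 (R q r) w)).1, (act13 (R p r) (act23 (R q r) w)).2.1) ∈ dom p q ∧
    (w.1, w.2.1) ∈ dom p q ∧
    ((act12 (R p q) w).1, (act12 (R p q) w).2.2) ∈ dom p r ∧
    (act13 (R p r) (act12 (R p q) w)).2 ∈ dom q r}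

/-- The parametric Yang-Baxter equation for a family of partially defined maps `R p q`, with
parameters in `params`: both sides are defined generically, and they agree wherever both are defined. -/
def IsParametricYangBaxter {F σ P : Type*} [Field F] (params : Set P)
    (dom : P → P → Set ((σ → F) × (σ → F)))
    (R : P → P → (σ → F) × (σ → F) → (σ → F) × (σ → F)) : Prop :=
  ∀ p ∈ params, ∀ q ∈ params, ∀ r ∈ params,
    Generically {z : σ ⊕ σ ⊕ σ → F |
      (z ∘ Sum.inl, z ∘ Sum.inr ∘ Sum.inl, z ∘ Sum.inr ∘ Sum.inr) ∈ tripleDomain dom R p q r} ∧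
    ∀ w ∈ tripleDomain dom R p q r,
      act12 (R p q) (act13 (R p r) (act23 (R q r) w)) =
        act23 (R q r) (act13 (R p r) (act12 (R p q) w))

/-! ### The map -/

/-- The parameters `p = (c₁, c₂, a₁, a₂, a₃)`. For a second set of parameters
`q = (d₁, d₂, b₁, b₂, b₃)` one has `d₁ = q.c1`, …, `b₃ = q.a3`. -/
structure Params (K : Type*) where
  c1 : K
  c2 : K
  a1 : K
  a2 : K
  a3 : K

/-- The parameters with `a₁, a₂, a₃` nonzero, that is, with `diag(a₁, a₂, a₃)` invertible. -/
def admissible (K : Type*) [Field K] : Set (Params K) :=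
  {p | p.a1 ≠ 0 ∧ p.a2 ≠ 0 ∧ p.a3 ≠ 0}

/-- Extension of scalars for parameters. -/
def Params.map {F K : Type*} (f : F → K) (p : Params F) : Params K :=
  ⟨f p.c1, f p.c2, f p.a1, f p.a2, f p.a3⟩

/-- A point of the four-dimensional phase space, with coordinates
`x 0 = x₁`, `x 1 = x₂`, `x 2 = X₁`, `x 3 = X₂`. -/
abbrev Pt (K : Type*) := Fin 4 → K

/-- The reduced `3 × 3` Lax matrix `L(x, X, p, λ)`. -/
def lax {K : Type*} [Field K] (x : Pt K) (p : Params K) (lam : K) : Matrix (Fin 3) (Fin 3) K :=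
  !![p.a1 * (p.c1 + p.c2) / (p.a2 * p.a3) - p.a1 * x 0 * x 2 - lam * p.a1,
      -(p.a2 * x 1 * x 2),
      x 2;
    -(p.a1 * x 0 * x 3),
      (p.c1 + p.c2) / p.a3 - p.a2 * x 1 * x 3 - lam * p.a2,
      x 3;
    3 * p.a1 * p.c2 * x 0 / p.a2 - p.a1 * p.a3 * x 0 * (x 0 * x 2 + x 1 * x 3),
      3 * p.c2 * x 1 - p.a2 * p.a3 * x 1 * (x 0 * x 2 + x 1 * x 3),
      (p.c1 - 2 * p.c2) / p.a2 + p.a3 * (x 0 * x 2 + x 1 * x 3) - lam * p.a3]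

section Formulas

variable {K : Type*} [Field K] (p q : Params K) (x y : Pt K)

def C1 : K :=
  p.a2 * p.a3 * q.a1 * (q.c1 - 2 * q.c2) - q.a1 * q.a2 * q.a3 * (p.c1 - 2 * p.c2)

def C2 : K :=
  q.a2 * q.a3 / p.a3 * (p.c1 + p.c2) - p.a2 * (q.c1 + q.c2)

def D1 : K :=
  p.a2 * p.a3 * q.a2 * q.a3 * (p.a3 * x 0 - q.a1 * y 0) * y 2 +
    p.a2 * p.a3 * q.a1 * q.a3 * (p.a3 * x 1 - q.a2 * y 1) * y 3 +
    C1 p q + 3 * p.a2 * p.a3 * q.a1 * q.c2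

def D2 : K :=
  p.a2 * q.a1 * q.a2 * q.a3 * (p.a3 * x 0 - q.a1 * y 0) * x 2 +
    p.a2 * q.a1 * q.a2 * q.a3 * (p.a3 * x 1 - q.a2 * y 1) * x 3 -
    C1 p q - 3 * p.a2 * p.a3 * q.a1 * q.c2

def u1 : K :=
  q.a3 / p.a3 * y 0 + q.a3 / p.a3 * (C1 p q / D1 p q x y) * (p.a3 / q.a1 * x 0 - y 0)

def u2 : K :=
  q.a3 / p.a3 * y 1 + q.a3 / p.a3 * (C1 p q / D1 p q x y) * (p.a3 / q.a2 * x 1 - y 1)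

def v1 : K :=
  p.a1 / q.a1 * x 0 - q.a1 * (C2 p q / D2 p q x y) * (p.a1 * (p.a3 / q.a1 * x 0 - y 0))

def v2 : K :=
  p.a2 / q.a2 * x 1 - q.a1 * (C2 p q / D2 p q x y) * (p.a2 * (p.a3 / q.a2 * x 1 - y 1))

/-- The common denominator of `U₁` and `V₁`. -/
def E1 : K := p.a1 * u1 p q x y - q.a3 * v1 p q x y

/-- The common denominator of `U₂` and `V₂`. -/
def E2 : K := p.a2 * u2 p q x y - q.a3 * v2 p q x y

def U1 : K :=
  ((p.a1 * x 0 - q.a1 * v1 p q x y) * x 2 + (p.a1 * y 0 - p.a3 * v1 p q x y) * y 2) / E1 p q x y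

def U2 : K :=
  ((p.a2 * x 1 - q.a2 * v2 p q x y) * x 3 + (p.a2 * y 1 - p.a3 * v2 p q x y) * y 3) / E2 p q x y

def V1 : K :=
  ((q.a1 * u1 p q x y - q.a3 * x 0) * x 2 + (p.a3 * u1 p q x y - q.a3 * y 0) * y 2) / E1 p q x y

def V2 : K :=
  ((q.a2 * u2 p q x y - q.a3 * x 1) * x 3 + (p.a3 * u2 p q x y - q.a3 * y 1) * y 3) / E2 p q x y

end Formulas

/-- The map `R_{p,q} : ((x, X), (y, Y)) ↦ ((u, U), (v, V))`. -/
def ybMap {K : Type*} [Field K] (p q : Params K) (w : Pt K × Pt K) : Pt K × Pt K :=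
  (![u1 p q w.1 w.2, u2 p q w.1 w.2, U1 p q w.1 w.2, U2 p q w.1 w.2],
    ![v1 p q w.1 w.2, v2 p q w.1 w.2, V1 p q w.1 w.2, V2 p q w.1 w.2])

/-- The points at which no denominator in the formulas for `R_{p,q}` vanishes. -/
def ybDomain {K : Type*} [Field K] (p q : Params K) : Set (Pt K × Pt K) :=
  {w | D1 p q w.1 w.2 ≠ 0 ∧ D2 p q w.1 w.2 ≠ 0 ∧ E1 p q w.1 w.2 ≠ 0 ∧ E2 p q w.1 w.2 ≠ 0}

/-! ### The three properties -/

/-- The refactorisation problem `L(u, U, p, λ) L(v, V, q, λ) = L(y, Y, q, λ) L(x, X, p, λ)`,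
for all values of the spectral parameter `λ`. -/
def Refactors {F : Type*} [Field F] (p q : Params F) (x y u v : Pt F) : Prop :=
  ∀ lam : F, lax u p lam * lax v q lam = lax y q lam * lax x p lam

/-- The Lax matrix `L(x, X, p, λ)` is not a scalar multiple of `diag(a₁, a₂, a₃)`; the only
exception is `c₂ = 0` and `X = 0`, where `L` does not depend on `x`. -/
def Nonscalar {F : Type*} [Field F] (p : Params F) (x : Pt F) : Prop :=
  p.c2 ≠ 0 ∨ x 2 ≠ 0 ∨ x 3 ≠ 0

/-- `L` is a strong Lax matrix of `R_{p,q}`: wherever `R_{p,q}` is defined its value solves the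
refactorisation problem, and if `L(x, X, p, ·)` and `L(y, Y, q, ·)` are not scalar multiples of
the diagonal matrices of the parameters, then it is the only solution. -/
def IsStrongLax {F : Type*} [Field F] (p q : Params F) : Prop :=
  ∀ x y : Pt F, (x, y) ∈ ybDomain p q →
    Refactors p q x y (ybMap p q (x, y)).1 (ybMap p q (x, y)).2 ∧
    (Nonscalar p x → Nonscalar q y →
      ∀ u v : Pt F, Refactors p q x y u v ↔ (u, v) = ybMap p q (x, y))

/-- The disjointness of the roots `(c₁ + c₂) / (a₂ a₃)`, `(c₁ - 2 c₂) / (a₂ a₃)` of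
`det L(x, X, p, λ)` from the roots `(d₁ + d₂) / (b₂ b₃)`, `(d₁ - 2 d₂) / (b₂ b₃)` of
`det L(y, Y, q, λ)`. -/
def DisjointSpectra {F : Type*} [Field F] (p q : Params F) : Prop :=
  (p.c1 + p.c2) / (p.a2 * p.a3) ≠ (q.c1 + q.c2) / (q.a2 * q.a3) ∧
  (p.c1 + p.c2) / (p.a2 * p.a3) ≠ (q.c1 - 2 * q.c2) / (q.a2 * q.a3) ∧
  (p.c1 - 2 * p.c2) / (p.a2 * p.a3) ≠ (q.c1 + q.c2) / (q.a2 * q.a3) ∧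
  (p.c1 - 2 * p.c2) / (p.a2 * p.a3) ≠ (q.c1 - 2 * q.c2) / (q.a2 * q.a3)

/-- The field of rational functions over `F` in the eight coordinates of `(x, X, y, Y)`. -/
abbrev FunField (F : Type*) [Field F] := FractionRing (MvPolynomial (Fin 4 ⊕ Fin 4) F)

/-- The coordinate functions, as a point with coordinates in the function field. -/
def genericPt (F : Type*) [Field F] : Pt (FunField F) × Pt (FunField F) :=
  (fun i => algebraMap (MvPolynomial (Fin 4 ⊕ Fin 4) F) (FunField F) (MvPolynomial.X (Sum.inl i)),
    fun i => algebraMap (MvPolynomial (Fin 4 ⊕ Fin 4) F) (FunField F) (MvPolynomial.X (Sum.inr i)))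

/-- The differential of a rational function. -/
def diff {F : Type*} [Field F] (f : FunField F) :
    ExteriorAlgebra (FunField F) (Ω[FunField F⁄F]) :=
  ExteriorAlgebra.ι (FunField F) (KaehlerDifferential.D F (FunField F) f)

/-- The two-form `dx₁ ∧ dX₁ + dx₂ ∧ dX₂ + dy₁ ∧ dY₁ + dy₂ ∧ dY₂`, for rational functions
`x₁, …, Y₂`. -/
def omega {F : Type*} [Field F] (w : Pt (FunField F) × Pt (FunField F)) :
    ExteriorAlgebra (FunField F) (Ω[FunField F⁄F]) :=
  diff (w.1 0) * diff (w.1 2) + diff (w.1 1) * diff (w.1 3) +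
    diff (w.2 0) * diff (w.2 2) + diff (w.2 1) * diff (w.2 3)

/-- `R_{p,q}` is symplectic: its components are well-defined rational functions
`u₁, …, V₂` of the coordinates, and
`du₁ ∧ dU₁ + du₂ ∧ dU₂ + dv₁ ∧ dV₁ + dv₂ ∧ dV₂ = dx₁ ∧ dX₁ + dx₂ ∧ dX₂ + dy₁ ∧ dY₁ + dy₂ ∧ dY₂`. -/
def IsSymplectic {F : Type*} [Field F] (p q : Params F) : Prop :=
  genericPt F ∈ ybDomain (p.map (algebraMap F (FunField F))) (q.map (algebraMap F (FunField F))) ∧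
  omega (ybMap (p.map (algebraMap F (FunField F))) (q.map (algebraMap F (FunField F)))
    (genericPt F)) = omega (genericPt F)

end YangBaxter

end

/-! The Lax matrix is a rank one perturbation of a diagonal pencil, `L = (ρ₁ - λ) A + a αᵀ`, where
`A` is the diagonal matrix of the parameters and the last entry of the row `α` is 1 (`lax_eq`). The
pairing of `α` with `A⁻¹a` is the constant `ρ₂ - ρ₁` (`sum_row_mul_col`), and `L` times a matrix
`laxAdj` of the same shape is scalar. So `L` has rank at most one at `λ = ρ₁`, and `laxAdj` has rank
at most one at `λ = ρ₂`.

Evaluating a refactorisation and its inverse at these four values of `λ` shows what the map does.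
Let `α`, `a` be the row and the weighted column of `x`, and `β`, `b` those of `y`, weighted as in
`pairing_snd`. Write `δ₁`, `δ₂` for the differences of the roots, `φ = ⟨β, a⟩` and `ψ = ⟨α, b⟩`. Up
to a scalar that restores the last entry 1, the new rows are `δ₂ α - ψ β` and `φ α - δ₁ β`, and the
new columns are the contragredient combinations of `a` and `b`, with denominator `δ₁δ₂ - φψ`. This
is `IsImage`, and `isImage_ybMap` identifies it with the explicit formulas. The rest follows from
these relations.

Birationality: they are reversible, so exchanging both the points and the parameters inverts the map
(`IsImage.swap`, `ybMap_swap`).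

Strong Lax property: `IsImage.refactors` verifies the factorisation; in `Refactors.unique` the rank
one evaluations determine the rows, and the coefficient of `λ` then gives a linear system for the
columns.

Yang-Baxter: along either side, the rows and columns of the outer factors are transported by
products of two Lax matrices, which agree by refactorisation; the middle factor follows by
cancellation (`IsFactorisation.yangBaxter`). This needs `ρ₁ ≠ ρ₂` for each parameter, that is, a
nonzero second component. The remaining parameters are reached by shifting that component and using
that regular functions agreeing generically agree everywhere (`yangBaxter`).

Quadrirationality: for fixed `y`, the unnormalised row and column of `u` are linear images of those
of `x` under rank one perturbations of scalars; disjoint roots make these invertible, with inverses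
of the same form (`slide_slide`).

Symplecticity: minus the form is `∑ dα ∧ da + dβ ∧ db`. Rescaling a row and its column inversely
does not change it, because their pairing is constant (`rescaling`). Mixing the rows by a matrix
that depends on `φ`, `ψ` and the columns by its contragredient adds terms in `dφ`, `dψ`, which
cancel (`cotangent_lift`). -/

noncomputable section

namespace YangBaxter

/-! ### Regular functions and principal open sets -/

section Regular

variable {F σ τ : Type*} [Field F]

/-- On `S`, the function `f` is a quotient of polynomials whose denominator has no zero in `S`. -/
def IsRegular (S : Set (σ → F)) (f : (σ → F) → F) : Prop :=
  ∃ N D : MvPolynomial σ F, ∀ z ∈ S,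
    MvPolynomial.eval z D ≠ 0 ∧ f z = MvPolynomial.eval z N / MvPolynomial.eval z D

/-- `S` is the set where some polynomial does not vanish. -/
def IsPrincipal (S : Set (σ → F)) : Prop :=
  ∃ Q : MvPolynomial σ F, ∀ z, z ∈ S ↔ MvPolynomial.eval z Q ≠ 0

variable {S T : Set (σ → F)} {f g : (σ → F) → F}

theorem IsRegular.mono (h : IsRegular T f) (hST : S ⊆ T) : IsRegular S f := by
  obtain ⟨N, D, h⟩ := h
  exact ⟨N, D, fun z hz => h z (hST hz)⟩

theorem IsRegular.congr (h : IsRegular S f) (hfg : ∀ z ∈ S, f z = g z) : IsRegular S g := by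
  obtain ⟨N, D, h⟩ := h
  exact ⟨N, D, fun z hz => ⟨(h z hz).1, (hfg z hz) ▸ (h z hz).2⟩⟩

theorem isRegular_const (c : F) : IsRegular S fun _ => c :=
  ⟨MvPolynomial.C c, 1, fun z _ => by simp⟩

theorem isRegular_coord (i : σ) : IsRegular S fun z => z i :=
  ⟨MvPolynomial.X i, 1, fun z _ => by simp⟩

theorem IsRegular.add (hf : IsRegular S f) (hg : IsRegular S g) :
    IsRegular S fun z => f z + g z := by
  obtain ⟨N, D, h⟩ := hf
  obtain ⟨N', D', h'⟩ := hg
  refine ⟨N * D' + D * N', D * D', fun z hz => ?_⟩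
  have h1 := h z hz
  have h2 := h' z hz
  refine ⟨by simpa using ⟨h1.1, h2.1⟩, ?_⟩
  beta_reduce
  rw [h1.2, h2.2, div_add_div _ _ h1.1 h2.1]
  simp

theorem IsRegular.mul (hf : IsRegular S f) (hg : IsRegular S g) :
    IsRegular S fun z => f z * g z := by
  obtain ⟨N, D, h⟩ := hf
  obtain ⟨N', D', h'⟩ := hg
  refine ⟨N * N', D * D', fun z hz => ?_⟩
  have h1 := h z hz
  have h2 := h' z hz
  refine ⟨by simpa using ⟨h1.1, h2.1⟩, ?_⟩
  beta_reduce
  rw [h1.2, h2.2, div_mul_div_comm]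
  simp

theorem IsRegular.neg (hf : IsRegular S f) : IsRegular S fun z => -f z :=
  ((isRegular_const (-1)).mul hf).congr fun z _ => by ring

theorem IsRegular.sub (hf : IsRegular S f) (hg : IsRegular S g) :
    IsRegular S fun z => f z - g z :=
  (hf.add hg.neg).congr fun z _ => by ring

theorem IsRegular.div (hf : IsRegular S f) (hg : IsRegular S g) (h0 : ∀ z ∈ S, g z ≠ 0) :
    IsRegular S fun z => f z / g z := by
  obtain ⟨N, D, h⟩ := hf
  obtain ⟨N', D', h'⟩ := hg
  refine ⟨N * D', D * N', fun z hz => ?_⟩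
  have h1 := h z hz
  have h2 := h' z hz
  have h3 : MvPolynomial.eval z N' ≠ 0 := fun h4 => h0 z hz (by rw [h2.2, h4, zero_div])
  refine ⟨by simpa using ⟨h1.1, h3⟩, ?_⟩
  beta_reduce
  rw [h1.2, h2.2, div_div_div_eq]
  simp

theorem IsRegular.sum {ι : Type*} {s : Finset ι} {f : ι → (σ → F) → F}
    (hf : ∀ i ∈ s, IsRegular S (f i)) : IsRegular S fun z => ∑ i ∈ s, f i z := by
  classical
  induction s using Finset.induction_on with
  | empty => simpa using isRegular_const (0 : F)
  | insert a s ha ih =>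
    simp only [Finset.sum_insert ha]
    exact (hf a (Finset.mem_insert_self a s)).add
      (ih fun i hi => hf i (Finset.mem_insert_of_mem hi))

theorem IsRegular.eval_comp {f : τ → (σ → F) → F} (hf : ∀ i, IsRegular S (f i))
    (P : MvPolynomial τ F) : IsRegular S fun z => MvPolynomial.eval (fun i => f i z) P := by
  induction P using MvPolynomial.induction_on with
  | C a => simpa using isRegular_const a
  | add P Q hP hQ => simpa using hP.add hQ
  | mul_X P i hP => simpa using hP.mul (hf i)

theorem isPrincipal_univ : IsPrincipal (Set.univ : Set (σ → F)) := ⟨1, fun z => by simp⟩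

theorem IsPrincipal.and_ne_zero (hS : IsPrincipal S) (hf : IsRegular S f) :
    IsPrincipal {z | z ∈ S ∧ f z ≠ 0} := by
  obtain ⟨Q, hQ⟩ := hS
  obtain ⟨N, D, h⟩ := hf
  refine ⟨Q * N, fun z => ?_⟩
  by_cases hz : z ∈ S
  · have h1 := h z hz
    have h2 := (hQ z).1 hz
    simp [hz, h1.2, h1.1, h2]
  · have h2 : MvPolynomial.eval z Q = 0 := by
      by_contra h3
      exact hz ((hQ z).2 h3)
    simp [hz, h2]

theorem IsPrincipal.inter (hS : IsPrincipal S) (hT : IsPrincipal T) : IsPrincipal (S ∩ T) := by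
  obtain ⟨Q, hQ⟩ := hS
  obtain ⟨Q', hQ'⟩ := hT
  exact ⟨Q * Q', fun z => by simp [hQ, hQ']⟩

theorem IsPrincipal.preimage {T : Set (τ → F)} {f : τ → (σ → F) → F} (hS : IsPrincipal S)
    (hT : IsPrincipal T) (hf : ∀ i, IsRegular S (f i)) :
    IsPrincipal {z | z ∈ S ∧ (fun i => f i z) ∈ T} := by
  obtain ⟨Q, hQ⟩ := hT
  obtain ⟨Q', hQ'⟩ := hS.and_ne_zero (IsRegular.eval_comp hf Q)
  exact ⟨Q', fun z => by rw [← hQ' z]; simp [hQ]⟩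

theorem IsPrincipal.generically (hS : IsPrincipal S) (hne : S.Nonempty) : Generically S := by
  obtain ⟨Q, hQ⟩ := hS
  obtain ⟨z, hz⟩ := hne
  exact ⟨Q, fun h => (hQ z).1 hz (by simp [h]), fun z hz => (hQ z).2 hz⟩

/-- A birational isomorphism between principal open sets `S` and `S'`, restricted to a nonempty
principal open subset of `S` inside `dom`. -/
theorem isBirational_of_isPrincipal {dom S T : Set (σ → F)} {S' : Set (τ → F)}
    {f : (σ → F) → (τ → F)} {f' : (σ → F) → (τ → F)} {g : (τ → F) → (σ → F)}
    (hS : IsPrincipal S) (hS' : IsPrincipal S') (hT : IsPrincipal T) (hne : (S ∩ T).Nonempty)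
    (hdom : S ∩ T ⊆ dom) (hff' : ∀ z ∈ S ∩ T, f z = f' z)
    (hf' : ∀ j, IsRegular S fun z => f' z j) (hg : ∀ j, IsRegular S' fun w => g w j)
    (hfS : ∀ z ∈ S, f' z ∈ S' ∧ g (f' z) = z) (hgS : ∀ w ∈ S', g w ∈ S ∧ f' (g w) = w) :
    IsBirational dom f := by
  have h1 := hS.inter hT
  obtain ⟨Q, hQ⟩ := h1
  -- The target has to shrink together with the source: the polynomial `Q'` cuts out the points of
  -- `S'` that `g` sends into `T`.
  obtain ⟨Q', hQ'⟩ := hS'.preimage hT (f := fun j w => g w j) hg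
  obtain ⟨z, hz⟩ := hne
  refine ⟨Q, Q', g, fun h => (hQ z).1 hz (by simp [h]),
    fun h => (hQ' (f' z)).1 ⟨(hfS z hz.1).1, ?_⟩ (by simp [h]),
    fun z hz => hdom ((hQ z).2 hz), ?_, ?_, ?_, ?_⟩
  · have := (hfS z hz.1).2
    simpa [this] using hz.2
  · intro j
    obtain ⟨N, D, h⟩ := hf' j
    refine ⟨N, D, fun z hz => ?_⟩
    have hz' := (hQ z).2 hz
    rw [hff' z hz']
    exact h z hz'.1
  · intro j
    obtain ⟨N, D, h⟩ := hg j
    exact ⟨N, D, fun w hw => h w ((hQ' w).2 hw).1⟩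
  · intro z hz
    have hz' := (hQ z).2 hz
    rw [hff' z hz']
    refine ⟨(hQ' _).1 ⟨(hfS z hz'.1).1, ?_⟩, (hfS z hz'.1).2⟩
    have := (hfS z hz'.1).2
    simpa [this] using hz'.2
  · intro w hw
    have hw' := (hQ' w).2 hw
    have h2 : g w ∈ S ∩ T := ⟨(hgS w hw'.1).1, hw'.2⟩
    exact ⟨(hQ _).1 h2, by rw [hff' _ h2]; exact (hgS w hw'.1).2⟩

variable [Infinite F]

theorem exists_eval_ne_zero {Q : MvPolynomial σ F} (hQ : Q ≠ 0) :
    ∃ z, MvPolynomial.eval z Q ≠ 0 := by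
  by_contra! h
  exact hQ (MvPolynomial.funext fun z => by simpa using h z)

theorem IsPrincipal.inter_nonempty (hS : IsPrincipal S) (hT : IsPrincipal T)
    (hSne : S.Nonempty) (hTne : T.Nonempty) : (S ∩ T).Nonempty := by
  obtain ⟨Q, hQ⟩ := hS
  obtain ⟨Q', hQ'⟩ := hT
  obtain ⟨a, ha⟩ := hSne
  obtain ⟨b, hb⟩ := hTne
  have h1 : Q ≠ 0 := fun h => (hQ a).1 ha (by simp [h])
  have h2 : Q' ≠ 0 := fun h => (hQ' b).1 hb (by simp [h])
  obtain ⟨z, hz⟩ := exists_eval_ne_zero (mul_ne_zero h1 h2)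
  simp only [map_mul, ne_eq, mul_eq_zero, not_or] at hz
  exact ⟨z, (hQ z).2 hz.1, (hQ' z).2 hz.2⟩

/-- Regular functions that agree on a nonempty principal open subset agree everywhere. -/
theorem IsRegular.eq_of_eqOn (hS : IsPrincipal S) (hT : IsPrincipal T) (hTne : T.Nonempty)
    (hf : IsRegular S f) (hg : IsRegular S g) (h : ∀ z ∈ S, z ∈ T → f z = g z)
    {z : σ → F} (hz : z ∈ S) : f z = g z := by
  by_contra hne
  -- A single point of disagreement makes the locus of disagreement a nonempty principal open set,
  -- which must meet `T`.
  obtain ⟨z', ⟨h1, h2⟩, h3⟩ := (hS.and_ne_zero (hf.sub hg)).inter_nonempty hT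
    ⟨z, hz, sub_ne_zero.2 hne⟩ hTne
  exact h2 (sub_eq_zero.2 (h z' h1 h3))

end Regular

/-! ### The rank one structure of the Lax matrix -/

section Structure

variable {K : Type*} [Field K]

/-- The diagonal matrix `diag(a₁, a₂, a₃)`, as a vector. -/
def diagVec (p : Params K) : Fin 3 → K := ![p.a1, p.a2, p.a3]

/-- The row vector of the rank one part of the Lax matrix. -/
def laxRow (p : Params K) (x : Pt K) : Fin 3 → K := ![-(p.a1 * x 0), -(p.a2 * x 1), 1]

/-- The column vector of the rank one part of the Lax matrix. -/
def laxCol (p : Params K) (x : Pt K) : Fin 3 → K :=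
  ![x 2, x 3, p.a3 * (x 0 * x 2 + x 1 * x 3) - 3 * p.c2 / p.a2]

/-- The double root of the determinant of the Lax matrix. -/
def root1 (p : Params K) : K := (p.c1 + p.c2) / (p.a2 * p.a3)

/-- The simple root of the determinant of the Lax matrix. -/
def root2 (p : Params K) : K := (p.c1 - 2 * p.c2) / (p.a2 * p.a3)

/-- The pairing of the row and the column of the rank one part. -/
def gap (p : Params K) : K := -(3 * p.c2) / (p.a2 * p.a3)

def del1 (p q : Params K) : K := root1 q - root1 p

def del2 (p q : Params K) : K := root2 q - root2 p

/-- The scalar through which the two rank one parts meet in the product `L(y) L(x)`; `psi` plays the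
same part in the product of the inverses. -/
def phi (p q : Params K) (x y : Pt K) : K := ∑ k, laxRow q y k * laxCol p x k

def psi (p q : Params K) (x y : Pt K) : K :=
  ∑ k, laxRow p x k * laxCol q y k / (diagVec p k * diagVec q k)

/-- Minus the determinant of the two by two matrix that mixes the rows of `x` and `y`. -/
def disc (p q : Params K) (x y : Pt K) : K :=
  del1 p q * del2 p q - phi p q x y * psi p q x y

/-- The normaliser read off from the third entry of the new row, since every `laxRow` ends in 1;
likewise `scaleV`. -/
def scaleU (p q : Params K) (x y : Pt K) : K := (del2 p q - psi p q x y * p.a3) / q.a3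

def scaleV (p q : Params K) (x y : Pt K) : K := phi p q x y - del1 p q * p.a3

theorem diagVec_ne_zero {p : Params K} (hp : p ∈ admissible K) (k : Fin 3) :
    diagVec p k ≠ 0 := by
  obtain ⟨h1, h2, h3⟩ := hp
  fin_cases k <;> assumption

theorem root2_eq (p : Params K) : root2 p = root1 p + gap p := by
  simp only [root1, root2, gap]
  ring

theorem del2_eq (p q : Params K) : del2 p q = del1 p q + gap q - gap p := by
  simp only [del1, del2, root2_eq]
  ring

theorem del1_swap (p q : Params K) : del1 q p = -del1 p q := by
  simp only [del1]
  ring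

theorem del2_swap (p q : Params K) : del2 q p = -del2 p q := by
  simp only [del2]
  ring

/-- The third entry of `laxCol` is such that its variable part cancels the first two summands,
leaving a constant. -/
theorem sum_row_mul_col {p : Params K} (hp : p ∈ admissible K) (x : Pt K) :
    ∑ k, laxRow p x k * laxCol p x k / diagVec p k = gap p := by
  obtain ⟨h1, h2, h3⟩ := hp
  simp only [Fin.sum_univ_three, laxRow, laxCol, diagVec, gap, Matrix.cons_val]
  field_simp
  ring

theorem lax_eq {p : Params K} (hp : p ∈ admissible K) (x : Pt K) (lam : K) :
    lax x p lam = (root1 p - lam) • Matrix.diagonal (diagVec p) +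
      Matrix.vecMulVec (laxCol p x) (laxRow p x) := by
  obtain ⟨h1, h2, h3⟩ := hp
  ext i j
  fin_cases i <;> fin_cases j <;>
    simp [lax, laxRow, laxCol, diagVec, root1, Matrix.diagonal] <;>
    field_simp <;> ring

theorem C1_eq {p q : Params K} (hp : p ∈ admissible K) (hq : q ∈ admissible K) :
    C1 p q = p.a2 * p.a3 * q.a1 * q.a2 * q.a3 * del2 p q := by
  obtain ⟨h1, h2, h3⟩ := hp
  obtain ⟨h4, h5, h6⟩ := hq
  simp only [C1, del2, root2]
  field_simp

theorem C2_eq {p q : Params K} (hp : p ∈ admissible K) (hq : q ∈ admissible K) :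
    C2 p q = -(p.a2 * q.a2 * q.a3 * del1 p q) := by
  obtain ⟨h1, h2, h3⟩ := hp
  obtain ⟨h4, h5, h6⟩ := hq
  simp only [C2, del1, root1]
  field_simp
  ring

theorem D1_eq {p q : Params K} (hp : p ∈ admissible K) (hq : q ∈ admissible K) (x y : Pt K) :
    D1 p q x y = p.a2 * p.a3 * q.a1 * q.a2 * q.a3 * q.a3 * scaleU p q x y := by
  obtain ⟨h1, h2, h3⟩ := hp
  obtain ⟨h4, h5, h6⟩ := hq
  simp only [D1, C1, scaleU, psi, del2, root2, Fin.sum_univ_three, laxRow, laxCol, diagVec,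
    Matrix.cons_val]
  field_simp
  ring

theorem D2_eq {p q : Params K} (hp : p ∈ admissible K) (hq : q ∈ admissible K) (x y : Pt K) :
    D2 p q x y = p.a2 * q.a1 * q.a2 * q.a3 * scaleV p q x y := by
  obtain ⟨h1, h2, h3⟩ := hp
  obtain ⟨h4, h5, h6⟩ := hq
  simp only [D2, C1, scaleV, phi, del1, root1, Fin.sum_univ_three, laxRow, laxCol,
    Matrix.cons_val]
  field_simp
  ring

theorem D1_ne_zero_iff {p q : Params K} (hp : p ∈ admissible K) (hq : q ∈ admissible K)
    {x y : Pt K} : D1 p q x y ≠ 0 ↔ scaleU p q x y ≠ 0 := by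
  rw [D1_eq hp hq]
  obtain ⟨-, h2, h3⟩ := hp
  obtain ⟨h4, h5, h6⟩ := hq
  simp [h2, h3, h4, h5, h6]

theorem D2_ne_zero_iff {p q : Params K} (hp : p ∈ admissible K) (hq : q ∈ admissible K)
    {x y : Pt K} : D2 p q x y ≠ 0 ↔ scaleV p q x y ≠ 0 := by
  rw [D2_eq hp hq]
  obtain ⟨-, h2, -⟩ := hp
  obtain ⟨h4, h5, h6⟩ := hq
  simp [h2, h4, h5, h6]

section Components

variable {p q : Params K} {x y : Pt K}

theorem scaleU_mul_u1 (hp : p ∈ admissible K) (hq : q ∈ admissible K)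
    (h : scaleU p q x y ≠ 0) :
    scaleU p q x y * u1 p q x y = del2 p q * x 0 / q.a1 - psi p q x y * y 0 := by
  have h0 : psi p q x y * p.a3 = del2 p q - q.a3 * scaleU p q x y := by
    simp only [scaleU]; field_simp [hq.2.2]; ring
  rw [u1, C1_eq hp hq, D1_eq hp hq]
  obtain ⟨h1, h2, h3⟩ := hp
  obtain ⟨h4, h5, h6⟩ := hq
  rw [← eq_div_iff h3] at h0
  rw [h0]
  field_simp
  ring

theorem scaleU_mul_u2 (hp : p ∈ admissible K) (hq : q ∈ admissible K)
    (h : scaleU p q x y ≠ 0) :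
    scaleU p q x y * u2 p q x y = del2 p q * x 1 / q.a2 - psi p q x y * y 1 := by
  have h0 : psi p q x y * p.a3 = del2 p q - q.a3 * scaleU p q x y := by
    simp only [scaleU]; field_simp [hq.2.2]; ring
  rw [u2, C1_eq hp hq, D1_eq hp hq]
  obtain ⟨h1, h2, h3⟩ := hp
  obtain ⟨h4, h5, h6⟩ := hq
  rw [← eq_div_iff h3] at h0
  rw [h0]
  field_simp
  ring

theorem scaleV_mul_v1 (hp : p ∈ admissible K) (hq : q ∈ admissible K)
    (h : scaleV p q x y ≠ 0) :
    scaleV p q x y * v1 p q x y =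
      p.a1 / q.a1 * phi p q x y * x 0 - del1 p q * p.a1 * y 0 := by
  have h0 : phi p q x y = scaleV p q x y + del1 p q * p.a3 := by
    simp only [scaleV]; ring
  rw [v1, C2_eq hp hq, D2_eq hp hq, h0]
  obtain ⟨h1, h2, h3⟩ := hp
  obtain ⟨h4, h5, h6⟩ := hq
  field_simp
  ring

theorem scaleV_mul_v2 (hp : p ∈ admissible K) (hq : q ∈ admissible K)
    (h : scaleV p q x y ≠ 0) :
    scaleV p q x y * v2 p q x y =
      p.a2 / q.a2 * phi p q x y * x 1 - del1 p q * p.a2 * y 1 := by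
  have h0 : phi p q x y = scaleV p q x y + del1 p q * p.a3 := by
    simp only [scaleV]; ring
  rw [v2, C2_eq hp hq, D2_eq hp hq, h0]
  obtain ⟨h1, h2, h3⟩ := hp
  obtain ⟨h4, h5, h6⟩ := hq
  field_simp
  ring

/-- Once the normalisers are cleared, the first coordinates of both new points are combinations of
`x 0` and `y 0`; in the difference, the coefficients of both acquire the common factor `disc`. -/
theorem E1_eq (hp : p ∈ admissible K) (hq : q ∈ admissible K)
    (hU : scaleU p q x y ≠ 0) (hV : scaleV p q x y ≠ 0) :
    q.a1 * E1 p q x y * (scaleU p q x y * scaleV p q x y) =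
      -(disc p q x y * (p.a1 * (p.a3 * x 0 - q.a1 * y 0))) := by
  have h1 := scaleU_mul_u1 hp hq hU
  have h2 := scaleV_mul_v1 hp hq hV
  have h3 : q.a3 * scaleU p q x y = del2 p q - psi p q x y * p.a3 := by
    simp only [scaleU]; field_simp [hq.2.2]
  have h4 : scaleV p q x y = phi p q x y - del1 p q * p.a3 := rfl
  have hb := hq.1
  have h5 : q.a1 * (del2 p q * x 0 / q.a1 - psi p q x y * y 0) =
      del2 p q * x 0 - q.a1 * psi p q x y * y 0 := by field_simp
  have h6 : q.a1 * (p.a1 / q.a1 * phi p q x y * x 0 - del1 p q * p.a1 * y 0) =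
      p.a1 * phi p q x y * x 0 - q.a1 * del1 p q * p.a1 * y 0 := by field_simp
  simp only [E1, disc]
  linear_combination (p.a1 * scaleV p q x y * q.a1) * h1 - q.a1 * q.a3 * scaleU p q x y * h2 +
    p.a1 * scaleV p q x y * h5 - q.a3 * scaleU p q x y * h6 -
    (p.a1 * phi p q x y * x 0 - q.a1 * del1 p q * p.a1 * y 0) * h3 +
    p.a1 * (del2 p q * x 0 - q.a1 * psi p q x y * y 0) * h4

theorem E2_eq (hp : p ∈ admissible K) (hq : q ∈ admissible K)
    (hU : scaleU p q x y ≠ 0) (hV : scaleV p q x y ≠ 0) :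
    q.a2 * E2 p q x y * (scaleU p q x y * scaleV p q x y) =
      -(disc p q x y * (p.a2 * (p.a3 * x 1 - q.a2 * y 1))) := by
  have h1 := scaleU_mul_u2 hp hq hU
  have h2 := scaleV_mul_v2 hp hq hV
  have h3 : q.a3 * scaleU p q x y = del2 p q - psi p q x y * p.a3 := by
    simp only [scaleU]; field_simp [hq.2.2]
  have h4 : scaleV p q x y = phi p q x y - del1 p q * p.a3 := rfl
  have hb := hq.2.1
  have h5 : q.a2 * (del2 p q * x 1 / q.a2 - psi p q x y * y 1) =
      del2 p q * x 1 - q.a2 * psi p q x y * y 1 := by field_simp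
  have h6 : q.a2 * (p.a2 / q.a2 * phi p q x y * x 1 - del1 p q * p.a2 * y 1) =
      p.a2 * phi p q x y * x 1 - q.a2 * del1 p q * p.a2 * y 1 := by field_simp
  simp only [E2, disc]
  linear_combination (p.a2 * scaleV p q x y * q.a2) * h1 - q.a2 * q.a3 * scaleU p q x y * h2 +
    p.a2 * scaleV p q x y * h5 - q.a3 * scaleU p q x y * h6 -
    (p.a2 * phi p q x y * x 1 - q.a2 * del1 p q * p.a2 * y 1) * h3 +
    p.a2 * (del2 p q * x 1 - q.a2 * psi p q x y * y 1) * h4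

/-- Trades the four denominators of the formulas for the factors that occur in the structural
relations. -/
theorem mem_ybDomain_iff (hp : p ∈ admissible K) (hq : q ∈ admissible K) : (x, y) ∈ ybDomain p q ↔
    scaleU p q x y ≠ 0 ∧ scaleV p q x y ≠ 0 ∧ disc p q x y ≠ 0 ∧
      p.a3 * x 0 - q.a1 * y 0 ≠ 0 ∧ p.a3 * x 1 - q.a2 * y 1 ≠ 0 := by
  have h : (x, y) ∈ ybDomain p q ↔
    D1 p q x y ≠ 0 ∧ D2 p q x y ≠ 0 ∧ E1 p q x y ≠ 0 ∧ E2 p q x y ≠ 0 := Iff.rfl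
  rw [h, D1_ne_zero_iff hp hq, D2_ne_zero_iff hp hq]
  constructor
  · rintro ⟨hU, hV, h1, h2⟩
    have e1 := E1_eq hp hq hU hV
    have e2 := E2_eq hp hq hU hV
    have n1 : q.a1 * E1 p q x y * (scaleU p q x y * scaleV p q x y) ≠ 0 :=
      mul_ne_zero (mul_ne_zero hq.1 h1) (mul_ne_zero hU hV)
    have n2 : q.a2 * E2 p q x y * (scaleU p q x y * scaleV p q x y) ≠ 0 :=
      mul_ne_zero (mul_ne_zero hq.2.1 h2) (mul_ne_zero hU hV)
    rw [e1] at n1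
    rw [e2] at n2
    simp only [ne_eq, neg_eq_zero, mul_eq_zero, not_or] at n1 n2
    exact ⟨hU, hV, n1.1, n1.2.2, n2.2.2⟩
  · rintro ⟨hU, hV, hD, h1, h2⟩
    refine ⟨hU, hV, fun h0 => ?_, fun h0 => ?_⟩
    · have e1 := E1_eq hp hq hU hV
      rw [h0] at e1
      simp [hD, h1, hp.1] at e1
    · have e1 := E2_eq hp hq hU hV
      rw [h0] at e1
      simp [hD, h2, hp.2.1] at e1

end Components

/-- The relations between the rows and columns of the rank one parts at `(x, y)` and at its image
`(u, v)`. -/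
structure IsImage (p q : Params K) (x y u v : Pt K) : Prop where
  row_fst : ∀ k, scaleU p q x y * diagVec q k * laxRow p u k =
    del2 p q * laxRow p x k - psi p q x y * diagVec p k * laxRow q y k
  row_snd : ∀ k, scaleV p q x y * laxRow q v k =
    phi p q x y * laxRow p x k - del1 p q * diagVec p k * laxRow q y k
  col_fst : ∀ k, disc p q x y * laxCol p u k =
    scaleU p q x y * (del1 p q * diagVec q k * laxCol p x k + phi p q x y * laxCol q y k)
  col_snd : ∀ k, disc p q x y * diagVec p k * laxCol q v k =
    -scaleV p q x y * (psi p q x y * diagVec q k * laxCol p x k + del2 p q * laxCol q y k)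

end Structure

/-! ### Pairings of the mixed rows and columns -/

section Pairing

variable {K : Type*} [Field K] {al a be b : Fin 3 → K} {d d' f g m n : K}

/-- Expanding leaves `d d' m + f g (d' - d - n)`, and the relation between `d` and `d'` turns the
bracket into `-m`. The cross pairings below collapse by the same relation. -/
theorem row_pairing (hA : ∑ k, al k * a k = m) (hB : ∑ k, be k * b k = n)
    (hf : ∑ k, be k * a k = f) (hg : ∑ k, al k * b k = g) (hd : d' = d + n - m) :
    ∑ k, (d' * al k - g * be k) * (d * a k + f * b k) = (d * d' - f * g) * m := by
  simp only [Fin.sum_univ_three] at *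
  subst hd
  linear_combination (d + n - m) * d * hA - g * f * hB + (d + n - m) * f * hg - g * d * hf

theorem cross_pairing_fst (hA : ∑ k, al k * a k = m) (hB : ∑ k, be k * b k = n)
    (hf : ∑ k, be k * a k = f) (hg : ∑ k, al k * b k = g) (hd : d' = d + n - m) :
    ∑ k, (d' * al k - g * be k) * (g * a k + d' * b k) = g * (d * d' - f * g) := by
  simp only [Fin.sum_univ_three] at *
  subst hd
  linear_combination (d + n - m) * g * hA - g * (d + n - m) * hB +
    (d + n - m) * (d + n - m) * hg - g * g * hf

theorem cross_pairing_snd (hA : ∑ k, al k * a k = m) (hB : ∑ k, be k * b k = n)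
    (hf : ∑ k, be k * a k = f) (hg : ∑ k, al k * b k = g) (hd : d' = d + n - m) :
    ∑ k, (f * al k - d * be k) * (d * a k + f * b k) = -(f * (d * d' - f * g)) := by
  simp only [Fin.sum_univ_three] at *
  subst hd
  linear_combination f * d * hA - d * f * hB + f * f * hg - d * d * hf

/-- The third entry of a column is determined by the first two and by the pairing with a row. -/
theorem third_entry {r c C : Fin 3 → K} {s D m : K} (hr : r 2 ≠ 0) (hm : ∑ k, r k * c k = m)
    (hC : ∑ k, s * r k * C k = D * m) (h0 : D * c 0 = s * C 0) (h1 : D * c 1 = s * C 1) :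
    D * c 2 = s * C 2 := by
  apply mul_left_cancel₀ hr
  simp only [Fin.sum_univ_three] at *
  linear_combination D * hm - hC - r 0 * h0 - r 1 * h1

end Pairing

/-! ### The image of a pair of points, and reversibility -/

section Image

variable {K : Type*} [Field K] {p q : Params K} {x y u v : Pt K}

theorem pairing_fst (hp : p ∈ admissible K) (x : Pt K) :
    ∑ k, laxRow p x k * (laxCol p x k / diagVec p k) = gap p := by
  simp only [← sum_row_mul_col hp x, mul_div_assoc]

theorem pairing_snd (hp : p ∈ admissible K) (hq : q ∈ admissible K) (y : Pt K) :
    ∑ k, diagVec p k * laxRow q y k * (laxCol q y k / (diagVec p k * diagVec q k)) = gap q := by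
  rw [← sum_row_mul_col hq y]
  refine Finset.sum_congr rfl fun k _ => ?_
  have h1 := diagVec_ne_zero hp k
  have h2 := diagVec_ne_zero hq k
  field_simp

theorem pairing_phi (hp : p ∈ admissible K) (x y : Pt K) :
    ∑ k, diagVec p k * laxRow q y k * (laxCol p x k / diagVec p k) = phi p q x y := by
  refine Finset.sum_congr rfl fun k _ => ?_
  have h1 := diagVec_ne_zero hp k
  field_simp

theorem pairing_psi (x y : Pt K) :
    ∑ k, laxRow p x k * (laxCol q y k / (diagVec p k * diagVec q k)) = psi p q x y := by
  simp only [psi, mul_div_assoc]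

theorem scaleU_mul (hq : q ∈ admissible K) (x y : Pt K) :
    scaleU p q x y * q.a3 = del2 p q - psi p q x y * p.a3 := by
  simp only [scaleU]
  field_simp [hq.2.2]

/-- It suffices to know the rows and the first two entries of the columns. -/
theorem IsImage.of_col (hp : p ∈ admissible K) (hq : q ∈ admissible K)
    (h1 : ∀ k, scaleU p q x y * diagVec q k * laxRow p u k =
      del2 p q * laxRow p x k - psi p q x y * diagVec p k * laxRow q y k)
    (h2 : ∀ k, scaleV p q x y * laxRow q v k =
      phi p q x y * laxRow p x k - del1 p q * diagVec p k * laxRow q y k)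
    (h3 : ∀ k, k ≠ 2 → disc p q x y * laxCol p u k =
      scaleU p q x y * (del1 p q * diagVec q k * laxCol p x k + phi p q x y * laxCol q y k))
    (h4 : ∀ k, k ≠ 2 → disc p q x y * diagVec p k * laxCol q v k =
      -scaleV p q x y * (psi p q x y * diagVec q k * laxCol p x k + del2 p q * laxCol q y k)) :
    IsImage p q x y u v := by
  have hA := diagVec_ne_zero hp
  have hB := diagVec_ne_zero hq
  have e1 := pairing_fst hp x
  have e2 := pairing_snd hp hq y
  have e3 := pairing_phi (q := q) hp x y
  have e4 := pairing_psi (p := p) (q := q) x y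
  have r1 := row_pairing e1 e2 e3 e4 (del2_eq p q)
  have r2 := row_pairing e2 e1 e4 e3 (d' := del1 p q) (d := del2 p q)
    (by rw [del2_eq p q]; ring)
  have k1 : ∀ k, disc p q x y * (laxCol p u k / (diagVec p k * diagVec q k)) =
      scaleU p q x y * (del1 p q * (laxCol p x k / diagVec p k) +
        phi p q x y * (laxCol q y k / (diagVec p k * diagVec q k))) ↔
      disc p q x y * laxCol p u k = scaleU p q x y *
        (del1 p q * diagVec q k * laxCol p x k + phi p q x y * laxCol q y k) := by
    intro k
    have := hA k
    have := hB k
    field_simp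
  have k2 : ∀ k, disc p q x y * (laxCol q v k / diagVec q k) =
      -scaleV p q x y * (del2 p q * (laxCol q y k / (diagVec p k * diagVec q k)) +
        psi p q x y * (laxCol p x k / diagVec p k)) ↔
      disc p q x y * diagVec p k * laxCol q v k = -scaleV p q x y *
        (psi p q x y * diagVec q k * laxCol p x k + del2 p q * laxCol q y k) := by
    intro k
    have := hA k
    have := hB k
    field_simp
    constructor <;> intro h <;> linear_combination h
  refine ⟨h1, h2, ?_, ?_⟩
  -- Both the column of `u` and the claimed one pair with the row of `u` to the value dictated by
  -- `gap p`, so agreement in two entries forces the third.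
  · have t := third_entry (r := fun k => diagVec q k * laxRow p u k)
      (c := fun k => laxCol p u k / (diagVec p k * diagVec q k))
      (C := fun k => del1 p q * (laxCol p x k / diagVec p k) +
        phi p q x y * (laxCol q y k / (diagVec p k * diagVec q k)))
      (s := scaleU p q x y) (D := disc p q x y) (m := gap p)
      (by simpa [laxRow] using hB 2)
      (by
        rw [← pairing_snd hq hp u]
        refine Finset.sum_congr rfl fun k _ => ?_
        rw [mul_comm (diagVec p k)])
      (by
        rw [disc, ← r1]
        refine Finset.sum_congr rfl fun k _ => ?_
        linear_combination (del1 p q * (laxCol p x k / diagVec p k) +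
          phi p q x y * (laxCol q y k / (diagVec p k * diagVec q k))) * h1 k)
      ((k1 0).2 (h3 0 (by decide))) ((k1 1).2 (h3 1 (by decide)))
    intro k
    by_cases hk : k = 2
    · rw [hk]
      exact (k1 2).1 t
    · exact h3 k hk
  · have t := third_entry (r := laxRow q v)
      (c := fun k => laxCol q v k / diagVec q k)
      (C := fun k => del2 p q * (laxCol q y k / (diagVec p k * diagVec q k)) +
        psi p q x y * (laxCol p x k / diagVec p k))
      (s := -scaleV p q x y) (D := disc p q x y) (m := gap q)
      (by simp [laxRow])
      (pairing_fst hq v)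
      (by
        rw [disc, mul_comm (del1 p q), mul_comm (phi p q x y), ← r2]
        refine Finset.sum_congr rfl fun k _ => ?_
        linear_combination -(del2 p q * (laxCol q y k / (diagVec p k * diagVec q k)) +
        psi p q x y * (laxCol p x k / diagVec p k)) * h2 k)
      ((k2 0).2 (h4 0 (by decide))) ((k2 1).2 (h4 1 (by decide)))
    intro k
    by_cases hk : k = 2
    · rw [hk]
      exact (k2 2).1 t
    · exact h4 k hk

/-- Clearing `E1` by its factorisation and eliminating `v1` puts the factor `p.a1 * (p.a3 * x 0 -
q.a1 * y 0)` on both sides; it is nonzero on the domain and cancels. -/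
theorem U1_eq (hp : p ∈ admissible K) (hq : q ∈ admissible K) (h : (x, y) ∈ ybDomain p q) :
    disc p q x y * U1 p q x y =
      scaleU p q x y * (del1 p q * q.a1 * x 2 + phi p q x y * y 2) := by
  have hE : E1 p q x y ≠ 0 := h.2.2.1
  obtain ⟨hU, hV, hD, hw, -⟩ := (mem_ybDomain_iff hp hq).1 h
  have e := E1_eq hp hq hU hV
  have e2 := scaleV_mul_v1 hp hq hV
  have e3 : scaleV p q x y = phi p q x y - del1 p q * p.a3 := rfl
  have hb := hq.1
  have e4 : q.a1 * (p.a1 / q.a1 * phi p q x y * x 0 - del1 p q * p.a1 * y 0) =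
      p.a1 * phi p q x y * x 0 - q.a1 * del1 p q * p.a1 * y 0 := by field_simp
  have e5 : U1 p q x y * E1 p q x y = (p.a1 * x 0 - q.a1 * v1 p q x y) * x 2 +
      (p.a1 * y 0 - p.a3 * v1 p q x y) * y 2 := by
    rw [U1, div_mul_cancel₀ _ hE]
  apply mul_left_cancel₀ (mul_ne_zero hp.1 hw)
  linear_combination U1 p q x y * e - (scaleU p q x y * scaleV p q x y * q.a1) * e5 +
    scaleU p q x y * (q.a1 * x 2 + p.a3 * y 2) * (q.a1 * e2 + e4) -
    scaleU p q x y * q.a1 * p.a1 * (x 0 * x 2 + y 0 * y 2) * e3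

theorem U2_eq (hp : p ∈ admissible K) (hq : q ∈ admissible K) (h : (x, y) ∈ ybDomain p q) :
    disc p q x y * U2 p q x y =
      scaleU p q x y * (del1 p q * q.a2 * x 3 + phi p q x y * y 3) := by
  have hE : E2 p q x y ≠ 0 := h.2.2.2
  obtain ⟨hU, hV, hD, -, hw⟩ := (mem_ybDomain_iff hp hq).1 h
  have e := E2_eq hp hq hU hV
  have e2 := scaleV_mul_v2 hp hq hV
  have e3 : scaleV p q x y = phi p q x y - del1 p q * p.a3 := rfl
  have hb := hq.2.1
  have e4 : q.a2 * (p.a2 / q.a2 * phi p q x y * x 1 - del1 p q * p.a2 * y 1) =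
      p.a2 * phi p q x y * x 1 - q.a2 * del1 p q * p.a2 * y 1 := by field_simp
  have e5 : U2 p q x y * E2 p q x y = (p.a2 * x 1 - q.a2 * v2 p q x y) * x 3 +
      (p.a2 * y 1 - p.a3 * v2 p q x y) * y 3 := by
    rw [U2, div_mul_cancel₀ _ hE]
  apply mul_left_cancel₀ (mul_ne_zero hp.2.1 hw)
  linear_combination U2 p q x y * e - (scaleU p q x y * scaleV p q x y * q.a2) * e5 +
    scaleU p q x y * (q.a2 * x 3 + p.a3 * y 3) * (q.a2 * e2 + e4) -
    scaleU p q x y * q.a2 * p.a2 * (x 1 * x 3 + y 1 * y 3) * e3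

theorem V1_eq (hp : p ∈ admissible K) (hq : q ∈ admissible K) (h : (x, y) ∈ ybDomain p q) :
    disc p q x y * p.a1 * V1 p q x y =
      -scaleV p q x y * (psi p q x y * q.a1 * x 2 + del2 p q * y 2) := by
  have hE : E1 p q x y ≠ 0 := h.2.2.1
  obtain ⟨hU, hV, hD, hw, -⟩ := (mem_ybDomain_iff hp hq).1 h
  have e := E1_eq hp hq hU hV
  have e2 := scaleU_mul_u1 hp hq hU
  have e3 := scaleU_mul (p := p) hq x y
  have hb := hq.1
  have e4 : q.a1 * (del2 p q * x 0 / q.a1 - psi p q x y * y 0) =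
      del2 p q * x 0 - q.a1 * psi p q x y * y 0 := by field_simp
  have e5 : V1 p q x y * E1 p q x y = (q.a1 * u1 p q x y - q.a3 * x 0) * x 2 +
      (p.a3 * u1 p q x y - q.a3 * y 0) * y 2 := by
    rw [V1, div_mul_cancel₀ _ hE]
  apply mul_left_cancel₀ hw
  linear_combination V1 p q x y * e - (scaleU p q x y * scaleV p q x y * q.a1) * e5 -
    scaleV p q x y * (q.a1 * x 2 + p.a3 * y 2) * (q.a1 * e2 + e4) +
    scaleV p q x y * q.a1 * (x 0 * x 2 + y 0 * y 2) * e3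

theorem V2_eq (hp : p ∈ admissible K) (hq : q ∈ admissible K) (h : (x, y) ∈ ybDomain p q) :
    disc p q x y * p.a2 * V2 p q x y =
      -scaleV p q x y * (psi p q x y * q.a2 * x 3 + del2 p q * y 3) := by
  have hE : E2 p q x y ≠ 0 := h.2.2.2
  obtain ⟨hU, hV, hD, -, hw⟩ := (mem_ybDomain_iff hp hq).1 h
  have e := E2_eq hp hq hU hV
  have e2 := scaleU_mul_u2 hp hq hU
  have e3 := scaleU_mul (p := p) hq x y
  have hb := hq.2.1
  have e4 : q.a2 * (del2 p q * x 1 / q.a2 - psi p q x y * y 1) =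
      del2 p q * x 1 - q.a2 * psi p q x y * y 1 := by field_simp
  have e5 : V2 p q x y * E2 p q x y = (q.a2 * u2 p q x y - q.a3 * x 1) * x 3 +
      (p.a3 * u2 p q x y - q.a3 * y 1) * y 3 := by
    rw [V2, div_mul_cancel₀ _ hE]
  apply mul_left_cancel₀ hw
  linear_combination V2 p q x y * e - (scaleU p q x y * scaleV p q x y * q.a2) * e5 -
    scaleV p q x y * (q.a2 * x 3 + p.a3 * y 3) * (q.a2 * e2 + e4) +
    scaleV p q x y * q.a2 * (x 1 * x 3 + y 1 * y 3) * e3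

theorem isImage_ybMap (hp : p ∈ admissible K) (hq : q ∈ admissible K)
    (h : (x, y) ∈ ybDomain p q) :
    IsImage p q x y (ybMap p q (x, y)).1 (ybMap p q (x, y)).2 := by
  obtain ⟨hU, hV, hD, -, -⟩ := (mem_ybDomain_iff hp hq).1 h
  have a1 := scaleU_mul_u1 hp hq hU
  have a2 := scaleU_mul_u2 hp hq hU
  have a3 := scaleU_mul (p := p) hq x y
  have b1 := scaleV_mul_v1 hp hq hV
  have b2 := scaleV_mul_v2 hp hq hV
  have hq1 := hq.1
  have hq2 := hq.2.1
  apply IsImage.of_col hp hq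
  · intro k
    fin_cases k
    · simp only [ybMap, laxRow, diagVec, Fin.zero_eta, Matrix.cons_val]
      field_simp at a1
      linear_combination -p.a1 * a1
    · simp only [ybMap, laxRow, diagVec, Fin.mk_one, Matrix.cons_val]
      field_simp at a2
      linear_combination -p.a2 * a2
    · simp only [laxRow, diagVec, Fin.reduceFinMk, Matrix.cons_val]
      linear_combination a3
  · intro k
    fin_cases k
    · simp only [ybMap, laxRow, diagVec, Fin.zero_eta, Matrix.cons_val]
      field_simp at b1
      linear_combination -b1
    · simp only [ybMap, laxRow, diagVec, Fin.mk_one, Matrix.cons_val]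
      field_simp at b2
      linear_combination -b2
    · simp only [laxRow, diagVec, Fin.reduceFinMk, Matrix.cons_val, scaleV]
      ring
  · intro k hk
    fin_cases k
    · exact U1_eq hp hq h
    · exact U2_eq hp hq h
    · exact absurd rfl hk
  · intro k hk
    fin_cases k
    · exact V1_eq hp hq h
    · exact V2_eq hp hq h
    · exact absurd rfl hk

theorem pt_ext (hp : p ∈ admissible K) (h0 : laxRow p x = laxRow p u)
    (h1 : ∀ k, k ≠ 2 → laxCol p x k = laxCol p u k) : x = u := by
  ext k
  fin_cases k
  · have := congrFun h0 0
    simpa [laxRow, hp.1] using this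
  · have := congrFun h0 1
    simpa [laxRow, hp.2.1] using this
  · simpa [laxCol] using h1 0 (by decide)
  · simpa [laxCol] using h1 1 (by decide)

theorem IsImage.eq (hp : p ∈ admissible K) (hq : q ∈ admissible K) {u' v' : Pt K}
    (hU : scaleU p q x y ≠ 0) (hV : scaleV p q x y ≠ 0) (hD : disc p q x y ≠ 0)
    (h : IsImage p q x y u v) (h' : IsImage p q x y u' v') : u = u' ∧ v = v' := by
  have hA := diagVec_ne_zero hp
  have hB := diagVec_ne_zero hq
  refine ⟨pt_ext hp (funext fun k => ?_) fun k _ => ?_,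
    pt_ext hq (funext fun k => ?_) fun k _ => ?_⟩
  · exact mul_left_cancel₀ (mul_ne_zero hU (hB k)) ((h.row_fst k).trans (h'.row_fst k).symm)
  · exact mul_left_cancel₀ hD ((h.col_fst k).trans (h'.col_fst k).symm)
  · exact mul_left_cancel₀ hV ((h.row_snd k).trans (h'.row_snd k).symm)
  · exact mul_left_cancel₀ (mul_ne_zero hD (hA k)) ((h.col_snd k).trans (h'.col_snd k).symm)

theorem IsImage.eq_ybMap (hp : p ∈ admissible K) (hq : q ∈ admissible K)
    (hd : (x, y) ∈ ybDomain p q) (h : IsImage p q x y u v) : (u, v) = ybMap p q (x, y) := by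
  obtain ⟨hU, hV, hD, -, -⟩ := (mem_ybDomain_iff hp hq).1 hd
  have := h.eq hp hq hU hV hD (isImage_ybMap hp hq hd)
  exact Prod.ext this.1 this.2

/-- The new row of `u` against the new column of `v` is, up to the normalisers, the first cross
pairing. So the reversed map sees the old pairings exchanged, up to sign and scale. -/
theorem IsImage.phi_swap (h : IsImage p q x y u v)
    (hp : p ∈ admissible K) (hq : q ∈ admissible K) (hD : disc p q x y ≠ 0) :
    scaleU p q x y * phi q p v u = -(scaleV p q x y * psi p q x y) := by
  have r := cross_pairing_fst (pairing_fst hp x) (pairing_snd hp hq y)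
    (pairing_phi (q := q) hp x y) (pairing_psi (p := p) (q := q) x y) (del2_eq p q)
  apply mul_left_cancel₀ hD
  have : disc p q x y * (scaleU p q x y * phi q p v u) = -scaleV p q x y *
      ∑ k, (del2 p q * laxRow p x k - psi p q x y * (diagVec p k * laxRow q y k)) *
        (psi p q x y * (laxCol p x k / diagVec p k) +
          del2 p q * (laxCol q y k / (diagVec p k * diagVec q k))) := by
    simp only [phi, Finset.mul_sum]
    refine Finset.sum_congr rfl fun k _ => ?_
    have hA := diagVec_ne_zero hp k
    have hB := diagVec_ne_zero hq k
    have e1 := h.row_fst k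
    have e2 := h.col_snd k
    field_simp
    linear_combination (disc p q x y * diagVec p k * laxCol q v k) * e1 +
      (del2 p q * laxRow p x k - psi p q x y * diagVec p k * laxRow q y k) * e2
  rw [this, r, disc]
  ring

theorem IsImage.psi_swap (h : IsImage p q x y u v)
    (hp : p ∈ admissible K) (hq : q ∈ admissible K) (hD : disc p q x y ≠ 0) :
    scaleV p q x y * psi q p v u = -(scaleU p q x y * phi p q x y) := by
  have r := cross_pairing_snd (pairing_fst hp x) (pairing_snd hp hq y)
    (pairing_phi (q := q) hp x y) (pairing_psi (p := p) (q := q) x y) (del2_eq p q)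
  apply mul_left_cancel₀ hD
  have : disc p q x y * (scaleV p q x y * psi q p v u) = scaleU p q x y *
      ∑ k, (phi p q x y * laxRow p x k - del1 p q * (diagVec p k * laxRow q y k)) *
        (del1 p q * (laxCol p x k / diagVec p k) +
          phi p q x y * (laxCol q y k / (diagVec p k * diagVec q k))) := by
    simp only [psi, Finset.mul_sum]
    refine Finset.sum_congr rfl fun k _ => ?_
    have hA := diagVec_ne_zero hp k
    have hB := diagVec_ne_zero hq k
    have e1 := h.row_snd k
    have e2 := h.col_fst k
    field_simp
    linear_combination (disc p q x y * laxCol p u k) * e1 +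
      (phi p q x y * laxRow p x k - del1 p q * diagVec p k * laxRow q y k) * e2
  rw [this, r, disc]
  ring

theorem IsImage.disc_swap (h : IsImage p q x y u v)
    (hp : p ∈ admissible K) (hq : q ∈ admissible K) (hU : scaleU p q x y ≠ 0)
    (hV : scaleV p q x y ≠ 0) (hD : disc p q x y ≠ 0) : disc q p v u = disc p q x y := by
  have e1 := h.phi_swap hp hq hD
  have e2 := h.psi_swap hp hq hD
  rw [disc, disc, del1_swap p q, del2_swap p q]
  apply mul_left_cancel₀ (mul_ne_zero hU hV)
  linear_combination -scaleV p q x y * psi q p v u * e1 + scaleV p q x y * psi p q x y * e2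

/-- Besides entering the reversal, this shows that the normaliser at the reversed pair cannot vanish
when `disc` does not. -/
theorem IsImage.scaleU_swap (h : IsImage p q x y u v)
    (hp : p ∈ admissible K) (hq : q ∈ admissible K) (hD : disc p q x y ≠ 0) :
    scaleU q p v u * scaleV p q x y = disc p q x y := by
  have e1 := scaleU_mul (p := q) hp v u
  have e2 := h.psi_swap hp hq hD
  have e3 := scaleU_mul (p := p) hq x y
  have e4 : scaleV p q x y = phi p q x y - del1 p q * p.a3 := rfl
  rw [del2_swap p q] at e1
  apply mul_left_cancel₀ hp.2.2
  rw [disc]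
  linear_combination scaleV p q x y * e1 - q.a3 * e2 + phi p q x y * e3 - del2 p q * e4

theorem IsImage.scaleV_swap (h : IsImage p q x y u v)
    (hp : p ∈ admissible K) (hq : q ∈ admissible K) (hD : disc p q x y ≠ 0) :
    scaleV q p v u * scaleU p q x y = disc p q x y := by
  have e2 := h.phi_swap hp hq hD
  have e3 := scaleU_mul (p := p) hq x y
  have e4 : scaleV p q x y = phi p q x y - del1 p q * p.a3 := rfl
  have e5 : scaleV q p v u = phi q p v u - del1 q p * q.a3 := rfl
  rw [del1_swap p q] at e5
  rw [disc]
  linear_combination scaleU p q x y * e5 + e2 + del1 p q * e3 - psi p q x y * e4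

/-- The map is reversible. -/
theorem IsImage.swap (h : IsImage p q x y u v)
    (hp : p ∈ admissible K) (hq : q ∈ admissible K) (hU : scaleU p q x y ≠ 0)
    (hV : scaleV p q x y ≠ 0) (hD : disc p q x y ≠ 0) : IsImage q p v u y x := by
  have e1 := h.phi_swap hp hq hD
  have e2 := h.psi_swap hp hq hD
  have e3 := h.scaleU_swap hp hq hD
  have e4 := h.scaleV_swap hp hq hD
  have hd : disc p q x y = del1 p q * del2 p q - phi p q x y * psi p q x y := rfl
  refine ⟨fun k => ?_, fun k => ?_, fun k => ?_, fun k => ?_⟩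
  · have f1 := h.row_fst k
    have f2 := h.row_snd k
    rw [del2_swap p q]
    apply mul_left_cancel₀ hV
    linear_combination diagVec p k * laxRow q y k * e3 + del2 p q * f2 - phi p q x y * f1 +
      diagVec q k * laxRow p u k * e2 + diagVec p k * laxRow q y k * hd
  · have f1 := h.row_fst k
    have f2 := h.row_snd k
    rw [del1_swap p q]
    apply mul_left_cancel₀ hU
    linear_combination laxRow p x k * e4 + psi p q x y * f2 - del1 p q * f1 -
      laxRow q v k * e1 + laxRow p x k * hd
  · have f1 := h.col_fst k
    have f2 := h.col_snd k
    rw [h.disc_swap hp hq hU hV hD, del1_swap p q]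
    apply mul_left_cancel₀ (mul_ne_zero hU hV)
    linear_combination -scaleU p q x y * (-del1 p q * diagVec p k * laxCol q v k +
        phi q p v u * laxCol p u k) * e3 - disc p q x y * laxCol p u k * e1 +
      del1 p q * scaleU p q x y * f2 + scaleV p q x y * psi p q x y * f1 +
      scaleU p q x y * scaleV p q x y * laxCol q y k * hd
  · have f1 := h.col_fst k
    have f2 := h.col_snd k
    rw [h.disc_swap hp hq hU hV hD, del2_swap p q]
    apply mul_left_cancel₀ (mul_ne_zero hU hV)
    linear_combination scaleV p q x y * (psi q p v u * diagVec p k * laxCol q v k -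
        del2 p q * laxCol p u k) * e4 + disc p q x y * diagVec p k * laxCol q v k * e2 -
      scaleU p q x y * phi p q x y * f2 - del2 p q * scaleV p q x y * f1 +
      scaleU p q x y * scaleV p q x y * diagVec q k * laxCol p x k * hd

end Image

/-! ### Regularity of the map, and its birationality -/

theorem phi_eq {K : Type*} [Field K] {p : Params K} (hp : p ∈ admissible K) (q : Params K)
    (x y : Pt K) : phi p q x y = (p.a3 * x 0 - q.a1 * y 0) * x 2 +
      (p.a3 * x 1 - q.a2 * y 1) * x 3 + p.a3 * gap p := by
  obtain ⟨h1, h2, h3⟩ := hp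
  simp only [phi, gap, Fin.sum_univ_three, laxRow, laxCol, Matrix.cons_val]
  field_simp
  ring

theorem psi_eq {K : Type*} [Field K] {p q : Params K} (hp : p ∈ admissible K)
    (hq : q ∈ admissible K) (x y : Pt K) :
    psi p q x y = gap q / p.a3 - (p.a3 * x 0 - q.a1 * y 0) * y 2 / (p.a3 * q.a1) -
      (p.a3 * x 1 - q.a2 * y 1) * y 3 / (p.a3 * q.a2) := by
  obtain ⟨h1, h2, h3⟩ := hp
  obtain ⟨h4, h5, h6⟩ := hq
  simp only [psi, gap, Fin.sum_univ_three, laxRow, laxCol, diagVec, Matrix.cons_val]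
  field_simp
  ring

theorem exists_ne_ne {K : Type*} [Infinite K] (a b : K) : ∃ c, c ≠ a ∧ c ≠ b := by
  classical
  obtain ⟨c, hc⟩ := Infinite.exists_notMem_finset {a, b}
  exact ⟨c, by simpa using hc⟩

theorem ybDomain_nonempty {K : Type*} [Field K] [Infinite K] {p q : Params K}
    (hp : p ∈ admissible K) (hq : q ∈ admissible K) : (ybDomain p q).Nonempty := by
  -- Here `s` and `t` are the values that `phi` and `psi` will take: `s` avoids the zero of
  -- `scaleV`, and `t` avoids the zeros of `scaleU` and `disc`. With positions `(1, 1)` and `(0,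
  -- 0)`, the first momenta realise them independently.
  obtain ⟨s, hs, hs0⟩ := exists_ne_ne (del1 p q * p.a3) 0
  obtain ⟨t, ht, ht0⟩ := exists_ne_ne (del2 p q / p.a3) (del1 p q * del2 p q / s)
  have h1 := hp.2.2
  have h2 := hq.1
  refine ⟨(![1, 1, (s - p.a3 * gap p) / p.a3, 0],
    ![0, 0, (gap q / p.a3 - t) * q.a1, 0]), (mem_ybDomain_iff hp hq).2 ?_⟩
  have e1 : phi p q ![1, 1, (s - p.a3 * gap p) / p.a3, 0]
      ![0, 0, (gap q / p.a3 - t) * q.a1, 0] = s := by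
    rw [phi_eq hp]
    simp only [Matrix.cons_val]
    field_simp
    ring
  have e2 : psi p q ![1, 1, (s - p.a3 * gap p) / p.a3, 0]
      ![0, 0, (gap q / p.a3 - t) * q.a1, 0] = t := by
    rw [psi_eq hp hq]
    simp only [Matrix.cons_val]
    field_simp
    ring
  simp only [scaleU, scaleV, disc, e1, e2, Matrix.cons_val]
  refine ⟨div_ne_zero (fun h => ht ?_) hq.2.2, fun h => hs (sub_eq_zero.1 h), fun h => ht0 ?_,
    by simpa using h1, by simpa using h1⟩
  · rw [eq_div_iff h1]
    exact (sub_eq_zero.1 h).symm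
  · rw [eq_div_iff hs0, mul_comm]
    exact (sub_eq_zero.1 h).symm

/-- Applied for `(p, q)` and for `(q, p)`, this gives a two-sided inverse on the full domains, with
no further shrinking. -/
theorem ybMap_swap {K : Type*} [Field K] {p q : Params K} (hp : p ∈ admissible K)
    (hq : q ∈ admissible K) {w : Pt K × Pt K} (h : w ∈ ybDomain p q) :
    (ybMap p q w).swap ∈ ybDomain q p ∧ ybMap q p (ybMap p q w).swap = w.swap := by
  obtain ⟨x, y⟩ := w
  obtain ⟨hU, hV, hD, -, -⟩ := (mem_ybDomain_iff hp hq).1 h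
  have him := isImage_ybMap hp hq h
  have h1 : (ybMap p q (x, y)).swap ∈ ybDomain q p := by
    refine (mem_ybDomain_iff hq hp).2 ⟨fun h0 => ?_, fun h0 => ?_, ?_, fun h0 => ?_, fun h0 => ?_⟩
    · have := him.scaleU_swap hp hq hD
      rw [h0, zero_mul] at this
      exact hD this.symm
    · have := him.scaleV_swap hp hq hD
      rw [h0, zero_mul] at this
      exact hD this.symm
    · rwa [him.disc_swap hp hq hU hV hD]
    -- The position factors in the domain criterion at the reversed pair are the negatives of `E1`
    -- and `E2` at the original one.
    · exact h.2.2.1 (by rw [← neg_eq_zero, ← h0]; simp [ybMap, E1])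
    · exact h.2.2.2 (by rw [← neg_eq_zero, ← h0]; simp [ybMap, E2])
  exact ⟨h1, ((him.swap hp hq hU hV hD).eq_ybMap hq hp h1).symm⟩

/-! ### Regular dependence on points and parameters -/

section Regular

variable {F σ : Type*} [Field F] {S S' : Set (σ → F)}

/-- The coordinates of `x` are regular functions. -/
def IsRegularPt (S : Set (σ → F)) (x : (σ → F) → Pt F) : Prop :=
  ∀ i, IsRegular S fun s => x s i

theorem IsRegularPt.mono {x : (σ → F) → Pt F} (h : IsRegularPt S x) (hS : S' ⊆ S) :
    IsRegularPt S' x :=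
  fun i => (h i).mono hS

/-- The parameters `p` are regular functions, and they are admissible. -/
structure IsRegularParams (S : Set (σ → F)) (p : (σ → F) → Params F) : Prop where
  mem : ∀ s ∈ S, p s ∈ admissible F
  c1 : IsRegular S fun s => (p s).c1
  c2 : IsRegular S fun s => (p s).c2
  a1 : IsRegular S fun s => (p s).a1
  a2 : IsRegular S fun s => (p s).a2
  a3 : IsRegular S fun s => (p s).a3

theorem IsRegularParams.mono {p : (σ → F) → Params F} (h : IsRegularParams S p) (hS : S' ⊆ S) :
    IsRegularParams S' p :=
  ⟨fun s hs => h.mem s (hS hs), h.c1.mono hS, h.c2.mono hS, h.a1.mono hS, h.a2.mono hS,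
    h.a3.mono hS⟩

theorem isRegularParams_const {p : Params F} (hp : p ∈ admissible F) :
    IsRegularParams S fun _ => p :=
  ⟨fun _ _ => hp, isRegular_const _, isRegular_const _, isRegular_const _, isRegular_const _,
    isRegular_const _⟩

variable {p q r : (σ → F) → Params F} {x y z : (σ → F) → Pt F}

theorem isRegular_C1 (hp : IsRegularParams S p) (hq : IsRegularParams S q) :
    IsRegular S fun s => C1 (p s) (q s) :=
  (((hp.a2.mul hp.a3).mul hq.a1).mul (hq.c1.sub ((isRegular_const 2).mul hq.c2))).sub
    (((hq.a1.mul hq.a2).mul hq.a3).mul (hp.c1.sub ((isRegular_const 2).mul hp.c2)))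

theorem isRegular_C2 (hp : IsRegularParams S p) (hq : IsRegularParams S q) :
    IsRegular S fun s => C2 (p s) (q s) :=
  (((hq.a2.mul hq.a3).div hp.a3 fun s hs => (hp.mem s hs).2.2).mul (hp.c1.add hp.c2)).sub
    (hp.a2.mul (hq.c1.add hq.c2))

theorem isRegular_D1 (hp : IsRegularParams S p) (hq : IsRegularParams S q)
    (hx : IsRegularPt S x) (hy : IsRegularPt S y) :
    IsRegular S fun s => D1 (p s) (q s) (x s) (y s) :=
  (((((((hp.a2.mul hp.a3).mul hq.a2).mul hq.a3).mul
    ((hp.a3.mul (hx 0)).sub (hq.a1.mul (hy 0)))).mul (hy 2)).add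
    (((((hp.a2.mul hp.a3).mul hq.a1).mul hq.a3).mul
    ((hp.a3.mul (hx 1)).sub (hq.a2.mul (hy 1)))).mul (hy 3))).add (isRegular_C1 hp hq)).add
    (((((isRegular_const 3).mul hp.a2).mul hp.a3).mul hq.a1).mul hq.c2)

theorem isRegular_D2 (hp : IsRegularParams S p) (hq : IsRegularParams S q)
    (hx : IsRegularPt S x) (hy : IsRegularPt S y) :
    IsRegular S fun s => D2 (p s) (q s) (x s) (y s) :=
  (((((((hp.a2.mul hq.a1).mul hq.a2).mul hq.a3).mul
    ((hp.a3.mul (hx 0)).sub (hq.a1.mul (hy 0)))).mul (hx 2)).add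
    (((((hp.a2.mul hq.a1).mul hq.a2).mul hq.a3).mul
    ((hp.a3.mul (hx 1)).sub (hq.a2.mul (hy 1)))).mul (hx 3))).sub (isRegular_C1 hp hq)).sub
    (((((isRegular_const 3).mul hp.a2).mul hp.a3).mul hq.a1).mul hq.c2)

theorem isRegular_u1 (hp : IsRegularParams S p) (hq : IsRegularParams S q) (hx : IsRegularPt S x)
    (hy : IsRegularPt S y) (h : ∀ s ∈ S, D1 (p s) (q s) (x s) (y s) ≠ 0) :
    IsRegular S fun s => u1 (p s) (q s) (x s) (y s) :=
  have hr := hq.a3.div hp.a3 fun s hs => (hp.mem s hs).2.2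
  (hr.mul (hy 0)).add ((hr.mul ((isRegular_C1 hp hq).div (isRegular_D1 hp hq hx hy) h)).mul
    (((hp.a3.div hq.a1 fun s hs => (hq.mem s hs).1).mul (hx 0)).sub (hy 0)))

theorem isRegular_u2 (hp : IsRegularParams S p) (hq : IsRegularParams S q) (hx : IsRegularPt S x)
    (hy : IsRegularPt S y) (h : ∀ s ∈ S, D1 (p s) (q s) (x s) (y s) ≠ 0) :
    IsRegular S fun s => u2 (p s) (q s) (x s) (y s) :=
  have hr := hq.a3.div hp.a3 fun s hs => (hp.mem s hs).2.2
  (hr.mul (hy 1)).add ((hr.mul ((isRegular_C1 hp hq).div (isRegular_D1 hp hq hx hy) h)).mul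
    (((hp.a3.div hq.a2 fun s hs => (hq.mem s hs).2.1).mul (hx 1)).sub (hy 1)))

theorem isRegular_v1 (hp : IsRegularParams S p) (hq : IsRegularParams S q) (hx : IsRegularPt S x)
    (hy : IsRegularPt S y) (h : ∀ s ∈ S, D2 (p s) (q s) (x s) (y s) ≠ 0) :
    IsRegular S fun s => v1 (p s) (q s) (x s) (y s) :=
  ((hp.a1.div hq.a1 fun s hs => (hq.mem s hs).1).mul (hx 0)).sub
    ((hq.a1.mul ((isRegular_C2 hp hq).div (isRegular_D2 hp hq hx hy) h)).mul
    (hp.a1.mul (((hp.a3.div hq.a1 fun s hs => (hq.mem s hs).1).mul (hx 0)).sub (hy 0))))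

theorem isRegular_v2 (hp : IsRegularParams S p) (hq : IsRegularParams S q) (hx : IsRegularPt S x)
    (hy : IsRegularPt S y) (h : ∀ s ∈ S, D2 (p s) (q s) (x s) (y s) ≠ 0) :
    IsRegular S fun s => v2 (p s) (q s) (x s) (y s) :=
  ((hp.a2.div hq.a2 fun s hs => (hq.mem s hs).2.1).mul (hx 1)).sub
    ((hq.a1.mul ((isRegular_C2 hp hq).div (isRegular_D2 hp hq hx hy) h)).mul
    (hp.a2.mul (((hp.a3.div hq.a2 fun s hs => (hq.mem s hs).2.1).mul (hx 1)).sub (hy 1))))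

theorem isPrincipal_ybDomain (hS : IsPrincipal S) (hp : IsRegularParams S p)
    (hq : IsRegularParams S q) (hx : IsRegularPt S x) (hy : IsRegularPt S y) :
    IsPrincipal {s | s ∈ S ∧ (x s, y s) ∈ ybDomain (p s) (q s)} := by
  have h2 := (hS.and_ne_zero (isRegular_D1 hp hq hx hy)).and_ne_zero
    ((isRegular_D2 hp hq hx hy).mono fun s hs => hs.1)
  set S2 := {s | s ∈ {s | s ∈ S ∧ D1 (p s) (q s) (x s) (y s) ≠ 0} ∧
    D2 (p s) (q s) (x s) (y s) ≠ 0} with hS2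
  have hsub : S2 ⊆ S := fun s hs => hs.1.1
  have hp' := hp.mono hsub
  have hq' := hq.mono hsub
  have hx' := hx.mono hsub
  have hy' := hy.mono hsub
  have e1 : IsRegular S2 fun s => E1 (p s) (q s) (x s) (y s) :=
    (hp'.a1.mul (isRegular_u1 hp' hq' hx' hy' fun s hs => hs.1.2)).sub
      (hq'.a3.mul (isRegular_v1 hp' hq' hx' hy' fun s hs => hs.2))
  have e2 : IsRegular S2 fun s => E2 (p s) (q s) (x s) (y s) :=
    (hp'.a2.mul (isRegular_u2 hp' hq' hx' hy' fun s hs => hs.1.2)).sub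
      (hq'.a3.mul (isRegular_v2 hp' hq' hx' hy' fun s hs => hs.2))
  obtain ⟨Q, hQ⟩ := (h2.and_ne_zero e1).and_ne_zero (e2.mono fun s hs => hs.1)
  refine ⟨Q, fun s => ?_⟩
  rw [← hQ s]
  simp only [hS2, ybDomain, Set.mem_ofPred_eq]
  tauto

theorem isRegularPt_ybMap (hp : IsRegularParams S p) (hq : IsRegularParams S q)
    (hx : IsRegularPt S x) (hy : IsRegularPt S y)
    (h : ∀ s ∈ S, (x s, y s) ∈ ybDomain (p s) (q s)) :
    IsRegularPt S (fun s => (ybMap (p s) (q s) (x s, y s)).1) ∧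
      IsRegularPt S fun s => (ybMap (p s) (q s) (x s, y s)).2 := by
  have hu1 := isRegular_u1 hp hq hx hy fun s hs => (h s hs).1
  have hu2 := isRegular_u2 hp hq hx hy fun s hs => (h s hs).1
  have hv1 := isRegular_v1 hp hq hx hy fun s hs => (h s hs).2.1
  have hv2 := isRegular_v2 hp hq hx hy fun s hs => (h s hs).2.1
  have e1 : IsRegular S fun s => E1 (p s) (q s) (x s) (y s) :=
    (hp.a1.mul hu1).sub (hq.a3.mul hv1)
  have e2 : IsRegular S fun s => E2 (p s) (q s) (x s) (y s) :=
    (hp.a2.mul hu2).sub (hq.a3.mul hv2)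
  have n1 : ∀ s ∈ S, E1 (p s) (q s) (x s) (y s) ≠ 0 := fun s hs => (h s hs).2.2.1
  have n2 : ∀ s ∈ S, E2 (p s) (q s) (x s) (y s) ≠ 0 := fun s hs => (h s hs).2.2.2
  constructor
  · intro i
    fin_cases i
    · exact hu1
    · exact hu2
    · exact ((((hp.a1.mul (hx 0)).sub (hq.a1.mul hv1)).mul (hx 2)).add
        (((hp.a1.mul (hy 0)).sub (hp.a3.mul hv1)).mul (hy 2))).div e1 n1
    · exact ((((hp.a2.mul (hx 1)).sub (hq.a2.mul hv2)).mul (hx 3)).add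
        (((hp.a2.mul (hy 1)).sub (hp.a3.mul hv2)).mul (hy 3))).div e2 n2
  · intro i
    fin_cases i
    · exact hv1
    · exact hv2
    · exact ((((hq.a1.mul hu1).sub (hq.a3.mul (hx 0))).mul (hx 2)).add
        (((hp.a3.mul hu1).sub (hq.a3.mul (hy 0))).mul (hy 2))).div e1 n1
    · exact ((((hq.a2.mul hu2).sub (hq.a3.mul (hx 1))).mul (hx 3)).add
        (((hp.a3.mul hu2).sub (hq.a3.mul (hy 1))).mul (hy 3))).div e2 n2

theorem isPrincipal_ybDomain_sum {p q : Params F} (hp : p ∈ admissible F)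
    (hq : q ∈ admissible F) :
    IsPrincipal {w : Fin 4 ⊕ Fin 4 → F | (w ∘ Sum.inl, w ∘ Sum.inr) ∈ ybDomain p q} := by
  have h := isPrincipal_ybDomain (p := fun _ => p) (q := fun _ => q)
    (x := fun w : Fin 4 ⊕ Fin 4 → F => w ∘ Sum.inl) (y := fun w => w ∘ Sum.inr)
    isPrincipal_univ (isRegularParams_const hp) (isRegularParams_const hq)
    (fun i => isRegular_coord (Sum.inl i)) fun i => isRegular_coord (Sum.inr i)
  simpa using h

theorem isBirationalPair_ybMap [Infinite F] {p q : Params F} (hp : p ∈ admissible F)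
    (hq : q ∈ admissible F) : IsBirationalPair (ybDomain p q) (ybMap p q) := by
  have hS := isPrincipal_ybDomain_sum hp hq
  have hS' := (isPrincipal_ybDomain (p := fun _ => q) (q := fun _ => p)
    (x := fun w : Fin 4 ⊕ Fin 4 → F => w ∘ Sum.inr) (y := fun w => w ∘ Sum.inl)
    isPrincipal_univ (isRegularParams_const hq) (isRegularParams_const hp)
    (fun i => isRegular_coord (Sum.inr i)) fun i => isRegular_coord (Sum.inl i))
  have hne := ybDomain_nonempty hp hq
  simp only [Set.mem_univ, true_and] at hS'
  set S := {w : Fin 4 ⊕ Fin 4 → F | (w ∘ Sum.inl, w ∘ Sum.inr) ∈ ybDomain p q} with hSdef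
  set S' := {w : Fin 4 ⊕ Fin 4 → F | (w ∘ Sum.inr, w ∘ Sum.inl) ∈ ybDomain q p} with hSdef'
  have h1 := isRegularPt_ybMap (S := S) (p := fun _ => p) (q := fun _ => q)
    (x := fun w => w ∘ Sum.inl) (y := fun w => w ∘ Sum.inr)
    (isRegularParams_const hp) (isRegularParams_const hq)
    (fun i => isRegular_coord (Sum.inl i)) (fun i => isRegular_coord (Sum.inr i)) fun s hs => hs
  have h2 := isRegularPt_ybMap (S := S') (p := fun _ => q) (q := fun _ => p)
    (x := fun w => w ∘ Sum.inr) (y := fun w => w ∘ Sum.inl)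
    (isRegularParams_const hq) (isRegularParams_const hp)
    (fun i => isRegular_coord (Sum.inr i)) (fun i => isRegular_coord (Sum.inl i)) fun s hs => hs
  refine isBirational_of_isPrincipal (T := Set.univ) hS hS' isPrincipal_univ ?_ (fun z hz => hz.1)
    (fun z _ => rfl) (g := fun w => Sum.elim (ybMap q p (w ∘ Sum.inr, w ∘ Sum.inl)).2
      (ybMap q p (w ∘ Sum.inr, w ∘ Sum.inl)).1) ?_ ?_ ?_ ?_
  · obtain ⟨⟨x, y⟩, h⟩ := hne
    exact ⟨Sum.elim x y, by simpa [hSdef] using h, trivial⟩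
  · rintro (i | i)
    · exact h1.1 i
    · exact h1.2 i
  · rintro (i | i)
    · exact h2.2 i
    · exact h2.1 i
  · intro z hz
    have h3 := ybMap_swap hp hq hz
    have h4 : ybMap q p ((ybMap p q (z ∘ Sum.inl, z ∘ Sum.inr)).2,
      (ybMap p q (z ∘ Sum.inl, z ∘ Sum.inr)).1) = (z ∘ Sum.inr, z ∘ Sum.inl) := h3.2
    refine ⟨h3.1, ?_⟩
    simp only [Sum.elim_comp_inr, Sum.elim_comp_inl, h4]
    exact Sum.elim_comp_inl_inr z
  · intro z hz
    have h3 := ybMap_swap hq hp hz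
    have h4 : ybMap p q ((ybMap q p (z ∘ Sum.inr, z ∘ Sum.inl)).2,
      (ybMap q p (z ∘ Sum.inr, z ∘ Sum.inl)).1) = (z ∘ Sum.inl, z ∘ Sum.inr) := h3.2
    refine ⟨h3.1, ?_⟩
    simp only [Sum.elim_comp_inr, Sum.elim_comp_inl, h4]
    exact Sum.elim_comp_inl_inr z

end Regular

/-! ### Refactorisation -/

section RankOne

variable {K : Type*} [Field K]

/-- A rank one perturbation of a multiple of a diagonal matrix. -/
def rankOne (s : K) (d c r : Fin 3 → K) : Matrix (Fin 3) (Fin 3) K :=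
  s • Matrix.diagonal d + Matrix.vecMulVec c r

theorem rankOne_apply (s : K) (d c r : Fin 3 → K) (i j : Fin 3) :
    rankOne s d c r i j = s * Matrix.diagonal d i j + c i * r j := by
  simp [rankOne, Matrix.vecMulVec_apply]

theorem rankOne_mul_apply (s t : K) (d c r d' c' r' : Fin 3 → K) (i j : Fin 3) :
    (rankOne s d c r * rankOne t d' c' r') i j = s * t * Matrix.diagonal (d * d') i j +
      s * d i * c' i * r' j + t * c i * r j * d' j + (∑ k, r k * c' k) * c i * r' j := by
  simp only [rankOne, Matrix.mul_add, Matrix.add_mul, Matrix.smul_mul, Matrix.mul_smul,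
    Matrix.diagonal_mul_diagonal, Matrix.vecMulVec_mul_vecMulVec, Matrix.add_apply,
    Matrix.smul_apply, Matrix.diagonal_mul, Matrix.mul_diagonal, Matrix.vecMulVec_apply,
    smul_eq_mul, Pi.smul_apply, dotProduct]
  simp only [Pi.mul_def]
  ring

theorem vecMul_rankOne (s : K) (d c r w : Fin 3 → K) (j : Fin 3) :
    Matrix.vecMul w (rankOne s d c r) j = s * w j * d j + (∑ k, w k * c k) * r j := by
  simp only [rankOne, Matrix.vecMul_add, Matrix.vecMul_smul, Matrix.vecMul_vecMulVec,
    Pi.add_apply, Pi.smul_apply, Matrix.vecMul_diagonal, smul_eq_mul, dotProduct]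
  ring

theorem rankOne_mulVec (s : K) (d c r w : Fin 3 → K) (i : Fin 3) :
    Matrix.mulVec (rankOne s d c r) w i = s * d i * w i + (∑ k, r k * w k) * c i := by
  simp only [rankOne, Matrix.add_mulVec, Matrix.smul_mulVec, Matrix.vecMulVec_mulVec,
    Pi.add_apply, Pi.smul_apply, Matrix.mulVec_diagonal, smul_eq_mul, dotProduct,
    MulOpposite.smul_eq_mul_unop, MulOpposite.unop_op]
  ring

theorem rankOne_zero (d c r : Fin 3 → K) : rankOne 0 d c r = Matrix.vecMulVec c r := by
  rw [rankOne, zero_smul, zero_add]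

/-- The matrix proportional to the inverse of the Lax matrix. -/
def laxAdj (x : Pt K) (p : Params K) (lam : K) : Matrix (Fin 3) (Fin 3) K :=
  rankOne (root2 p - lam) (fun k => (diagVec p k)⁻¹) (fun k => -(laxCol p x k / diagVec p k))
    (fun k => laxRow p x k / diagVec p k)

variable {p q : Params K}

theorem lax_eq_rankOne (hp : p ∈ admissible K) (x : Pt K) (lam : K) :
    lax x p lam = rankOne (root1 p - lam) (diagVec p) (laxCol p x) (laxRow p x) :=
  lax_eq hp x lam

theorem lax_mul_laxAdj (hp : p ∈ admissible K) (x : Pt K) (lam : K) :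
    lax x p lam * laxAdj x p lam = ((root1 p - lam) * (root2 p - lam)) • 1 := by
  ext i j
  have h := sum_row_mul_col hp x
  have h1 : ∑ k, laxRow p x k * -(laxCol p x k / diagVec p k) = -gap p := by
    rw [← h, ← Finset.sum_neg_distrib]
    exact Finset.sum_congr rfl fun k _ => by ring
  have h2 : (diagVec p * fun k => (diagVec p k)⁻¹) = 1 := by
    ext k
    simp [diagVec_ne_zero hp k]
  rw [lax_eq_rankOne hp, laxAdj, rankOne_mul_apply, h1, h2, root2_eq]
  have hi := diagVec_ne_zero hp i
  have hj := diagVec_ne_zero hp j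
  simp only [Matrix.diagonal_one', Matrix.smul_apply, smul_eq_mul]
  field_simp
  ring

theorem laxAdj_mul_lax (hp : p ∈ admissible K) (x : Pt K) (lam : K) :
    laxAdj x p lam * lax x p lam = ((root1 p - lam) * (root2 p - lam)) • 1 := by
  ext i j
  have h := sum_row_mul_col hp x
  have h1 : ∑ k, laxRow p x k / diagVec p k * laxCol p x k = gap p := by
    rw [← h]
    exact Finset.sum_congr rfl fun k _ => by ring
  have h2 : ((fun k => (diagVec p k)⁻¹) * diagVec p) = 1 := by
    ext k
    simp [diagVec_ne_zero hp k]
  rw [lax_eq_rankOne hp, laxAdj, rankOne_mul_apply, h1, h2, root2_eq]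
  have hi := diagVec_ne_zero hp i
  have hj := diagVec_ne_zero hp j
  simp only [Matrix.diagonal_one', Matrix.smul_apply, smul_eq_mul]
  field_simp
  ring

variable {x y u v : Pt K}

/-- The diagonal parts of the two products agree. In the remaining terms the normalisers of rows and
columns cancel, so multiplying by `disc` leaves an identity bilinear in the old columns and rows. -/
theorem IsImage.refactors (h : IsImage p q x y u v) (hp : p ∈ admissible K)
    (hq : q ∈ admissible K) (hV : scaleV p q x y ≠ 0) (hD : disc p q x y ≠ 0) :
    Refactors p q x y u v := by
  intro lam
  ext i j
  simp only [lax_eq_rankOne hp, lax_eq_rankOne hq, rankOne_mul_apply]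
  have e0 : ∑ k, laxRow p u k * laxCol q v k = phi q p v u := rfl
  have e1 : ∑ k, laxRow q y k * laxCol p x k = phi p q x y := rfl
  have e2 := h.phi_swap hp hq hD
  have hd : disc p q x y = del1 p q * del2 p q - phi p q x y * psi p q x y := rfl
  have hs : root1 q - lam = (root1 p - lam) + del1 p q := by
    simp only [del1]
    ring
  rw [e0, e1, hs, mul_comm (diagVec q)]
  have c1 := h.col_fst i
  have c2 := h.col_snd i
  have r1 := h.row_fst j
  have r2 := h.row_snd j
  set X := diagVec q i * laxCol p x i
  set Y := laxCol q y i
  set a := laxRow p x j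
  set b := diagVec p j * laxRow q y j
  -- The three terms `k1`, `k2`, `k3` are the nondiagonal parts of the left product: the two single
  -- rank one terms and their mixed term.
  have k1 : disc p q x y * (diagVec p i * laxCol q v i * laxRow q v j) =
      -((psi p q x y * X + del2 p q * Y) * (phi p q x y * a - del1 p q * b)) := by
    apply mul_left_cancel₀ hV
    linear_combination (scaleV p q x y * laxRow q v j) * c2 -
      scaleV p q x y * (psi p q x y * X + del2 p q * Y) * r2
  have k2 : disc p q x y * (laxCol p u i * laxRow p u j * diagVec q j) =
      (del1 p q * X + phi p q x y * Y) * (del2 p q * a - psi p q x y * b) := by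
    linear_combination (laxRow p u j * diagVec q j) * c1 +
      (del1 p q * X + phi p q x y * Y) * r1
  have k3 : disc p q x y * (phi q p v u * laxCol p u i * laxRow q v j) =
      -(psi p q x y * (del1 p q * X + phi p q x y * Y) *
        (phi p q x y * a - del1 p q * b)) := by
    apply mul_left_cancel₀ hV
    linear_combination (scaleV p q x y * phi q p v u * laxRow q v j) * c1 +
      (del1 p q * X + phi p q x y * Y) * scaleV p q x y * laxRow q v j * e2 -
      scaleV p q x y * psi p q x y * (del1 p q * X + phi p q x y * Y) * r2
  apply mul_left_cancel₀ hD
  linear_combination (root1 p - lam) * k1 + (root1 p - lam + del1 p q) * k2 + k3 -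
    ((root1 p - lam) * (X * a + Y * b) + (del1 p q * X + phi p q x y * Y) * a) * hd

/-- Away from the roots this is the inverse of the factorisation, up to a common scalar. Entries are
polynomial in `λ`, so it persists at the roots, which is where it is needed. -/
theorem Refactors.adj [Infinite K] (h : Refactors p q x y u v) (hp : p ∈ admissible K)
    (hq : q ∈ admissible K) (lam : K) :
    laxAdj v q lam * laxAdj u p lam = laxAdj x p lam * laxAdj y q lam := by
  have hreg : ∀ (p : Params K) (x : Pt K) (i j : Fin 3),
      IsRegular (Set.univ : Set (Unit → K)) fun z => laxAdj x p (z ()) i j := by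
    intro p x i j
    simp only [laxAdj, rankOne_apply]
    exact (((isRegular_const _).sub (isRegular_coord ())).mul (isRegular_const _)).add
      (isRegular_const _)
  have hc : ∀ c : K, IsRegular (Set.univ : Set (Unit → K)) fun z => c - z () :=
    fun c => (isRegular_const c).sub (isRegular_coord ())
  have hT := isPrincipal_univ.and_ne_zero
    (((hc (root1 p)).mul (hc (root2 p))).mul ((hc (root1 q)).mul (hc (root2 q))))
  ext i j
  simp only [Matrix.mul_apply]
  refine IsRegular.eq_of_eqOn (z := fun _ => lam)
    (f := fun z => ∑ k, laxAdj v q (z ()) i k * laxAdj u p (z ()) k j)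
    (g := fun z => ∑ k, laxAdj x p (z ()) i k * laxAdj y q (z ()) k j)
    isPrincipal_univ hT ?_ ?_ ?_ ?_ trivial
  · classical
    obtain ⟨c, hc⟩ := Infinite.exists_notMem_finset {root1 p, root2 p, root1 q, root2 q}
    refine ⟨fun _ => c, trivial, ?_⟩
    simp only [Finset.mem_insert, Finset.mem_singleton, not_or] at hc
    obtain ⟨h1, h2, h3, h4⟩ := hc
    exact mul_ne_zero (mul_ne_zero (sub_ne_zero.2 (Ne.symm h1)) (sub_ne_zero.2 (Ne.symm h2)))
      (mul_ne_zero (sub_ne_zero.2 (Ne.symm h3)) (sub_ne_zero.2 (Ne.symm h4)))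
  · exact IsRegular.sum fun k _ => (hreg q v i k).mul (hreg p u k j)
  · exact IsRegular.sum fun k _ => (hreg p x i k).mul (hreg q y k j)
  · rintro z - ⟨-, hz⟩
    have key : laxAdj v q (z ()) * laxAdj u p (z ()) * (lax u p (z ()) * lax v q (z ())) *
        (laxAdj x p (z ()) * laxAdj y q (z ())) =
        laxAdj v q (z ()) * laxAdj u p (z ()) * (lax y q (z ()) * lax x p (z ())) *
        (laxAdj x p (z ()) * laxAdj y q (z ())) := by rw [h (z ())]
    have l1 : laxAdj v q (z ()) * laxAdj u p (z ()) * (lax u p (z ()) * lax v q (z ())) =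
        ((root1 p - z ()) * (root2 p - z ()) * ((root1 q - z ()) * (root2 q - z ()))) • 1 := by
      calc _ = laxAdj v q (z ()) * (laxAdj u p (z ()) * lax u p (z ())) * lax v q (z ()) := by
            simp only [Matrix.mul_assoc]
        _ = _ := by
            rw [laxAdj_mul_lax hp, Matrix.mul_smul, Matrix.mul_one, Matrix.smul_mul,
              laxAdj_mul_lax hq, smul_smul]
    have l2 : lax y q (z ()) * lax x p (z ()) * (laxAdj x p (z ()) * laxAdj y q (z ())) =
        ((root1 p - z ()) * (root2 p - z ()) * ((root1 q - z ()) * (root2 q - z ()))) • 1 := by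
      calc _ = lax y q (z ()) * (lax x p (z ()) * laxAdj x p (z ())) * laxAdj y q (z ()) := by
            simp only [Matrix.mul_assoc]
        _ = _ := by
            rw [lax_mul_laxAdj hp, Matrix.mul_smul, Matrix.mul_one, Matrix.smul_mul,
              lax_mul_laxAdj hq, smul_smul]
    rw [l1, Matrix.mul_assoc (laxAdj v q (z ()) * laxAdj u p (z ())), l2, Matrix.smul_mul,
      Matrix.one_mul, Matrix.mul_smul, Matrix.mul_one] at key
    have key2 := smul_right_injective _ hz key
    have := congrFun (congrFun key2 i) j
    simpa only [Matrix.mul_apply] using this.symm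

theorem laxCol_ne_zero [CharZero K] (hp : p ∈ admissible K) (h : Nonscalar p x) :
    ∃ k, laxCol p x k ≠ 0 := by
  by_contra! h0
  have h1 : x 2 = 0 := h0 0
  have h2 : x 3 = 0 := h0 1
  have h3 : p.a3 * (x 0 * x 2 + x 1 * x 3) - 3 * p.c2 / p.a2 = 0 := h0 2
  rw [h1, h2] at h3
  have h4 : p.c2 = 0 := by simpa [hp.2.1] using h3
  rcases h with h | h | h <;> contradiction

theorem eq_and_eq_of_linear {a c U V X Y X' Y' : K} (hE : a * U - c * V ≠ 0) (ha : a ≠ 0)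
    (h1 : a * Y + c * X = a * Y' + c * X') (h2 : V * Y + U * X = V * Y' + U * X') :
    X = X' ∧ Y = Y' := by
  have h3 : X = X' := by
    apply mul_left_cancel₀ hE
    linear_combination a * h2 - V * h1
  refine ⟨h3, ?_⟩
  subst h3
  apply mul_left_cancel₀ ha
  linear_combination h1

/-- Uniqueness of the refactorisation. -/
theorem Refactors.unique [CharZero K] (hp : p ∈ admissible K) (hq : q ∈ admissible K)
    (hd : (x, y) ∈ ybDomain p q) (hx : Nonscalar p x) (hy : Nonscalar q y)
    (h : Refactors p q x y u v) : (u, v) = ybMap p q (x, y) := by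
  obtain ⟨hU, hV, hD, -, -⟩ := (mem_ybDomain_iff hp hq).1 hd
  have him := isImage_ybMap hp hq hd
  have h' := him.refactors hp hq hV hD
  set u' := (ybMap p q (x, y)).1
  set v' := (ybMap p q (x, y)).2
  have hA := diagVec_ne_zero hp
  have hB := diagVec_ne_zero hq
  -- At `λ = root1 q` the factors at `v` and `y` reduce to their rank one parts. A nonzero entry of
  -- the column of `y` exposes the row of `v` up to a scalar, and the last entry 1 fixes the scalar.
  have hv : laxRow q v = laxRow q v' := by
    obtain ⟨i, hi⟩ := laxCol_ne_zero hq hy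
    have key : ∀ j, Matrix.mulVec (lax u p (root1 q)) (laxCol q v) i * laxRow q v j =
        laxCol q y i * (scaleV p q x y * laxRow q v' j) := by
      intro j
      have e := congrFun (congrFun (h (root1 q)) i) j
      rw [lax_eq_rankOne hq, lax_eq_rankOne hq, sub_self, rankOne_zero, rankOne_zero,
        Matrix.mul_vecMulVec, Matrix.vecMulVec_mul, Matrix.vecMulVec_apply,
        Matrix.vecMulVec_apply, lax_eq_rankOne hp x, vecMul_rankOne] at e
      rw [e, him.row_snd j]
      simp only [phi, del1]
      ring
    have k2 := key 2
    have e2 : ∀ v : Pt K, laxRow q v 2 = 1 := fun v => rfl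
    rw [e2, e2, mul_one, mul_one] at k2
    ext j
    have := key j
    rw [k2, mul_assoc] at this
    exact mul_left_cancel₀ hV (mul_left_cancel₀ hi this)
  -- The same argument for the inverted factorisation at `λ = root2 p`, with a nonzero entry of the
  -- column of `x`.
  have hu : laxRow p u = laxRow p u' := by
    obtain ⟨i, hi⟩ := laxCol_ne_zero hp hx
    have key : ∀ j, Matrix.mulVec (laxAdj v q (root2 p))
          (fun k => -(laxCol p u k / diagVec p k)) i * laxRow p u j =
        -(laxCol p x i / diagVec p i) * (scaleU p q x y * laxRow p u' j) := by
      intro j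
      have e := congrFun (congrFun (h.adj hp hq (root2 p)) i) j
      rw [laxAdj.eq_def u, laxAdj.eq_def x, sub_self, rankOne_zero, rankOne_zero,
        Matrix.mul_vecMulVec, Matrix.vecMulVec_mul, Matrix.vecMulVec_apply,
        Matrix.vecMulVec_apply, laxAdj.eq_def y, vecMul_rankOne] at e
      have e3 := him.row_fst j
      have e4 : ∑ k, laxRow p x k / diagVec p k * -(laxCol q y k / diagVec q k) =
          -psi p q x y := by
        rw [psi, ← Finset.sum_neg_distrib]
        exact Finset.sum_congr rfl fun k _ => by ring
      rw [e4] at e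
      have hAj := hA j
      have hBj := hB j
      have e5 : root2 q - root2 p = del2 p q := rfl
      rw [e5] at e
      apply mul_right_cancel₀ (inv_ne_zero hAj)
      have e6 : scaleU p q x y * laxRow p u' j * (diagVec p j)⁻¹ =
          del2 p q * (laxRow p x j / diagVec p j) * (diagVec q j)⁻¹ +
            -psi p q x y * (laxRow q y j / diagVec q j) := by
        field_simp
        linear_combination e3
      rw [mul_assoc _ _ (diagVec p j)⁻¹, mul_assoc _ (scaleU p q x y * _), e6, ← e,
        div_eq_mul_inv (laxRow p u j)]
    have k2 := key 2
    have e2 : ∀ v : Pt K, laxRow p v 2 = 1 := fun v => rfl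
    rw [e2, e2, mul_one, mul_one] at k2
    ext j
    have := key j
    rw [k2, mul_assoc] at this
    exact mul_left_cancel₀ hU (mul_left_cancel₀ (neg_ne_zero.2 (div_ne_zero hi (hA i))) this)
  -- Subtracting two values of `λ` removes the mixed term, which is quadratic in the unknown
  -- columns; what remains is linear in them.
  have hlin : ∀ i j, diagVec p i * laxCol q v i * laxRow q v' j +
      laxCol p u i * laxRow p u' j * diagVec q j =
      diagVec p i * laxCol q v' i * laxRow q v' j +
      laxCol p u' i * laxRow p u' j * diagVec q j := by
    intro i j
    have k0 := congrFun (congrFun ((h (root1 p)).trans (h' (root1 p)).symm) i) j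
    have k1 := congrFun (congrFun ((h (root1 p - 1)).trans (h' (root1 p - 1)).symm) i) j
    simp only [lax_eq_rankOne hp, lax_eq_rankOne hq, rankOne_mul_apply, hu, hv] at k0 k1
    linear_combination k1 - k0
  -- Entries `(0, 2)` and `(0, 0)` form a two by two system for the first momenta, whose determinant
  -- is `E1` up to sign.
  have f1 := eq_and_eq_of_linear (U := u' 0) (V := v' 0) (X := u 2) (X' := u' 2) (Y := v 2)
    (Y' := v' 2) (a := p.a1) (c := q.a3) hd.2.2.1 hp.1
    (by
      have := hlin 0 2
      simp only [laxRow, laxCol, diagVec, Matrix.cons_val] at this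
      linear_combination this)
    (by
      have := hlin 0 0
      simp only [laxRow, laxCol, diagVec, Matrix.cons_val] at this
      apply mul_left_cancel₀ (mul_ne_zero hp.1 hq.1)
      linear_combination -this)
  have f2 := eq_and_eq_of_linear (U := u' 1) (V := v' 1) (X := u 3) (X' := u' 3) (Y := v 3)
    (Y' := v' 3) (a := p.a2) (c := q.a3) hd.2.2.2 hp.2.1
    (by
      have := hlin 1 2
      simp only [laxRow, laxCol, diagVec, Matrix.cons_val] at this
      linear_combination this)
    (by
      have := hlin 1 1
      simp only [laxRow, laxCol, diagVec, Matrix.cons_val] at this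
      apply mul_left_cancel₀ (mul_ne_zero hp.2.1 hq.2.1)
      linear_combination -this)
  refine Prod.ext (pt_ext hp hu fun k hk => ?_) (pt_ext hq hv fun k hk => ?_)
  · fin_cases k
    · exact f1.1
    · exact f2.1
    · exact absurd rfl hk
  · fin_cases k
    · exact f1.2
    · exact f2.2
    · exact absurd rfl hk

theorem isStrongLax [CharZero K] (hp : p ∈ admissible K) (hq : q ∈ admissible K) :
    IsStrongLax p q := by
  intro x y hd
  obtain ⟨-, hV, hD, -, -⟩ := (mem_ybDomain_iff hp hq).1 hd
  have h := (isImage_ybMap hp hq hd).refactors hp hq hV hD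
  refine ⟨h, fun hx hy u v => ⟨fun h' => h'.unique hp hq hd hx hy, fun h' => ?_⟩⟩
  rw [← h'] at h
  exact h

end RankOne

/-! ### The Yang-Baxter equation -/

section Factors


theorem smul_eq_vecMul_mul {K : Type*} [Field K] {c c' : K} {a b w : Fin 3 → K}
    {M N : Matrix (Fin 3) (Fin 3) K} (h : c • a = Matrix.vecMul w M)
    (h' : c' • b = Matrix.vecMul a N) : (c * c') • b = Matrix.vecMul w (M * N) := by
  rw [mul_smul, h', ← Matrix.smul_vecMul, h, Matrix.vecMul_vecMul]

theorem smul_eq_mul_mulVec {K : Type*} [Field K] {c c' : K} {a b w : Fin 3 → K}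
    {M N : Matrix (Fin 3) (Fin 3) K} (h : c • a = Matrix.mulVec M w)
    (h' : c' • b = Matrix.mulVec N a) : (c * c') • b = Matrix.mulVec (N * M) w := by
  rw [mul_smul, h', ← Matrix.mulVec_smul, h, Matrix.mulVec_mulVec]

variable {K : Type*} [Field K]

/-- The row vector of the rank one part of `laxAdj`. -/
def adjRow (p : Params K) (x : Pt K) : Fin 3 → K := fun k => laxRow p x k / diagVec p k

/-- The column vector of the rank one part of `laxAdj`, up to sign. -/
def adjCol (p : Params K) (x : Pt K) : Fin 3 → K := fun k => laxCol p x k / diagVec p k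

/-- How the rows and columns of a refactorisation arise from the Lax matrices. -/
structure IsFactorisation (p q : Params K) (x y u v : Pt K) : Prop where
  row_snd : ∃ c : K, c ≠ 0 ∧ c • laxRow q v = Matrix.vecMul (laxRow q y) (lax x p (root1 q))
  row_fst : ∃ c : K, c ≠ 0 ∧ c • adjRow p u = Matrix.vecMul (adjRow p x) (laxAdj y q (root2 p))
  col_fst : ∃ c : K, c ≠ 0 ∧ c • laxCol p u = Matrix.mulVec (lax y q (root1 p)) (laxCol p x)
  col_snd : ∃ c : K, c ≠ 0 ∧ c • adjCol q v = Matrix.mulVec (laxAdj x p (root2 q)) (adjCol q y)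
  lax : Refactors p q x y u v
  adj : ∀ lam, laxAdj v q lam * laxAdj u p lam = laxAdj x p lam * laxAdj y q lam

variable {p q r : Params K}

/-- The four scalars are `scaleV`, `scaleU` and the quotients of `disc` by them. Only their
nonvanishing matters afterwards. -/
theorem isFactorisation_ybMap [Infinite K] (hp : p ∈ admissible K) (hq : q ∈ admissible K)
    {x y : Pt K} (hd : (x, y) ∈ ybDomain p q) :
    IsFactorisation p q x y (ybMap p q (x, y)).1 (ybMap p q (x, y)).2 := by
  obtain ⟨hU, hV, hD, -, -⟩ := (mem_ybDomain_iff hp hq).1 hd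
  have h := isImage_ybMap hp hq hd
  have hr := h.refactors hp hq hV hD
  have hA := diagVec_ne_zero hp
  have hB := diagVec_ne_zero hq
  refine ⟨⟨_, hV, ?_⟩, ⟨_, hU, ?_⟩, ⟨_, div_ne_zero hD hU, ?_⟩, ⟨_, div_ne_zero hD hV, ?_⟩, hr,
    hr.adj hp hq⟩
  · ext k
    rw [lax_eq_rankOne hp, vecMul_rankOne, Pi.smul_apply, smul_eq_mul, h.row_snd]
    simp only [phi, del1]
    ring
  · ext k
    have e : ∑ k, adjRow p x k * -(laxCol q y k / diagVec q k) = -psi p q x y := by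
      rw [psi, ← Finset.sum_neg_distrib]
      exact Finset.sum_congr rfl fun k _ => by rw [adjRow]; ring
    have e2 := h.row_fst k
    have hAk := hA k
    have hBk := hB k
    rw [laxAdj, vecMul_rankOne, e, Pi.smul_apply, smul_eq_mul, adjRow, adjRow, ← del2]
    field_simp
    linear_combination e2
  · ext k
    have e : ∑ k, laxRow q y k * laxCol p x k = phi p q x y := rfl
    rw [lax_eq_rankOne hq, rankOne_mulVec, e, Pi.smul_apply, smul_eq_mul, ← del1, div_mul_eq_mul_div,
      h.col_fst]
    field_simp
  · ext k
    have e : ∑ k, laxRow p x k / diagVec p k * adjCol q y k = psi p q x y := by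
      rw [psi]
      exact Finset.sum_congr rfl fun k _ => by rw [adjCol, div_mul_div_comm]
    have e2 := h.col_snd k
    have hAk := hA k
    have hBk := hB k
    have e3 : root2 p - root2 q = -del2 p q := by
      rw [del2]
      ring
    rw [laxAdj, rankOne_mulVec, e, Pi.smul_apply, smul_eq_mul, adjCol, adjCol, e3]
    field_simp
    linear_combination e2

theorem row_eq_of_smul {x x' : Pt K} {c c' : K} (hc : c ≠ 0)
    (h : c • laxRow p x = c' • laxRow p x') : laxRow p x = laxRow p x' := by
  have h2 : c = c' := by simpa [laxRow] using congrFun h 2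
  subst h2
  exact smul_right_injective _ hc h

theorem adjRow_eq_of_smul (hp : p ∈ admissible K) {x x' : Pt K} {c c' : K} (hc : c ≠ 0)
    (h : c • adjRow p x = c' • adjRow p x') : laxRow p x = laxRow p x' := by
  refine row_eq_of_smul hc (c' := c') (funext fun k => ?_)
  have h1 := congrFun h k
  have hA := diagVec_ne_zero hp k
  simp only [adjRow, Pi.smul_apply, smul_eq_mul] at h1 ⊢
  field_simp at h1
  exact h1

/-- Columns carry no normalised entry. Pairing both sides with the common row gives `c * gap p = c'
* gap p`, which is why a nonzero `gap` is required. -/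
theorem adjCol_eq_of_smul (hp : p ∈ admissible K) (hg : gap p ≠ 0) {x x' : Pt K} {c c' : K}
    (hc : c ≠ 0) (hr : laxRow p x = laxRow p x') (h : c • adjCol p x = c' • adjCol p x') :
    laxCol p x = laxCol p x' := by
  have e1 := sum_row_mul_col hp x
  have e2 := sum_row_mul_col hp x'
  have h2 : c = c' := by
    apply mul_right_cancel₀ hg
    nth_rewrite 1 [← e1]
    rw [← e2, Finset.mul_sum, Finset.mul_sum]
    refine Finset.sum_congr rfl fun k _ => ?_
    have := congrFun h k
    simp only [adjCol, Pi.smul_apply, smul_eq_mul] at this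
    rw [hr, mul_div_assoc, mul_div_assoc]
    linear_combination laxRow p x' k * this
  subst h2
  ext k
  have h3 := congrFun (smul_right_injective _ hc h) k
  have hA := diagVec_ne_zero hp k
  simp only [adjCol] at h3
  field_simp at h3
  exact h3

theorem col_eq_of_smul (hp : p ∈ admissible K) (hg : gap p ≠ 0) {x x' : Pt K} {c c' : K}
    (hc : c ≠ 0) (hr : laxRow p x = laxRow p x') (h : c • laxCol p x = c' • laxCol p x') :
    laxCol p x = laxCol p x' := by
  refine adjCol_eq_of_smul hp hg hc hr (c' := c') (funext fun k => ?_)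
  have h1 := congrFun h k
  simp only [adjCol, Pi.smul_apply, smul_eq_mul, ← mul_div_assoc] at h1 ⊢
  rw [h1]

theorem eq_of_lax_eq (hp : p ∈ admissible K) (hg : gap p ≠ 0) {x x' : Pt K} {lam : K}
    (h : lax x p lam = lax x' p lam) : x = x' := by
  have h1 : ∀ i j, laxCol p x i * laxRow p x j = laxCol p x' i * laxRow p x' j := by
    intro i j
    have := congrFun (congrFun h i) j
    rw [lax_eq_rankOne hp, lax_eq_rankOne hp, rankOne_apply, rankOne_apply] at this
    exact add_left_cancel this
  have h2 : laxCol p x = laxCol p x' := by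
    ext i
    simpa [laxRow] using h1 i 2
  obtain ⟨i, hi⟩ : ∃ i, laxCol p x i ≠ 0 := by
    by_contra! h0
    apply hg
    rw [← sum_row_mul_col hp x]
    simp [h0]
  refine pt_ext hp (funext fun j => ?_) fun k _ => by rw [h2]
  have := h1 i j
  rw [← h2] at this
  exact mul_left_cancel₀ hi this

theorem lax_cancel_left (hp : p ∈ admissible K) {x : Pt K} {lam : K} (h1 : lam ≠ root1 p)
    (h2 : lam ≠ root2 p) {M N : Matrix (Fin 3) (Fin 3) K}
    (h : lax x p lam * M = lax x p lam * N) : M = N := by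
  have h3 : (root1 p - lam) * (root2 p - lam) ≠ 0 :=
    mul_ne_zero (sub_ne_zero.2 h1.symm) (sub_ne_zero.2 h2.symm)
  have h4 := congrArg (laxAdj x p lam * ·) h
  simp only [← Matrix.mul_assoc, laxAdj_mul_lax hp, Matrix.smul_mul, Matrix.one_mul] at h4
  exact smul_right_injective _ h3 h4

theorem lax_cancel_right (hp : p ∈ admissible K) {x : Pt K} {lam : K} (h1 : lam ≠ root1 p)
    (h2 : lam ≠ root2 p) {M N : Matrix (Fin 3) (Fin 3) K}
    (h : M * lax x p lam = N * lax x p lam) : M = N := by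
  have h3 : (root1 p - lam) * (root2 p - lam) ≠ 0 :=
    mul_ne_zero (sub_ne_zero.2 h1.symm) (sub_ne_zero.2 h2.symm)
  have h4 := congrArg (· * laxAdj x p lam) h
  simp only [Matrix.mul_assoc, lax_mul_laxAdj hp, Matrix.mul_smul, Matrix.mul_one] at h4
  exact smul_right_injective _ h3 h4

/-- Two ways to refactorise a product of three Lax matrices give the same result. -/
theorem IsFactorisation.yangBaxter [Infinite K] (hp : p ∈ admissible K) (hq : q ∈ admissible K)
    (hr : r ∈ admissible K) (gp : gap p ≠ 0) (gq : gap q ≠ 0) (gr : gap r ≠ 0)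
    {x y z x₁ y₁ z₁ x₂ y₂ z₂ x₃ y₃ z₃ x₄ y₄ z₄ : Pt K}
    (h1 : IsFactorisation q r y z y₁ z₁) (h2 : IsFactorisation p r x z₁ x₁ z₂)
    (h3 : IsFactorisation p q x₁ y₁ x₂ y₂) (h4 : IsFactorisation p q x y x₃ y₃)
    (h5 : IsFactorisation p r x₃ z x₄ z₃) (h6 : IsFactorisation q r y₃ z₃ y₄ z₄) :
    x₂ = x₄ ∧ y₂ = y₄ ∧ z₂ = z₄ := by
  -- On one side the row of `z` is multiplied by the Lax matrices at `y`, `x`; on the other by those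
  -- at `x₃`, `y₃`. `h4` equates the products at `root1 r`, and the inverted form at `root2 r` does
  -- the same for columns.
  have hz : z₂ = z₄ := by
    obtain ⟨c1, n1, e1⟩ := h1.row_snd
    obtain ⟨c2, n2, e2⟩ := h2.row_snd
    obtain ⟨c3, n3, e3⟩ := h5.row_snd
    obtain ⟨c4, n4, e4⟩ := h6.row_snd
    have f := (smul_eq_vecMul_mul e1 e2).trans
      ((h4.lax (root1 r)).symm ▸ (smul_eq_vecMul_mul e3 e4).symm)
    have hrow := row_eq_of_smul (mul_ne_zero n1 n2) f
    obtain ⟨c1, n1, e1⟩ := h1.col_snd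
    obtain ⟨c2, n2, e2⟩ := h2.col_snd
    obtain ⟨c3, n3, e3⟩ := h5.col_snd
    obtain ⟨c4, n4, e4⟩ := h6.col_snd
    have f := (smul_eq_mul_mulVec e1 e2).trans
      ((h4.adj (root2 r)) ▸ (smul_eq_mul_mulVec e3 e4).symm)
    have hcol := adjCol_eq_of_smul hr gr (mul_ne_zero n1 n2) hrow f
    exact pt_ext hr hrow fun k _ => by rw [hcol]
  have hx : x₂ = x₄ := by
    obtain ⟨c1, n1, e1⟩ := h2.row_fst
    obtain ⟨c2, n2, e2⟩ := h3.row_fst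
    obtain ⟨c3, n3, e3⟩ := h4.row_fst
    obtain ⟨c4, n4, e4⟩ := h5.row_fst
    have f := (smul_eq_vecMul_mul e1 e2).trans
      ((h1.adj (root2 p)).symm ▸ (smul_eq_vecMul_mul e3 e4).symm)
    have hrow := adjRow_eq_of_smul hp (mul_ne_zero n1 n2) f
    obtain ⟨c1, n1, e1⟩ := h2.col_fst
    obtain ⟨c2, n2, e2⟩ := h3.col_fst
    obtain ⟨c3, n3, e3⟩ := h4.col_fst
    obtain ⟨c4, n4, e4⟩ := h5.col_fst
    have f := (smul_eq_mul_mulVec e1 e2).trans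
      ((h1.lax (root1 p)) ▸ (smul_eq_mul_mulVec e3 e4).symm)
    have hcol := col_eq_of_smul hp gp (mul_ne_zero n1 n2) hrow f
    exact pt_ext hp hrow fun k _ => by rw [hcol]
  -- Both sides refactor the same triple product. With the outer factors known to agree, they are
  -- cancelled at a `λ` where they are invertible.
  refine ⟨hx, ?_, hz⟩
  subst hx hz
  classical
  obtain ⟨lam, hlam⟩ := Infinite.exists_notMem_finset {root1 p, root2 p, root1 r, root2 r}
  simp only [Finset.mem_insert, Finset.mem_singleton, not_or] at hlam
  obtain ⟨l1, l2, l3, l4⟩ := hlam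
  refine eq_of_lax_eq hq gq (lam := lam)
    (lax_cancel_left (x := x₂) hp l1 l2 (lax_cancel_right (x := z₂) hr l3 l4 ?_))
  have e1 := h3.lax lam
  have e2 := h2.lax lam
  have e3 := h1.lax lam
  have e4 := h6.lax lam
  have e5 := h5.lax lam
  have e6 := h4.lax lam
  rw [e1, Matrix.mul_assoc, e2, ← Matrix.mul_assoc, e3, Matrix.mul_assoc (YangBaxter.lax x₂ p lam),
    e4, ← Matrix.mul_assoc, e5, Matrix.mul_assoc, Matrix.mul_assoc, e6]

end Factors

/-! ### Regularity of both sides of the Yang-Baxter equation -/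

section Triples

variable {F σ : Type*} [Field F] {S : Set (σ → F)} {p q r : (σ → F) → Params F}
  {x y z : (σ → F) → Pt F}

/-- For parameters and points that depend regularly on a point of an affine space, the triples at
which both sides of the Yang-Baxter equation are defined form a principal open set, and both sides
are regular there. -/
theorem isPrincipal_tripleDomain (hS : IsPrincipal S) (hp : IsRegularParams S p)
    (hq : IsRegularParams S q) (hr : IsRegularParams S r) (hx : IsRegularPt S x)
    (hy : IsRegularPt S y) (hz : IsRegularPt S z) :
    ∃ S' : Set (σ → F), IsPrincipal S' ∧
      (∀ s, s ∈ S' ↔ s ∈ S ∧ (x s, y s, z s) ∈ tripleDomain ybDomain ybMap (p s) (q s) (r s)) ∧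
      (∀ w : (σ → F) → Pt F × Pt F × Pt F,
        ((w = fun s => act12 (ybMap (p s) (q s)) (act13 (ybMap (p s) (r s))
          (act23 (ybMap (q s) (r s)) (x s, y s, z s)))) ∨
        (w = fun s => act23 (ybMap (q s) (r s)) (act13 (ybMap (p s) (r s))
          (act12 (ybMap (p s) (q s)) (x s, y s, z s))))) →
        IsRegularPt S' (fun s => (w s).1) ∧ IsRegularPt S' (fun s => (w s).2.1) ∧
          IsRegularPt S' (fun s => (w s).2.2)) := by
  have P1 := isPrincipal_ybDomain hS hq hr hy hz
  set S1 := {s | s ∈ S ∧ (y s, z s) ∈ ybDomain (q s) (r s)} with hS1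
  have i1 : S1 ⊆ S := fun s hs => hs.1
  have R1 := isRegularPt_ybMap (hq.mono i1) (hr.mono i1) (hy.mono i1) (hz.mono i1)
    fun s hs => hs.2
  have P2 := isPrincipal_ybDomain P1 (hp.mono i1) (hr.mono i1) (hx.mono i1) R1.2
  set S2 := {s | s ∈ S1 ∧ (x s, (ybMap (q s) (r s) (y s, z s)).2) ∈ ybDomain (p s) (r s)}
    with hS2
  have i2 : S2 ⊆ S1 := fun s hs => hs.1
  have R2 := isRegularPt_ybMap ((hp.mono i1).mono i2) ((hr.mono i1).mono i2)
    ((hx.mono i1).mono i2) (R1.2.mono i2) fun s hs => hs.2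
  have P3 := isPrincipal_ybDomain P2 ((hp.mono i1).mono i2) ((hq.mono i1).mono i2) R2.1
    (R1.1.mono i2)
  set S3 := {s | s ∈ S2 ∧ ((ybMap (p s) (r s) (x s, (ybMap (q s) (r s) (y s, z s)).2)).1,
    (ybMap (q s) (r s) (y s, z s)).1) ∈ ybDomain (p s) (q s)} with hS3
  have i3 : S3 ⊆ S2 := fun s hs => hs.1
  have R3 := isRegularPt_ybMap (((hp.mono i1).mono i2).mono i3) (((hq.mono i1).mono i2).mono i3)
    (R2.1.mono i3) ((R1.1.mono i2).mono i3) fun s hs => hs.2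
  have P4 := isPrincipal_ybDomain hS hp hq hx hy
  set S4 := {s | s ∈ S ∧ (x s, y s) ∈ ybDomain (p s) (q s)} with hS4
  have i4 : S4 ⊆ S := fun s hs => hs.1
  have R4 := isRegularPt_ybMap (hp.mono i4) (hq.mono i4) (hx.mono i4) (hy.mono i4)
    fun s hs => hs.2
  have P5 := isPrincipal_ybDomain P4 (hp.mono i4) (hr.mono i4) R4.1 (hz.mono i4)
  set S5 := {s | s ∈ S4 ∧ ((ybMap (p s) (q s) (x s, y s)).1, z s) ∈ ybDomain (p s) (r s)}
    with hS5
  have i5 : S5 ⊆ S4 := fun s hs => hs.1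
  have R5 := isRegularPt_ybMap ((hp.mono i4).mono i5) ((hr.mono i4).mono i5)
    (R4.1.mono i5) ((hz.mono i4).mono i5) fun s hs => hs.2
  have P6 := isPrincipal_ybDomain P5 ((hq.mono i4).mono i5) ((hr.mono i4).mono i5)
    (R4.2.mono i5) R5.2
  set S6 := {s | s ∈ S5 ∧ ((ybMap (p s) (q s) (x s, y s)).2,
    (ybMap (p s) (r s) ((ybMap (p s) (q s) (x s, y s)).1, z s)).2) ∈ ybDomain (q s) (r s)}
    with hS6
  have i6 : S6 ⊆ S5 := fun s hs => hs.1
  have R6 := isRegularPt_ybMap (((hq.mono i4).mono i5).mono i6) (((hr.mono i4).mono i5).mono i6)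
    ((R4.2.mono i5).mono i6) (R5.2.mono i6) fun s hs => hs.2
  have j3 : S3 ∩ S6 ⊆ S3 := Set.inter_subset_left
  have j6 : S3 ∩ S6 ⊆ S6 := Set.inter_subset_right
  refine ⟨S3 ∩ S6, P3.inter P6, fun s => ?_, fun w hw => ?_⟩
  · simp only [hS1, hS2, hS3, hS4, hS5, hS6, tripleDomain, act12, act13, act23,
      Set.mem_inter_iff, Set.mem_ofPred_eq]
    tauto
  · rcases hw with rfl | rfl
    · exact ⟨R3.1.mono j3, R3.2.mono j3, (R2.2.mono i3).mono j3⟩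
    · exact ⟨(R5.1.mono i6).mono j6, R6.1.mono j6, R6.2.mono j6⟩

end Triples

/-! ### The Yang-Baxter equation for all admissible parameters -/

section Main

variable {F : Type*} [Field F] {p q r : Params F}

theorem yangBaxter_of_gap_ne_zero [Infinite F] (hp : p ∈ admissible F) (hq : q ∈ admissible F)
    (hr : r ∈ admissible F) (gp : gap p ≠ 0) (gq : gap q ≠ 0) (gr : gap r ≠ 0)
    {w : Pt F × Pt F × Pt F} (hw : w ∈ tripleDomain ybDomain ybMap p q r) :
    act12 (ybMap p q) (act13 (ybMap p r) (act23 (ybMap q r) w)) =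
      act23 (ybMap q r) (act13 (ybMap p r) (act12 (ybMap p q) w)) := by
  obtain ⟨x, y, z⟩ := w
  obtain ⟨h1, h2, h3, h4, h5, h6⟩ := hw
  have := IsFactorisation.yangBaxter hp hq hr gp gq gr (isFactorisation_ybMap hq hr h1)
    (isFactorisation_ybMap hp hr h2) (isFactorisation_ybMap hp hq h3)
    (isFactorisation_ybMap hp hq h4) (isFactorisation_ybMap hp hr h5)
    (isFactorisation_ybMap hq hr h6)
  exact Prod.ext this.1 (Prod.ext this.2.1 this.2.2)

/-- The parameters with `c₂` shifted by `t`. -/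
def Params.shift (p : Params F) (t : F) : Params F := { p with c2 := p.c2 + t }

theorem isRegularParams_shift {S : Set (Unit → F)} (hp : p ∈ admissible F) :
    IsRegularParams S fun s => p.shift (s ()) :=
  ⟨fun _ _ => hp, isRegular_const _, (isRegular_const _).add (isRegular_coord ()),
    isRegular_const _, isRegular_const _, isRegular_const _⟩

theorem gap_shift_ne_zero [CharZero F] (hp : p ∈ admissible F) {t : F} (h : p.c2 + t ≠ 0) :
    gap (p.shift t) ≠ 0 :=
  div_ne_zero (neg_ne_zero.2 (mul_ne_zero three_ne_zero h)) (mul_ne_zero hp.2.1 hp.2.2)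

/-- The points stay fixed while all three `c2` are shifted by one variable `t`. Both sides are
regular in `t` on a principal open set containing 0 and agree wherever no shifted `c2` vanishes,
hence also at `t = 0`. -/
theorem yangBaxter [CharZero F] (hp : p ∈ admissible F) (hq : q ∈ admissible F)
    (hr : r ∈ admissible F) {w : Pt F × Pt F × Pt F}
    (hw : w ∈ tripleDomain ybDomain ybMap p q r) :
    act12 (ybMap p q) (act13 (ybMap p r) (act23 (ybMap q r) w)) =
      act23 (ybMap q r) (act13 (ybMap p r) (act12 (ybMap p q) w)) := by
  have shift_zero : ∀ p : Params F, p.shift 0 = p := fun p => by simp [Params.shift]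
  obtain ⟨S, hS, hmem, hreg⟩ := isPrincipal_tripleDomain
    (p := fun s : Unit → F => p.shift (s ())) (q := fun s => q.shift (s ()))
    (r := fun s => r.shift (s ())) (x := fun _ => w.1) (y := fun _ => w.2.1)
    (z := fun _ => w.2.2) isPrincipal_univ (isRegularParams_shift hp) (isRegularParams_shift hq)
    (isRegularParams_shift hr) (fun i => isRegular_const _) (fun i => isRegular_const _)
    (fun i => isRegular_const _)
  obtain ⟨a1, a2, a3⟩ := hreg _ (Or.inl rfl)
  obtain ⟨b1, b2, b3⟩ := hreg _ (Or.inr rfl)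
  have hc : ∀ c : F, IsRegular (Set.univ : Set (Unit → F)) fun s => c + s () :=
    fun c => (isRegular_const c).add (isRegular_coord ())
  have hT := isPrincipal_univ.and_ne_zero (((hc p.c2).mul (hc q.c2)).mul (hc r.c2))
  have hTne : {s : Unit → F | s ∈ Set.univ ∧
      (p.c2 + s ()) * (q.c2 + s ()) * (r.c2 + s ()) ≠ 0}.Nonempty := by
    classical
    obtain ⟨c, hc⟩ := Infinite.exists_notMem_finset {-p.c2, -q.c2, -r.c2}
    simp only [Finset.mem_insert, Finset.mem_singleton, not_or] at hc
    refine ⟨fun _ => c, trivial, ?_⟩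
    simp only [ne_eq, mul_eq_zero, not_or, add_eq_zero_iff_neg_eq]
    exact ⟨⟨fun h => hc.1 h.symm, fun h => hc.2.1 h.symm⟩, fun h => hc.2.2 h.symm⟩
  have h0 : (fun _ => 0 : Unit → F) ∈ S :=
    (hmem _).2 ⟨trivial, by simpa only [shift_zero] using hw⟩
  have key : ∀ s ∈ S, s ∈ {s : Unit → F | s ∈ Set.univ ∧
      (p.c2 + s ()) * (q.c2 + s ()) * (r.c2 + s ()) ≠ 0} → _ := fun s hs hs' =>
    yangBaxter_of_gap_ne_zero (p := p.shift (s ())) (q := q.shift (s ())) (r := r.shift (s ()))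
      hp hq hr (gap_shift_ne_zero hp (left_ne_zero_of_mul (left_ne_zero_of_mul hs'.2)))
      (gap_shift_ne_zero hq (right_ne_zero_of_mul (left_ne_zero_of_mul hs'.2)))
      (gap_shift_ne_zero hr (right_ne_zero_of_mul hs'.2)) ((hmem s).1 hs).2
  have e1 := fun i => IsRegular.eq_of_eqOn hS hT hTne (a1 i) (b1 i)
    (fun s hs hs' => congrFun (congrArg (fun w => w.1) (key s hs hs')) i) h0
  have e2 := fun i => IsRegular.eq_of_eqOn hS hT hTne (a2 i) (b2 i)
    (fun s hs hs' => congrFun (congrArg (fun w => w.2.1) (key s hs hs')) i) h0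
  have e3 := fun i => IsRegular.eq_of_eqOn hS hT hTne (a3 i) (b3 i)
    (fun s hs hs' => congrFun (congrArg (fun w => w.2.2) (key s hs hs')) i) h0
  simp only [shift_zero] at e1 e2 e3
  exact Prod.ext (funext e1) (Prod.ext (funext e2) (funext e3))

end Main

/-! ### Generic definedness of the Yang-Baxter equation -/

section Generic

variable {F τ : Type*} [Field F] [Infinite F]

/-- `R` acting on two factors of an affine space, which are read off by `fst` and `snd` and
replaced by `put`: the preimage of a nonempty principal open set is one. -/
theorem preimage_act_nonempty {p q : Params F} (hp : p ∈ admissible F) (hq : q ∈ admissible F)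
    {fst snd : (τ → F) → Pt F} {put : (τ → F) → Pt F → Pt F → τ → F}
    (hfst : IsRegularPt Set.univ fst) (hsnd : IsRegularPt Set.univ snd)
    (hput : ∀ (S : Set (τ → F)) (u v : (τ → F) → Pt F), IsRegularPt S u → IsRegularPt S v →
      ∀ i, IsRegular S fun z => put z (u z) (v z) i)
    (h1 : ∀ z u v, fst (put z u v) = u) (h2 : ∀ z u v, snd (put z u v) = v)
    (h3 : ∀ z u v u' v', put (put z u v) u' v' = put z u' v')
    (h4 : ∀ z, put z (fst z) (snd z) = z)
    {T : Set (τ → F)} (hT : IsPrincipal T) (hne : T.Nonempty) :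
    IsPrincipal {z | (fst z, snd z) ∈ ybDomain p q ∧
        put z (ybMap p q (fst z, snd z)).1 (ybMap p q (fst z, snd z)).2 ∈ T} ∧
      {z | (fst z, snd z) ∈ ybDomain p q ∧
        put z (ybMap p q (fst z, snd z)).1 (ybMap p q (fst z, snd z)).2 ∈ T}.Nonempty := by
  have hS := isPrincipal_ybDomain isPrincipal_univ (isRegularParams_const hp)
    (isRegularParams_const hq) hfst hsnd
  have hS' := isPrincipal_ybDomain isPrincipal_univ (isRegularParams_const hq)
    (isRegularParams_const hp) hsnd hfst
  simp only [Set.mem_univ, true_and] at hS hS'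
  constructor
  · have hr := isRegularPt_ybMap (S := {z | (fst z, snd z) ∈ ybDomain p q})
      (isRegularParams_const hp) (isRegularParams_const hq)
      (hfst.mono (Set.subset_univ _)) (hsnd.mono (Set.subset_univ _)) fun s hs => hs
    exact hS.preimage hT fun i => hput _ _ _ hr.1 hr.2 i
  · have hne' : {z | (snd z, fst z) ∈ ybDomain q p}.Nonempty := by
      obtain ⟨z, -⟩ := hne
      obtain ⟨⟨y, x⟩, h⟩ := ybDomain_nonempty hq hp
      exact ⟨put z x y, by simpa only [Set.mem_ofPred_eq, h1, h2] using h⟩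
    -- A point of `T` at which the inverse map is defined; its image under the inverse is the
    -- required preimage.
    obtain ⟨z, hz, hz'⟩ := hT.inter_nonempty hS' hne hne'
    have h := ybMap_swap hq hp hz'
    have h5 : ybMap p q ((ybMap q p (snd z, fst z)).2, (ybMap q p (snd z, fst z)).1) =
      (fst z, snd z) := h.2
    refine ⟨put z (ybMap q p (snd z, fst z)).2 (ybMap q p (snd z, fst z)).1, ?_⟩
    simp only [Set.mem_ofPred_eq, h1, h2, h3, h5, h4]
    exact ⟨h.1, hz⟩

theorem generically_tripleDomain {p q r : Params F} (hp : p ∈ admissible F)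
    (hq : q ∈ admissible F) (hr : r ∈ admissible F) :
    Generically {z : Fin 4 ⊕ Fin 4 ⊕ Fin 4 → F |
      (z ∘ Sum.inl, z ∘ Sum.inr ∘ Sum.inl, z ∘ Sum.inr ∘ Sum.inr) ∈
        tripleDomain ybDomain ybMap p q r} := by
  have c1 : IsRegularPt Set.univ fun z : Fin 4 ⊕ Fin 4 ⊕ Fin 4 → F => z ∘ Sum.inl :=
    fun i => isRegular_coord (Sum.inl i)
  have c2 : IsRegularPt Set.univ fun z : Fin 4 ⊕ Fin 4 ⊕ Fin 4 → F => z ∘ Sum.inr ∘ Sum.inl :=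
    fun i => isRegular_coord (Sum.inr (Sum.inl i))
  have c3 : IsRegularPt Set.univ fun z : Fin 4 ⊕ Fin 4 ⊕ Fin 4 → F => z ∘ Sum.inr ∘ Sum.inr :=
    fun i => isRegular_coord (Sum.inr (Sum.inr i))
  have eta3 : ∀ z : Fin 4 ⊕ Fin 4 ⊕ Fin 4 → F,
      Sum.elim (z ∘ Sum.inl) (Sum.elim (z ∘ Sum.inr ∘ Sum.inl) (z ∘ Sum.inr ∘ Sum.inr)) = z := by
    intro z
    ext (i | i | i) <;> rfl
  have a12 := fun T => preimage_act_nonempty (T := T) hp hq c1 c2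
    (put := fun z u v => Sum.elim u (Sum.elim v (z ∘ Sum.inr ∘ Sum.inr)))
    (fun S u v hu hv i => by
      rcases i with i | i | i
      exacts [hu i, hv i, isRegular_coord _])
    (fun _ _ _ => rfl) (fun _ _ _ => rfl) (fun _ _ _ _ _ => rfl) eta3
  have a13 := fun T => preimage_act_nonempty (T := T) hp hr c1 c3
    (put := fun z u v => Sum.elim u (Sum.elim (z ∘ Sum.inr ∘ Sum.inl) v))
    (fun S u v hu hv i => by
      rcases i with i | i | i
      exacts [hu i, isRegular_coord _, hv i])
    (fun _ _ _ => rfl) (fun _ _ _ => rfl) (fun _ _ _ _ _ => rfl) eta3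
  have a23 := fun T => preimage_act_nonempty (T := T) hq hr c2 c3
    (put := fun z u v => Sum.elim (z ∘ Sum.inl) (Sum.elim u v))
    (fun S u v hu hv i => by
      rcases i with i | i | i
      exacts [isRegular_coord _, hu i, hv i])
    (fun _ _ _ => rfl) (fun _ _ _ => rfl) (fun _ _ _ _ _ => rfl) eta3
  have ne : (Set.univ : Set (Fin 4 ⊕ Fin 4 ⊕ Fin 4 → F)).Nonempty := ⟨0, trivial⟩
  -- Each side is pulled back from its last map to its first, starting from the whole space.
  obtain ⟨p3, n3⟩ := a12 _ isPrincipal_univ ne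
  obtain ⟨p2, n2⟩ := a13 _ p3 n3
  obtain ⟨p1, n1⟩ := a23 _ p2 n2
  obtain ⟨p6, n6⟩ := a23 _ isPrincipal_univ ne
  obtain ⟨p5, n5⟩ := a13 _ p6 n6
  obtain ⟨p4, n4⟩ := a12 _ p5 n5
  obtain ⟨Q, hQ, h⟩ := (p1.inter p4).generically (p1.inter_nonempty p4 n1 n4)
  exact ⟨Q, hQ, fun z hz =>
    ⟨(h z hz).1.1, (h z hz).1.2.1, (h z hz).1.2.2.1, (h z hz).2.1, (h z hz).2.2.1,
      (h z hz).2.2.2.1⟩⟩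

theorem isParametricYangBaxter_ybMap [CharZero F] :
    IsParametricYangBaxter (admissible F) ybDomain ybMap :=
  fun _ hp _ hq _ hr => ⟨generically_tripleDomain hp hq hr, fun _ hw => yangBaxter hp hq hr hw⟩

end Generic

/-! ### Quadrirationality -/

section Slide

variable {K : Type*} [Field K]

/-- The point whose row and column are proportional to `al` and `a`. -/
def ofRowCol (p : Params K) (al a : Fin 3 → K) : Pt K :=
  ![-(al 0 / al 2) / p.a1, -(al 1 / al 2) / p.a2, a 0 * al 2, a 1 * al 2]

theorem ofRowCol_laxRow {p : Params K} (hp : p ∈ admissible K) (x : Pt K) {c : K} (hc : c ≠ 0)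
    {al a : Fin 3 → K} (hal : ∀ k, al k = c * laxRow p x k) (ha : ∀ k, c * a k = laxCol p x k) :
    ofRowCol p al a = x := by
  have h1 := hp.1
  have h2 := hp.2.1
  have e0 := hal 0
  have e1 := hal 1
  have e2 := hal 2
  have f0 := ha 0
  have f1 := ha 1
  simp only [laxRow, laxCol, Matrix.cons_val] at e0 e1 e2 f0 f1
  ext i
  fin_cases i
  · simp only [ofRowCol, Fin.zero_eta, Matrix.cons_val, e0, e2]
    field_simp
  · simp only [ofRowCol, Fin.mk_one, Matrix.cons_val, e1, e2]
    field_simp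
  · simp only [ofRowCol, Fin.reduceFinMk, Matrix.cons_val, e2, ← f0]
    ring
  · simp only [ofRowCol, Fin.reduceFinMk, Matrix.cons_val, e2, ← f1]
    ring

theorem laxRow_ofRowCol {p : Params K} (hp : p ∈ admissible K) {al a : Fin 3 → K}
    (h : al 2 ≠ 0) (k : Fin 3) : al 2 * laxRow p (ofRowCol p al a) k = al k := by
  have h1 := hp.1
  have h2 := hp.2.1
  fin_cases k
  · simp only [ofRowCol, laxRow, Fin.zero_eta, Matrix.cons_val]
    field_simp
  · simp only [ofRowCol, laxRow, Fin.mk_one, Matrix.cons_val]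
    field_simp
  · simp [laxRow]

theorem laxCol_ofRowCol {p : Params K} (hp : p ∈ admissible K) {al a : Fin 3 → K}
    (h : al 2 ≠ 0) (hg : ∑ k, al k * a k / diagVec p k = gap p) (k : Fin 3) :
    laxCol p (ofRowCol p al a) k = al 2 * a k := by
  by_cases hk : k = 2
  · subst hk
    have h1 := sum_row_mul_col hp (ofRowCol p al a)
    have r0 := laxRow_ofRowCol hp (a := a) h 0
    have r1 := laxRow_ofRowCol hp (a := a) h 1
    have r2 := laxRow_ofRowCol hp (a := a) h 2
    have c0 : laxCol p (ofRowCol p al a) 0 = a 0 * al 2 := rfl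
    have c1 : laxCol p (ofRowCol p al a) 1 = a 1 * al 2 := rfl
    rw [← hg] at h1
    simp only [Fin.sum_univ_three, c0, c1] at h1
    have hA := diagVec_ne_zero hp
    have e0 : laxRow p (ofRowCol p al a) 0 * (a 0 * al 2) / diagVec p 0 =
      al 0 * a 0 / diagVec p 0 := by rw [← r0]; ring
    have e1 : laxRow p (ofRowCol p al a) 1 * (a 1 * al 2) / diagVec p 1 =
      al 1 * a 1 / diagVec p 1 := by rw [← r1]; ring
    have e2 : laxRow p (ofRowCol p al a) 2 = 1 := rfl
    rw [e0, e1, e2, one_mul] at h1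
    have h2 := add_left_cancel h1
    exact (div_left_inj' (hA 2)).1 h2
  · fin_cases k
    · exact mul_comm _ _
    · exact mul_comm _ _
    · exact absurd rfl hk

/-- The pairing of the weighted row of `x` with `b`. -/
def rowPair (p : Params K) (W b : Fin 3 → K) (x : Pt K) : K := ∑ k, W k * laxRow p x k * b k

/-- The pairing of `be` with the weighted column of `x`. -/
def colPair (p : Params K) (W be : Fin 3 → K) (x : Pt K) : K :=
  ∑ k, be k * (laxCol p x k / (diagVec p k * W k))

def slideDisc (p : Params K) (W be b : Fin 3 → K) (d d' : K) (x : Pt K) : K :=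
  d * d' - colPair p W be x * rowPair p W b x

def slideRow (p : Params K) (W be b : Fin 3 → K) (d' : K) (x : Pt K) (k : Fin 3) : K :=
  d' * (W k * laxRow p x k) - rowPair p W b x * be k

def slideCol (p : Params K) (W be b : Fin 3 → K) (d d' : K) (x : Pt K) (k : Fin 3) : K :=
  (d * (laxCol p x k / (diagVec p k * W k)) + colPair p W be x * b k) /
    slideDisc p W be b d d' x

/-- For fixed vectors `be` and `b`, the action of a refactorisation on one of its two points. -/
def slide (p : Params K) (W W' be b : Fin 3 → K) (d d' : K) (x : Pt K) : Pt K :=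
  ofRowCol p (fun k => slideRow p W be b d' x k / W' k)
    (fun k => diagVec p k * W' k * slideCol p W be b d d' x k)

/-- The points at which `slide` is defined. -/
def slideDomain (p : Params K) (W be b : Fin 3 → K) (d d' : K) : Set (Pt K) :=
  {x | slideRow p W be b d' x 2 ≠ 0 ∧ slideDisc p W be b d d' x ≠ 0}

theorem weighted_pairing {p : Params K} (hp : p ∈ admissible K) {W : Fin 3 → K}
    (hW : ∀ k, W k ≠ 0) (x : Pt K) :
    ∑ k, W k * laxRow p x k * (laxCol p x k / (diagVec p k * W k)) = gap p := by
  rw [← sum_row_mul_col hp x]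
  refine Finset.sum_congr rfl fun k _ => ?_
  have h1 := diagVec_ne_zero hp k
  have h2 := hW k
  field_simp

/-- The weighted row undergoes the linear map `d' - be bᵀ` and, up to `slideDisc`, the weighted
column undergoes `d + b beᵀ`. Since `beᵀ b = m`, their inverses are proportional to `(d' - m) + be
bᵀ` and `(d + m) - b beᵀ`: the same operation with `b` negated and the scalars shifted. `h1` and
`h2` say that both maps are invertible. -/
theorem slide_slide {p : Params K} (hp : p ∈ admissible K) {W W' be b : Fin 3 → K} {d d' m : K}
    (hW : ∀ k, W k ≠ 0) (hW' : ∀ k, W' k ≠ 0) (hm : ∑ k, be k * b k = m)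
    (hd : d' = d + m - gap p) (h1 : d' * (d' - m) ≠ 0) (h2 : d * (d + m) ≠ 0) {x : Pt K}
    (hx : x ∈ slideDomain p W be b d d') :
    slide p W W' be b d d' x ∈ slideDomain p W' be (-b) (d + m) (d' - m) ∧
      slide p W' W be (-b) (d + m) (d' - m) (slide p W W' be b d d' x) = x := by
  obtain ⟨hr, hD⟩ := hx
  have hA := diagVec_ne_zero hp
  set s := slideRow p W be b d' x 2 / W' 2 with hs
  have hs0 : s ≠ 0 := div_ne_zero hr (hW' 2)
  set D := slideDisc p W be b d d' x with hDdef
  set f := colPair p W be x with hf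
  set g := rowPair p W b x with hg
  have pair := row_pairing (weighted_pairing hp hW x) hm hf.symm hg.symm hd
  have hrow : ∀ k, s * (W' k * laxRow p (slide p W W' be b d d' x) k) =
      d' * (W k * laxRow p x k) - g * be k := by
    intro k
    have := laxRow_ofRowCol hp (al := fun k => slideRow p W be b d' x k / W' k)
      (a := fun k => diagVec p k * W' k * slideCol p W be b d d' x k) hs0 k
    have hk := hW' k
    rw [eq_div_iff hk] at this
    have e : slideRow p W be b d' x k = d' * (W k * laxRow p x k) - g * be k := rfl
    rw [slide]
    linear_combination this + e
  have hcol : ∀ k, D * (laxCol p (slide p W W' be b d d' x) k / (diagVec p k * W' k)) =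
      s * (d * (laxCol p x k / (diagVec p k * W k)) + f * b k) := by
    intro k
    have := laxCol_ofRowCol hp (al := fun k => slideRow p W be b d' x k / W' k)
      (a := fun k => diagVec p k * W' k * slideCol p W be b d d' x k) hs0 (by
        have e : D * gap p = D * ∑ k, slideRow p W be b d' x k / W' k *
            (diagVec p k * W' k * slideCol p W be b d d' x k) / diagVec p k := by
          rw [hDdef, slideDisc, ← hf, ← hg, ← pair, Finset.mul_sum]
          refine Finset.sum_congr rfl fun k _ => ?_
          have e1 : D * slideCol p W be b d d' x k =
              d * (laxCol p x k / (diagVec p k * W k)) + f * b k := by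
            rw [slideCol, ← hDdef, mul_div_cancel₀ _ hD]
          have hk := hW' k
          have hAk := hA k
          rw [← e1]
          have e2 : d * d' - f * g = D := rfl
          rw [e2, slideRow, ← hg]
          field_simp
        exact (mul_left_cancel₀ hD e).symm) k
    have e1 : D * slideCol p W be b d d' x k =
        d * (laxCol p x k / (diagVec p k * W k)) + f * b k := by
      rw [slideCol, ← hDdef, mul_div_cancel₀ _ hD]
    rw [slide, this, ← e1]
    have hk := hW' k
    have hAk := hA k
    change D * (s * (diagVec p k * W' k * slideCol p W be b d d' x k) / _) = _
    field_simp
  set u := slide p W W' be b d d' x with hu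
  have hg' : s * rowPair p W' (-b) u = -(g * (d' - m)) := by
    have : s * rowPair p W' (-b) u = ∑ k, -((d' * (W k * laxRow p x k) - g * be k) * b k) := by
      rw [rowPair, Finset.mul_sum]
      refine Finset.sum_congr rfl fun k _ => ?_
      rw [← hrow k, Pi.neg_apply]
      ring
    rw [this, ← hm, hg, rowPair]
    simp only [Fin.sum_univ_three]
    ring
  have hf' : D * colPair p W' be u = s * f * (d + m) := by
    have : D * colPair p W' be u =
        ∑ k, be k * (s * (d * (laxCol p x k / (diagVec p k * W k)) + f * b k)) := by
      rw [colPair, Finset.mul_sum]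
      refine Finset.sum_congr rfl fun k _ => ?_
      rw [← hcol k]
      ring
    rw [this, ← hm, hf, colPair]
    simp only [Fin.sum_univ_three]
    ring
  -- The discriminants at a point and at its image have a constant product, nonzero by `h1` and
  -- `h2`; hence the image lies in the domain of the inverse.
  have hDD : D * slideDisc p W' be (-b) (d + m) (d' - m) u = (d + m) * (d' - m) * (d * d') := by
    have e : D = d * d' - f * g := rfl
    apply mul_left_cancel₀ hs0
    rw [slideDisc]
    linear_combination -s * rowPair p W' (-b) u * hf' - s * f * (d + m) * hg' +
      s * (d + m) * (d' - m) * e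
  have hrow2 : ∀ k, s * slideRow p W' be (-b) (d' - m) u k =
      (d' * (d' - m)) * (W k * laxRow p x k) := by
    intro k
    rw [slideRow]
    linear_combination (d' - m) * hrow k - be k * hg'
  have hD' : slideDisc p W' be (-b) (d + m) (d' - m) u ≠ 0 := by
    intro h0
    rw [h0, mul_zero] at hDD
    apply mul_ne_zero h1 h2
    linear_combination -hDD
  have hcol2 : ∀ k, (d' * (d' - m)) * slideCol p W' be (-b) (d + m) (d' - m) u k =
      s * (laxCol p x k / (diagVec p k * W k)) := by
    intro k
    apply mul_left_cancel₀ (mul_ne_zero hD hD')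
    have e1 : slideDisc p W' be (-b) (d + m) (d' - m) u *
        slideCol p W' be (-b) (d + m) (d' - m) u k =
        (d + m) * (laxCol p u k / (diagVec p k * W' k)) + colPair p W' be u * -b k := by
      rw [slideCol, mul_div_cancel₀ _ hD', Pi.neg_apply]
    linear_combination D * d' * (d' - m) * e1 + d' * (d' - m) * (d + m) * hcol k -
      d' * (d' - m) * b k * hf' - s * (laxCol p x k / (diagVec p k * W k)) * hDD
  refine ⟨⟨fun h0 => ?_, hD'⟩, ?_⟩
  · have := hrow2 2
    rw [h0, mul_zero] at this
    exact mul_ne_zero h1 (mul_ne_zero (hW 2) (by simp [laxRow])) this.symm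
  · refine ofRowCol_laxRow hp x (c := d' * (d' - m) / s) (div_ne_zero h1 hs0) (fun k => ?_)
      fun k => ?_
    · have := hrow2 k
      have hk := hW k
      rw [div_eq_iff hk]
      apply mul_left_cancel₀ hs0
      rw [this]
      field_simp
    · have := hcol2 k
      have hk := hW k
      have hAk := hA k
      have e : d' * (d' - m) / s *
          (diagVec p k * W k * slideCol p W' be (-b) (d + m) (d' - m) u k) =
          diagVec p k * W k / s *
          (d' * (d' - m) * slideCol p W' be (-b) (d + m) (d' - m) u k) := by ring
      rw [e, this]
      field_simp

end Slide

/-! ### Birationality in one argument -/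

section Regular

variable {F : Type*} [Field F] {p : Params F}

theorem isRegular_laxRow (S : Set (Pt F)) (k : Fin 3) : IsRegular S fun x => laxRow p x k := by
  fin_cases k
  · exact ((isRegular_const _).mul (isRegular_coord _)).neg
  · exact ((isRegular_const _).mul (isRegular_coord _)).neg
  · exact isRegular_const _

theorem isRegular_laxCol (S : Set (Pt F)) (k : Fin 3) : IsRegular S fun x => laxCol p x k := by
  fin_cases k
  · exact isRegular_coord _
  · exact isRegular_coord _
  · exact ((isRegular_const _).mul (((isRegular_coord _).mul (isRegular_coord _)).add
      ((isRegular_coord _).mul (isRegular_coord _)))).sub (isRegular_const _)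

theorem isRegular_rowPair (S : Set (Pt F)) (W b : Fin 3 → F) :
    IsRegular S fun x => rowPair p W b x :=
  IsRegular.sum fun k _ => ((isRegular_const _).mul (isRegular_laxRow S k)).mul (isRegular_const _)

theorem isRegular_weightedCol (S : Set (Pt F)) (W : Fin 3 → F) (k : Fin 3) :
    IsRegular S fun x => laxCol p x k / (diagVec p k * W k) :=
  ((isRegular_laxCol S k).mul (isRegular_const (diagVec p k * W k)⁻¹)).congr
    fun _ _ => (div_eq_mul_inv _ _).symm

theorem isRegular_colPair (S : Set (Pt F)) (W be : Fin 3 → F) :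
    IsRegular S fun x => colPair p W be x :=
  IsRegular.sum fun k _ => (isRegular_const _).mul (isRegular_weightedCol S W k)

theorem isRegular_slideDisc (S : Set (Pt F)) (W be b : Fin 3 → F) (d d' : F) :
    IsRegular S fun x => slideDisc p W be b d d' x :=
  (isRegular_const _).sub ((isRegular_colPair S W be).mul (isRegular_rowPair S W b))

theorem isRegular_slideRow (S : Set (Pt F)) (W be b : Fin 3 → F) (d' : F) (k : Fin 3) :
    IsRegular S fun x => slideRow p W be b d' x k :=
  ((isRegular_const _).mul ((isRegular_const _).mul (isRegular_laxRow S k))).sub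
    ((isRegular_rowPair S W b).mul (isRegular_const _))

theorem isPrincipal_slideDomain (W be b : Fin 3 → F) (d d' : F) :
    IsPrincipal (slideDomain p W be b d d') := by
  have := (isPrincipal_univ.and_ne_zero (isRegular_slideRow (p := p) Set.univ W be b d' 2)).and_ne_zero
    (isRegular_slideDisc (p := p) _ W be b d d')
  simpa [slideDomain] using this

theorem isRegularPt_slide (hp : p ∈ admissible F) {W W' be b : Fin 3 → F} {d d' : F}
    (hW' : ∀ k, W' k ≠ 0) :
    IsRegularPt (slideDomain p W be b d d') (slide p W W' be b d d') := by
  have h1 : ∀ k, IsRegular (slideDomain p W be b d d')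
      fun x => slideRow p W be b d' x k / W' k := fun k =>
    (isRegular_slideRow _ W be b d' k).div (isRegular_const _) fun _ _ => hW' k
  have h2 : ∀ k, IsRegular (slideDomain p W be b d d')
      fun x => diagVec p k * W' k * slideCol p W be b d d' x k := fun k =>
    (isRegular_const _).mul ((((isRegular_const _).mul (isRegular_weightedCol _ W k)).add
      ((isRegular_colPair _ W be).mul (isRegular_const _))).div
      (isRegular_slideDisc _ W be b d d') fun x hx => hx.2)
  have h3 : ∀ x ∈ slideDomain p W be b d d', slideRow p W be b d' x 2 / W' 2 ≠ 0 :=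
    fun x hx => div_ne_zero hx.1 (hW' 2)
  intro i
  fin_cases i
  · exact ((h1 0).div (h1 2) h3).neg.div (isRegular_const _) fun _ _ => hp.1
  · exact ((h1 1).div (h1 2) h3).neg.div (isRegular_const _) fun _ _ => hp.2.1
  · exact (h2 0).mul (h1 2)
  · exact (h2 1).mul (h1 2)

theorem isBirational_of_slide (hp : p ∈ admissible F) {W W' be b : Fin 3 → F} {d d' m : F}
    (hW : ∀ k, W k ≠ 0) (hW' : ∀ k, W' k ≠ 0) (hm : ∑ k, be k * b k = m)
    (hd : d' = d + m - gap p) (h1 : d' * (d' - m) ≠ 0) (h2 : d * (d + m) ≠ 0)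
    {dom : Set (Pt F)} (hdom : IsPrincipal dom) (hne : dom.Nonempty)
    (hsub : dom ⊆ slideDomain p W be b d d') {f : Pt F → Pt F}
    (hf : ∀ x ∈ dom, f x = slide p W W' be b d d' x) : IsBirational dom f := by
  refine isBirational_of_isPrincipal (isPrincipal_slideDomain (p := p) W be b d d')
    (isPrincipal_slideDomain (p := p) W' be (-b) (d + m) (d' - m)) hdom
    ⟨_, hsub hne.some_mem, hne.some_mem⟩ Set.inter_subset_right (fun _ hz => hf _ hz.2)
    (isRegularPt_slide hp hW') (isRegularPt_slide hp hW)
    (fun _ => slide_slide hp hW hW' hm hd h1 h2) fun _ hz => ?_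
  -- The reverse composite is the same statement for the inverse data, for which the pairing is
  -- `-m`; negating and shifting twice restores the original data.
  have := slide_slide hp hW' hW (be := be) (b := -b) (d := d + m) (d' := d' - m) (m := -m)
    (by simp [← hm]) (by rw [hd]; ring)
    (by rw [sub_neg_eq_add, sub_add_cancel, mul_comm]; exact h1)
    (by rw [add_neg_cancel_right, mul_comm]; exact h2) hz
  rwa [neg_neg, add_neg_cancel_right, sub_neg_eq_add, sub_add_cancel] at this

theorem exists_ne_zero_add_mul_ne_zero [Infinite F] {P : F} (hP : P ≠ 0) (Q : F) :
    ∃ e, e ≠ 0 ∧ P + e * Q ≠ 0 := by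
  obtain ⟨e, h0, h1⟩ := exists_ne_ne 0 (-P / Q)
  refine ⟨e, h0, fun h => ?_⟩
  by_cases hQ : Q = 0
  · exact hP (by simpa [hQ] using h)
  · exact h1 (by rw [eq_div_iff hQ]; linear_combination h)

variable {q : Params F}

/-- Making `phi` vanish reduces `scaleV` and `disc` to nonzero constants. Both position factors are
set equal to one `e`, chosen to keep `scaleU` nonzero as well. For fixed `x`, the next lemma makes
`psi` vanish instead. -/
theorem exists_fst_mem_ybDomain [Infinite F] (hp : p ∈ admissible F) (hq : q ∈ admissible F)
    (h1 : del1 p q ≠ 0) (h2 : del2 p q ≠ 0) (h3 : del2 p q - gap q ≠ 0) (y : Pt F) :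
    ∃ x, (x, y) ∈ ybDomain p q := by
  obtain ⟨e, he, he'⟩ := exists_ne_zero_add_mul_ne_zero h3 (y 2 / q.a1 + y 3 / q.a2)
  have ha := hp.2.2
  have hb1 := hq.1
  have hb2 := hq.2.1
  set x : Pt F := ![(q.a1 * y 0 + e) / p.a3, (q.a2 * y 1 + e) / p.a3, -(p.a3 * gap p) / e, 0]
  have w1 : p.a3 * x 0 - q.a1 * y 0 = e := by
    simp only [x, Matrix.cons_val]; field_simp; ring
  have w2 : p.a3 * x 1 - q.a2 * y 1 = e := by
    simp only [x, Matrix.cons_val]; field_simp; ring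
  have hphi : phi p q x y = 0 := by
    rw [phi_eq hp, w1, w2]
    simp only [x, Matrix.cons_val]
    field_simp
    ring
  refine ⟨x, (mem_ybDomain_iff hp hq).2 ⟨?_, ?_, ?_, by rwa [w1], by rwa [w2]⟩⟩
  · refine div_ne_zero ?_ hq.2.2
    have e1 : del2 p q - psi p q x y * p.a3 =
        del2 p q - gap q + e * (y 2 / q.a1 + y 3 / q.a2) := by
      rw [psi_eq hp hq, w1, w2]
      field_simp
      ring
    rwa [e1]
  · rw [scaleV, hphi, zero_sub]
    exact neg_ne_zero.2 (mul_ne_zero h1 ha)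
  · rw [disc, hphi, zero_mul, sub_zero]
    exact mul_ne_zero h1 h2

theorem exists_snd_mem_ybDomain [Infinite F] (hp : p ∈ admissible F) (hq : q ∈ admissible F)
    (h1 : del1 p q ≠ 0) (h2 : del2 p q ≠ 0) (h3 : gap p - del1 p q ≠ 0) (x : Pt F) :
    ∃ y, (x, y) ∈ ybDomain p q := by
  have ha := hp.2.2
  have hb1 := hq.1
  have hb2 := hq.2.1
  obtain ⟨e, he, he'⟩ := exists_ne_zero_add_mul_ne_zero (mul_ne_zero ha h3) (x 2 + x 3)
  set y : Pt F := ![(p.a3 * x 0 - e) / q.a1, (p.a3 * x 1 - e) / q.a2, gap q * q.a1 / e, 0]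
  have w1 : p.a3 * x 0 - q.a1 * y 0 = e := by
    simp only [y, Matrix.cons_val]; field_simp; ring
  have w2 : p.a3 * x 1 - q.a2 * y 1 = e := by
    simp only [y, Matrix.cons_val]; field_simp; ring
  have hpsi : psi p q x y = 0 := by
    rw [psi_eq hp hq, w1, w2]
    simp only [y, Matrix.cons_val]
    field_simp
    ring
  refine ⟨y, (mem_ybDomain_iff hp hq).2 ⟨?_, ?_, ?_, by rwa [w1], by rwa [w2]⟩⟩
  · rw [scaleU, hpsi, zero_mul, sub_zero]
    exact div_ne_zero h2 hq.2.2
  · have e1 : scaleV p q x y = p.a3 * (gap p - del1 p q) + e * (x 2 + x 3) := by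
      rw [scaleV, phi_eq hp, w1, w2]
      ring
    rwa [e1]
  · rw [disc, hpsi, mul_zero, sub_zero]
    exact mul_ne_zero h1 h2

/-- The four scalars whose nonvanishing `slide_slide` requires are exactly the four differences
between a root for `q` and a root for `p`, for either fixed argument. -/
theorem isQuadrirational_ybMap [Infinite F] (hp : p ∈ admissible F) (hq : q ∈ admissible F)
    (hs : DisjointSpectra p q) : IsQuadrirational (ybDomain p q) (ybMap p q) := by
  obtain ⟨s1, s2, s3, s4⟩ := hs
  have g1 := root2_eq p
  have g2 := root2_eq q
  have d1 : del1 p q ≠ 0 := sub_ne_zero.2 (Ne.symm s1)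
  have d2 : del2 p q ≠ 0 := sub_ne_zero.2 (Ne.symm s4)
  have d3 : del2 p q - gap q ≠ 0 := by
    have e : del2 p q - gap q = root1 q - root2 p := by rw [del2, g2]; ring
    rw [e]
    exact sub_ne_zero.2 (Ne.symm s3)
  have d4 : del1 p q + gap q ≠ 0 := by
    have e : del1 p q + gap q = root2 q - root1 p := by rw [del1, g2]; ring
    rw [e]
    exact sub_ne_zero.2 (Ne.symm s2)
  have d5 : del1 p q - gap p ≠ 0 := by
    have e : del1 p q - gap p = root1 q - root2 p := by rw [del1, g1]; ring
    rw [e]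
    exact sub_ne_zero.2 (Ne.symm s3)
  have d6 : del2 p q + gap p ≠ 0 := by
    have e : del2 p q + gap p = root2 q - root1 p := by rw [del2, g1]; ring
    rw [e]
    exact sub_ne_zero.2 (Ne.symm s2)
  have hA := diagVec_ne_zero hp
  have hB := diagVec_ne_zero hq
  have coord : IsRegularPt Set.univ fun x : Pt F => x := fun i => isRegular_coord i
  refine ⟨isBirationalPair_ybMap hp hq, fun y => ?_, fun x => ?_⟩
  · have hdom := isPrincipal_ybDomain isPrincipal_univ (isRegularParams_const hp)
      (isRegularParams_const hq) coord (y := fun _ => y) fun i => isRegular_const _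
    simp only [Set.mem_univ, true_and] at hdom
    have hrp : ∀ x, rowPair p 1 (fun k => laxCol q y k / (diagVec p k * diagVec q k)) x =
        psi p q x y := fun x => by
      rw [← pairing_psi]
      simp [rowPair]
    have hcp : ∀ x, colPair p 1 (fun k => diagVec p k * laxRow q y k) x = phi p q x y :=
      fun x => by
        rw [← pairing_phi hp]
        simp [colPair]
    have hsd : ∀ x, slideDisc p 1 (fun k => diagVec p k * laxRow q y k)
        (fun k => laxCol q y k / (diagVec p k * diagVec q k)) (del1 p q) (del2 p q) x =
        disc p q x y := fun x => by rw [slideDisc, hrp, hcp, disc]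
    have hsr : ∀ x u v, IsImage p q x y u v → ∀ k, slideRow p 1
        (fun k => diagVec p k * laxRow q y k)
        (fun k => laxCol q y k / (diagVec p k * diagVec q k)) (del2 p q) x k =
        scaleU p q x y * diagVec q k * laxRow p u k := fun x u v h k => by
      rw [slideRow, hrp, h.row_fst, Pi.one_apply]
      ring
    refine isBirational_of_slide hp (W := 1) (W' := diagVec q)
      (be := fun k => diagVec p k * laxRow q y k)
      (b := fun k => laxCol q y k / (diagVec p k * diagVec q k)) (d := del1 p q)
      (d' := del2 p q) (m := gap q) (fun k => one_ne_zero) hB (pairing_snd hp hq y)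
      (del2_eq p q) (mul_ne_zero d2 d3) (mul_ne_zero d1 d4) hdom
      (exists_fst_mem_ybDomain hp hq d1 d2 d3 y) (fun x hx => ?_) fun x hx => ?_
    · obtain ⟨hU, hV, hD, -, -⟩ := (mem_ybDomain_iff hp hq).1 hx
      refine ⟨?_, by rwa [hsd]⟩
      rw [hsr x _ _ (isImage_ybMap hp hq hx)]
      exact mul_ne_zero (mul_ne_zero hU (hB 2)) (by simp [laxRow])
    · obtain ⟨hU, hV, hD, -, -⟩ := (mem_ybDomain_iff hp hq).1 hx
      have h := isImage_ybMap hp hq hx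
      refine (ofRowCol_laxRow hp _ hU (fun k => ?_) fun k => ?_).symm
      · rw [hsr x _ _ h]
        have := hB k
        field_simp
      · have hAk := hA k
        have hBk := hB k
        have e := h.col_fst k
        rw [slideCol, hsd, hcp, Pi.one_apply]
        apply mul_left_cancel₀ hD
        rw [e]
        field_simp
  · have hdom := isPrincipal_ybDomain isPrincipal_univ (isRegularParams_const hp)
      (isRegularParams_const hq) (x := fun _ => x) (fun i => isRegular_const _) coord
    simp only [Set.mem_univ, true_and] at hdom
    have hrp : ∀ y, rowPair q (diagVec p) (fun k => laxCol p x k / diagVec p k) y =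
        phi p q x y := fun y => by
      rw [← pairing_phi hp]
      rfl
    have hcp : ∀ y, colPair q (diagVec p) (laxRow p x) y = psi p q x y := fun y => by
      rw [← pairing_psi]
      simp [colPair, mul_comm]
    have hsd : ∀ y, slideDisc q (diagVec p) (laxRow p x)
        (fun k => laxCol p x k / diagVec p k) (del2 p q) (del1 p q) y =
        disc p q x y := fun y => by
      rw [slideDisc, hrp, hcp, disc]
      ring
    have hsr : ∀ y u v, IsImage p q x y u v → ∀ k, slideRow q (diagVec p) (laxRow p x)
        (fun k => laxCol p x k / diagVec p k) (del1 p q) y k =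
        -scaleV p q x y * laxRow q v k := fun y u v h k => by
      rw [slideRow, hrp]
      linear_combination h.row_snd k
    -- The roles of the two points and of `del1`, `del2` are exchanged; the normaliser becomes
    -- `-scaleV`.
    refine isBirational_of_slide hq (W := diagVec p) (W' := 1) (be := laxRow p x)
      (b := fun k => laxCol p x k / diagVec p k) (d := del2 p q)
      (d' := del1 p q) (m := gap p) hA (fun k => one_ne_zero) (pairing_fst hp x)
      (by rw [del2_eq]; ring) (mul_ne_zero d1 d5) (mul_ne_zero d2 d6) hdom
      (exists_snd_mem_ybDomain hp hq d1 d2 (by rwa [← neg_sub, neg_ne_zero]) x)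
      (fun y hy => ?_) fun y hy => ?_
    · obtain ⟨hU, hV, hD, -, -⟩ := (mem_ybDomain_iff hp hq).1 hy
      refine ⟨?_, by rwa [hsd]⟩
      rw [hsr y _ _ (isImage_ybMap hp hq hy)]
      exact mul_ne_zero (neg_ne_zero.2 hV) (by simp [laxRow])
    · obtain ⟨hU, hV, hD, -, -⟩ := (mem_ybDomain_iff hp hq).1 hy
      have h := isImage_ybMap hp hq hy
      refine (ofRowCol_laxRow hq _ (neg_ne_zero.2 hV) (fun k => ?_) fun k => ?_).symm
      · rw [hsr y _ _ h, Pi.one_apply, div_one]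
      · have hAk := hA k
        have hBk := hB k
        have e := h.col_snd k
        rw [slideCol, hsd, hcp, Pi.one_apply]
        apply mul_left_cancel₀ (mul_ne_zero hD hAk)
        rw [e]
        field_simp
        ring

end Regular

/-! ### The symplectic form -/

section Alternating

variable {K V E : Type*} [Field K] [AddCommGroup V] [Module K V] [AddCommGroup E] [Module K E]

theorem alternating_swap (w : V →ₗ[K] V →ₗ[K] E) (hw : ∀ x, w x x = 0) (x y : V) :
    w x y = -w y x := by
  have := hw (x + y)
  simp only [map_add, LinearMap.add_apply, hw, zero_add, add_zero] at this
  exact eq_neg_of_add_eq_zero_right this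

/-- The correction terms are sorted by their second argument `P`, `Q` or `T`, which do not depend on
the index, so that the first arguments can be summed. -/
theorem cotangent_lift_single (w : V →ₗ[K] V →ₗ[K] E) (hw : ∀ x y, w x y = -w y x)
    {al a be b f g e d d' : K} {A A' B B' P Q T : V} (he : e * (d * d' - f * g) = 1) :
    w (d' • A - (g • B + be • Q)) (e • (d • A' + (f • B' + b • P)) + (d * a + f * b) • T) +
      w ((f • A + al • P) - d • B) (-(e • ((g • A' + a • Q) + d' • B') + (g * a + d' * b) • T)) =
    w A A' + w B B' +
      w (e • (d' • b • A - g • b • B) + e • (g • al • A' + d' • al • B' + (al * a) • Q) +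
        (g * (al * a) + d' * (al * b)) • T) P +
      w (e • (d • be • A' + f • be • B' + (be * b) • P) - e • (f • a • A - d • a • B) +
        (d * (be * a) + f * (be * b)) • T) Q +
      w ((d * d' - f * g) • (a • A + b • B)) T := by
  simp only [map_add, map_sub, map_neg, map_smul, LinearMap.add_apply, LinearMap.sub_apply,
    LinearMap.smul_apply]
  rw [hw P A', hw P B', hw P Q, hw P T, hw Q A', hw Q B', hw Q T]
  linear_combination (norm := module) he • w A A' + he • w B B'

/-- The change of the form `∑ dα ∧ da + dβ ∧ db` under a linear map of `(α, β)` and the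
contragredient map of `(a, b)`; it vanishes for the matrix with rows `(d', -g)` and `(f, -d)`. -/
theorem cotangent_lift (w : V →ₗ[K] V →ₗ[K] E) (hw : ∀ x, w x x = 0)
    {al a be b : Fin 3 → K} {f g e d d' m n : K} {A A' B B' : Fin 3 → V} {P Q T : V}
    (he : e * (d * d' - f * g) = 1) (hT : T = (e * e) • (f • Q + g • P)) (hd : d' + m = d + n)
    (hm : ∑ k, al k * a k = m) (hn : ∑ k, be k * b k = n) (hf : ∑ k, be k * a k = f)
    (hg : ∑ k, al k * b k = g) (hA : ∑ k, (al k • A' k + a k • A k) = 0)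
    (hB : ∑ k, (be k • B' k + b k • B k) = 0) (hP : ∑ k, (be k • A' k + a k • B k) = P)
    (hQ : ∑ k, (al k • B' k + b k • A k) = Q) :
    ∑ k, (w (d' • A k - (g • B k + be k • Q))
        (e • (d • A' k + (f • B' k + b k • P)) + (d * a k + f * b k) • T) +
      w ((f • A k + al k • P) - d • B k)
        (-(e • ((g • A' k + a k • Q) + d' • B' k) + (g * a k + d' * b k) • T))) =
    ∑ k, (w (A k) (A' k) + w (B k) (B' k)) := by
  simp only [cotangent_lift_single w (alternating_swap w hw) he]
  -- All the correction sums reduce to `P`, `Q`, `T` and this single vector, by the differentiated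
  -- pairing relations.
  set S : V := ∑ k, (a k • A k + b k • B k) with hS
  have hX : ∑ k, (e • (d' • b k • A k - g • b k • B k) +
      e • (g • al k • A' k + d' • al k • B' k + (al k * a k) • Q) +
      (g * (al k * a k) + d' * (al k * b k)) • T) =
      (e * (d' + m)) • Q - (e * g) • S + (g * (d' + m)) • T := by
    rw [hS]
    simp only [Fin.sum_univ_three] at *
    linear_combination (norm := module) (e * g) • hA + (e * d') • hQ + (e • hm) • Q +
      (g * hm + d' * hg) • T
  have hY : ∑ k, (e • (d • be k • A' k + f • be k • B' k + (be k * b k) • P) -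
      e • (f • a k • A k - d • a k • B k) + (d * (be k * a k) + f * (be k * b k)) • T) =
      (e * (d + n)) • P - (e * f) • S + (f * (d + n)) • T := by
    rw [hS]
    simp only [Fin.sum_univ_three] at *
    linear_combination (norm := module) (e * f) • hB + (e * d) • hP + (e • hn) • P +
      (f * hn + d * hf) • T
  have hZ : ∑ k, (d * d' - f * g) • (a k • A k + b k • B k) = (d * d' - f * g) • S := by
    rw [hS, Finset.smul_sum]
  have e1 : ∀ G : Fin 3 → V, ∀ R : V, ∑ k, w (G k) R = w (∑ k, G k) R := fun G R => by
    rw [map_sum, LinearMap.sum_apply]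
  -- The terms in `w P Q` cancel because `d' + m = d + n`; those in `w S P` and `w S Q` cancel
  -- against `w S T`, because `T` is the differential of `e`.
  rw [Finset.sum_add_distrib, Finset.sum_add_distrib, Finset.sum_add_distrib, e1, e1, e1, hX, hY,
    hZ, hT, hd]
  simp only [map_add, map_sub, map_smul, LinearMap.add_apply, LinearMap.sub_apply,
    LinearMap.smul_apply]
  rw [alternating_swap w hw P Q]
  simp only [hw, smul_zero, add_zero]
  linear_combination (norm := module) (e * he) • (f • w S Q + g • w S P)

theorem rescaling_single (w : V →ₗ[K] V →ₗ[K] E) (hw : ∀ x y, w x y = -w y x)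
    {s t r c : K} {R C U : V} (hst : s * t = 1) :
    w (s • R + r • U) (t • C + c • (-(t * t) • U)) =
      w R C - t • w (c • R + r • C) U + (-(r * c * (t * t))) • w U U := by
  simp only [map_add, map_smul, LinearMap.add_apply, LinearMap.smul_apply]
  rw [hw U C]
  linear_combination (norm := module) hst • w R C - (t * c * hst) • w R U

/-- With `U` the differential of `s`, that of `t = 1/s` is `-t² U`. The correction is the
differential of the pairing of `r` and `c` wedged with `U`, and `h` says that this differential is
zero. -/
theorem rescaling (w : V →ₗ[K] V →ₗ[K] E) (hw : ∀ x, w x x = 0)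
    {s t : K} {r c : Fin 3 → K} {R C : Fin 3 → V} {U : V} (hst : s * t = 1)
    (h : ∑ k, (c k • R k + r k • C k) = 0) :
    ∑ k, w (s • R k + r k • U) (t • C k + c k • (-(t * t) • U)) = ∑ k, w (R k) (C k) := by
  simp only [rescaling_single w (alternating_swap w hw) hst, hw, smul_zero, add_zero, Finset.sum_sub_distrib,
    ← Finset.smul_sum]
  rw [← LinearMap.sum_apply, ← map_sum, h, map_zero, LinearMap.zero_apply, smul_zero, sub_zero]

end Alternating

/-! ### Invariance of the two-form for any derivation and alternating pairing -/

section Symplectic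

variable {F K V E : Type*} [Field F] [Field K] [Algebra F K] [AddCommGroup V] [Module K V]
  [Module F V] [AddCommGroup E] [Module K E]

/-- Parameters in `F`, seen in an extension field. -/
abbrev Params.base (K : Type*) [Field K] [Algebra F K] (p : Params F) : Params K :=
  p.map (algebraMap F K)

theorem base_mem_admissible {p : Params F} (hp : p ∈ admissible F) :
    p.base K ∈ admissible K :=
  ⟨(map_ne_zero (algebraMap F K)).2 hp.1, (map_ne_zero (algebraMap F K)).2 hp.2.1,
    (map_ne_zero (algebraMap F K)).2 hp.2.2⟩

theorem diagVec_base (p : Params F) (k : Fin 3) :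
    diagVec (p.base K) k = algebraMap F K (diagVec p k) := by
  fin_cases k <;> rfl

theorem gap_base (p : Params F) : gap (p.base K) = algebraMap F K (gap p) := by
  simp [gap, Params.base, Params.map, map_ofNat (algebraMap F K)]

theorem del1_base (p q : Params F) : del1 (p.base K) (q.base K) = algebraMap F K (del1 p q) := by
  simp [del1, root1, Params.base, Params.map]

theorem del2_base (p q : Params F) : del2 (p.base K) (q.base K) = algebraMap F K (del2 p q) := by
  simp [del2, root2, Params.base, Params.map, map_ofNat (algebraMap F K)]

/-- The two-form `dx₁ ∧ dX₁ + dx₂ ∧ dX₂` in terms of a rescaled row and a rescaled column. -/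
theorem sum_row_col_form (D : Derivation F K V) (w : V →ₗ[K] V →ₗ[K] E) (hw : ∀ x, w x x = 0)
    {p : Params F} (hp : p ∈ admissible F) {W : Fin 3 → F} (hW : ∀ k, W k ≠ 0) {x : Pt K} {s : K}
    (hs : s ≠ 0) {al a : Fin 3 → K}
    (hal : ∀ k, al k = s * (algebraMap F K (W k) * laxRow (p.base K) x k))
    (ha : ∀ k, s * a k = laxCol (p.base K) x k / (diagVec (p.base K) k * algebraMap F K (W k))) :
    ∑ k, w (D (al k)) (D (a k)) = -(w (D (x 0)) (D (x 2)) + w (D (x 1)) (D (x 3))) := by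
  set r : Fin 3 → K := fun k => algebraMap F K (W k) * laxRow (p.base K) x k with hr
  set c : Fin 3 → K := fun k => laxCol (p.base K) x k *
    algebraMap F K (diagVec p k * W k)⁻¹ with hc
  have hA := diagVec_ne_zero hp
  have ha' : ∀ k, a k = s⁻¹ * c k := fun k => by
    apply mul_left_cancel₀ hs
    rw [ha, diagVec_base, ← mul_assoc, mul_inv_cancel₀ hs, one_mul]
    simp only [hc, map_inv₀, map_mul, div_eq_mul_inv]
  have hsum : ∑ k, (c k • D (r k) + r k • D (c k)) = 0 := by
    have h1 : ∑ k, r k * c k = algebraMap F K (gap p) := by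
      rw [← gap_base, ← sum_row_mul_col (base_mem_admissible hp) x]
      refine Finset.sum_congr rfl fun k _ => ?_
      have h2 : algebraMap F K (W k) ≠ 0 := (map_ne_zero _).2 (hW k)
      have h3 : algebraMap F K (diagVec p k) ≠ 0 := (map_ne_zero _).2 (hA k)
      simp only [hr, hc, diagVec_base, map_inv₀, map_mul]
      field_simp
    have h2 := congrArg D h1
    rw [map_sum, D.map_algebraMap] at h2
    rw [← h2]
    exact Finset.sum_congr rfl fun k _ => ((D.leibniz (r k) (c k)).trans (add_comm _ _)).symm
  have key := rescaling w hw (mul_inv_cancel₀ hs) (U := D s) hsum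
  have e1 : ∀ k, D (al k) = s • D (r k) + r k • D s := fun k => by rw [hal, D.leibniz]
  have e2 : ∀ k, D (a k) = s⁻¹ • D (c k) + c k • (-(s⁻¹ * s⁻¹) • D s) := fun k => by
    rw [ha', D.leibniz, D.leibniz_inv, pow_two]
  simp only [e1, e2, key, Fin.sum_univ_three]
  have r0 : D (r 0) = -(algebraMap F K (W 0 * p.a1) • D (x 0)) := by
    have : r 0 = -(algebraMap F K (W 0 * p.a1) * x 0) := by
      simp only [hr, laxRow, Matrix.cons_val, Params.base, Params.map, map_mul]
      ring
    rw [this, map_neg, D.leibniz, D.map_algebraMap, smul_zero, add_zero]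
  have r1 : D (r 1) = -(algebraMap F K (W 1 * p.a2) • D (x 1)) := by
    have : r 1 = -(algebraMap F K (W 1 * p.a2) * x 1) := by
      simp only [hr, laxRow, Matrix.cons_val, Params.base, Params.map, map_mul]
      ring
    rw [this, map_neg, D.leibniz, D.map_algebraMap, smul_zero, add_zero]
  have r2 : D (r 2) = 0 := by
    have : r 2 = algebraMap F K (W 2) := by simp [hr, laxRow]
    rw [this, D.map_algebraMap]
  have c0 : D (c 0) = algebraMap F K (p.a1 * W 0)⁻¹ • D (x 2) := by
    have : c 0 = x 2 * algebraMap F K (p.a1 * W 0)⁻¹ := rfl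
    rw [this, D.leibniz, D.map_algebraMap, smul_zero, zero_add]
  have c1 : D (c 1) = algebraMap F K (p.a2 * W 1)⁻¹ • D (x 3) := by
    have : c 1 = x 3 * algebraMap F K (p.a2 * W 1)⁻¹ := rfl
    rw [this, D.leibniz, D.map_algebraMap, smul_zero, zero_add]
  have u0 : algebraMap F K (p.a1 * W 0)⁻¹ * algebraMap F K (W 0 * p.a1) = 1 := by
    rw [← map_mul, mul_comm p.a1, inv_mul_cancel₀ (mul_ne_zero (hW 0) hp.1), map_one]
  have u1 : algebraMap F K (p.a2 * W 1)⁻¹ * algebraMap F K (W 1 * p.a2) = 1 := by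
    rw [← map_mul, mul_comm p.a2, inv_mul_cancel₀ (mul_ne_zero (hW 1) hp.2.1), map_one]
  rw [r0, r1, r2, c0, c1, map_zero, LinearMap.zero_apply, add_zero]
  simp only [map_neg, map_smul, LinearMap.neg_apply, LinearMap.smul_apply, smul_neg, smul_smul, u0,
    u1, one_smul]
  abel

/-- The map preserves the symplectic form, for any derivation and any alternating pairing. -/
theorem IsImage.symplectic (D : Derivation F K V) (w : V →ₗ[K] V →ₗ[K] E) (hw : ∀ x, w x x = 0)
    {p q : Params F} (hp : p ∈ admissible F) (hq : q ∈ admissible F) {x y u v : Pt K}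
    (hU : scaleU (p.base K) (q.base K) x y ≠ 0) (hV : scaleV (p.base K) (q.base K) x y ≠ 0)
    (hD : disc (p.base K) (q.base K) x y ≠ 0) (h : IsImage (p.base K) (q.base K) x y u v) :
    w (D (u 0)) (D (u 2)) + w (D (u 1)) (D (u 3)) + w (D (v 0)) (D (v 2)) + w (D (v 1)) (D (v 3)) =
    w (D (x 0)) (D (x 2)) + w (D (x 1)) (D (x 3)) + w (D (y 0)) (D (y 2)) +
      w (D (y 1)) (D (y 3)) := by
  have hpK := base_mem_admissible (K := K) hp
  have hqK := base_mem_admissible (K := K) hq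
  have hA := diagVec_ne_zero hpK
  have hB := diagVec_ne_zero hqK
  set P := p.base K
  set Q := q.base K
  set al : Fin 3 → K := laxRow P x with hal
  set a : Fin 3 → K := fun k => laxCol P x k / diagVec P k with ha
  set be : Fin 3 → K := fun k => diagVec P k * laxRow Q y k with hbe
  set b : Fin 3 → K := fun k => laxCol Q y k / (diagVec P k * diagVec Q k) with hb
  set f := phi P Q x y with hf
  set g := psi P Q x y with hg
  set d := algebraMap F K (del1 p q) with hd
  set d' := algebraMap F K (del2 p q) with hd'
  have hd1 : del1 P Q = d := del1_base p q
  have hd2 : del2 P Q = d' := del2_base p q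
  have hDe : disc P Q x y = d * d' - f * g := by rw [disc, hd1, hd2]
  set e := (d * d' - f * g)⁻¹ with he
  have hD' : d * d' - f * g ≠ 0 := hDe ▸ hD
  have he1 : e * (d * d' - f * g) = 1 := inv_mul_cancel₀ hD'
  have p1 : ∑ k, al k * a k = gap P := pairing_fst hpK x
  have p2 : ∑ k, be k * b k = gap Q := pairing_snd hpK hqK y
  have p3 : ∑ k, be k * a k = f := pairing_phi hpK x y
  have p4 : ∑ k, al k * b k = g := pairing_psi x y
  have Dd : D d = 0 := D.map_algebraMap _
  have Dd' : D d' = 0 := D.map_algebraMap _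
  have Dsum : ∀ (r c : Fin 3 → K), ∑ k, (r k • D (c k) + c k • D (r k)) = D (∑ k, r k * c k) :=
    fun r c => by simp only [map_sum, D.leibniz]
  have DT : D e = (e * e) • (f • D g + g • D f) := by
    rw [he, D.leibniz_inv, map_sub, D.leibniz, D.leibniz, Dd, Dd', smul_zero, smul_zero, add_zero,
      zero_sub, smul_neg, neg_smul, neg_neg, pow_two]
  have lift := cotangent_lift w hw (A := fun k => D (al k)) (A' := fun k => D (a k))
    (B := fun k => D (be k)) (B' := fun k => D (b k)) (P := D f) (Q := D g) he1 DT
    (by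
      have := del2_eq P Q
      rw [hd1, hd2] at this
      rw [this]
      ring) p1 p2 p3 p4
    (by rw [Dsum, p1, gap_base, D.map_algebraMap]) (by rw [Dsum, p2, gap_base, D.map_algebraMap])
    (by rw [Dsum, p3]) (by rw [Dsum, p4])
  have d1 : ∀ k, D (d' * al k - g * be k) = d' • D (al k) - (g • D (be k) + be k • D g) :=
    fun k => by rw [map_sub, D.leibniz, D.leibniz, Dd', smul_zero, add_zero]
  have d2 : ∀ k, D (e * (d * a k + f * b k)) =
      e • (d • D (a k) + (f • D (b k) + b k • D f)) + (d * a k + f * b k) • D e := fun k => by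
    rw [D.leibniz, map_add, D.leibniz, D.leibniz, Dd, smul_zero, add_zero]
  have d3 : ∀ k, D (f * al k - d * be k) = (f • D (al k) + al k • D f) - d • D (be k) :=
    fun k => by rw [map_sub, D.leibniz, D.leibniz, Dd, smul_zero, add_zero]
  have d4 : ∀ k, D (-(e * (g * a k + d' * b k))) =
      -(e • ((g • D (a k) + a k • D g) + d' • D (b k)) + (g * a k + d' * b k) • D e) := fun k => by
    rw [map_neg, D.leibniz, map_add, D.leibniz, D.leibniz, Dd', smul_zero, add_zero]
  simp only [← d1, ← d2, ← d3, ← d4, Finset.sum_add_distrib] at lift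
  -- The old points enter with normaliser 1, the new ones with `scaleU` and `scaleV`. The weights
  -- are constants of `F`, so the derivation kills them.
  have fx := sum_row_col_form D w hw hp (W := 1) (fun _ => one_ne_zero) (x := x) (s := 1)
    (al := al) (a := a) one_ne_zero (by simp [hal, P]) (by simp [ha, P])
  have fy := sum_row_col_form D w hw hq (W := diagVec p) (diagVec_ne_zero hp) (x := y) (s := 1)
    (al := be) (a := b) one_ne_zero
    (fun k => by rw [hbe, one_mul, ← diagVec_base])
    (fun k => by rw [hb, one_mul, ← diagVec_base, mul_comm (diagVec (q.base K) k)])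
  have fu := sum_row_col_form D w hw hp (W := diagVec q) (diagVec_ne_zero hq) (x := u)
    (s := scaleU P Q x y) (al := fun k => d' * al k - g * be k)
    (a := fun k => e * (d * a k + f * b k)) hU
    (fun k => by
      have := h.row_fst k
      rw [hd2] at this
      rw [← diagVec_base]
      linear_combination -this)
    (fun k => by
      have := h.col_fst k
      rw [hd1, hDe, ← hf] at this
      rw [← diagVec_base]
      have hAk := hA k
      have hBk := hB k
      apply mul_left_cancel₀ hD'
      change _ = (d * d' - f * g) * (laxCol P u k / (diagVec P k * diagVec Q k))
      rw [← mul_div_assoc (d * d' - f * g) (laxCol P u k), this]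
      simp only [ha, hb, he]
      field_simp)
  have fv := sum_row_col_form D w hw hq (W := 1) (fun _ => one_ne_zero) (x := v)
    (s := scaleV P Q x y) (al := fun k => f * al k - d * be k)
    (a := fun k => -(e * (g * a k + d' * b k))) hV
    (fun k => by
      have := h.row_snd k
      rw [hd1] at this
      rw [Pi.one_apply, map_one, one_mul]
      linear_combination -this)
    (fun k => by
      have := h.col_snd k
      rw [hd2, hDe, ← hg] at this
      rw [Pi.one_apply, map_one, mul_one]
      have hAk := hA k
      have hBk := hB k
      apply mul_left_cancel₀ (mul_ne_zero hD' hAk)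
      change _ = (d * d' - f * g) * diagVec P k * (laxCol Q v k / diagVec Q k)
      rw [← mul_div_assoc _ (laxCol Q v k), this]
      simp only [ha, hb, he]
      field_simp)
  rw [fx, fy, fu, fv] at lift
  have := congrArg Neg.neg lift
  rw [neg_add, neg_neg, neg_neg, neg_add, neg_neg, neg_neg] at this
  rw [add_assoc, this, ← add_assoc]

end Symplectic

/-! ### The map at the generic point, and the symplectic form -/

section Generic

variable {F : Type*} [Field F]

/-- The polynomial whose values are those of `phi`. -/
def phiPoly (p q : Params F) : MvPolynomial (Fin 4 ⊕ Fin 4) F :=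
  (.C p.a3 * .X (.inl 0) - .C q.a1 * .X (.inr 0)) * .X (.inl 2) +
    (.C p.a3 * .X (.inl 1) - .C q.a2 * .X (.inr 1)) * .X (.inl 3) + .C (p.a3 * gap p)

/-- The polynomial whose values are those of `psi`. -/
def psiPoly (p q : Params F) : MvPolynomial (Fin 4 ⊕ Fin 4) F :=
  .C (gap q / p.a3) -
    (.C p.a3 * .X (.inl 0) - .C q.a1 * .X (.inr 0)) * .X (.inr 2) * .C (p.a3 * q.a1)⁻¹ -
    (.C p.a3 * .X (.inl 1) - .C q.a2 * .X (.inr 1)) * .X (.inr 3) * .C (p.a3 * q.a2)⁻¹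

/-- A polynomial whose nonvanishing defines `ybDomain`. -/
def domainPoly (p q : Params F) : MvPolynomial (Fin 4 ⊕ Fin 4) F :=
  (.C (del2 p q) - psiPoly p q * .C p.a3) * (phiPoly p q - .C (del1 p q * p.a3)) *
    (.C (del1 p q * del2 p q) - phiPoly p q * psiPoly p q) *
    (.C p.a3 * .X (.inl 0) - .C q.a1 * .X (.inr 0)) *
    (.C p.a3 * .X (.inl 1) - .C q.a2 * .X (.inr 1))

variable {K : Type*} [Field K] [Algebra F K] {p q : Params F}

theorem aeval_phiPoly (hp : p ∈ admissible F) (q : Params F) (x y : Pt K) :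
    MvPolynomial.aeval (Sum.elim x y) (phiPoly p q) = phi (p.base K) (q.base K) x y := by
  rw [phi_eq (base_mem_admissible hp), gap_base]
  simp [phiPoly, Params.base, Params.map, MvPolynomial.algHom_C]

theorem aeval_psiPoly (hp : p ∈ admissible F) (hq : q ∈ admissible F) (x y : Pt K) :
    MvPolynomial.aeval (Sum.elim x y) (psiPoly p q) = psi (p.base K) (q.base K) x y := by
  rw [psi_eq (base_mem_admissible hp) (base_mem_admissible hq), gap_base]
  simp [psiPoly, Params.base, Params.map, MvPolynomial.algHom_C, div_eq_mul_inv]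

theorem mem_ybDomain_base_iff (hp : p ∈ admissible F) (hq : q ∈ admissible F) {x y : Pt K} :
    (x, y) ∈ ybDomain (p.base K) (q.base K) ↔
      MvPolynomial.aeval (Sum.elim x y) (domainPoly p q) ≠ 0 := by
  have hb : (q.base K).a3 ≠ 0 := (base_mem_admissible hq).2.2
  rw [mem_ybDomain_iff (base_mem_admissible hp) (base_mem_admissible hq), scaleU, scaleV, disc,
    del1_base, del2_base, ← aeval_phiPoly hp, ← aeval_psiPoly hp hq]
  simp only [domainPoly, map_mul, map_sub, MvPolynomial.algHom_C, MvPolynomial.aeval_X,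
    Sum.elim_inl, Sum.elim_inr, Params.base, Params.map, ne_eq, mul_eq_zero, div_eq_zero_iff,
    not_or] at hb ⊢
  tauto

/-- One point over `F` where `domainPoly` does not vanish shows that it is a nonzero polynomial, and
its value at the generic point is itself, in the fraction field. -/
theorem genericPt_mem_ybDomain [Infinite F] (hp : p ∈ admissible F) (hq : q ∈ admissible F) :
    genericPt F ∈ ybDomain (p.base (FunField F)) (q.base (FunField F)) := by
  obtain ⟨⟨x, y⟩, h⟩ := ybDomain_nonempty hp hq
  have h0 : domainPoly p q ≠ 0 := fun h1 =>
    (mem_ybDomain_base_iff (K := F) hp hq).1 h (by rw [h1, map_zero])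
  refine (mem_ybDomain_base_iff (x := (genericPt F).1) (y := (genericPt F).2) hp hq).2 ?_
  have h1 : Sum.elim (genericPt F).1 (genericPt F).2 =
      algebraMap (MvPolynomial (Fin 4 ⊕ Fin 4) F) (FunField F) ∘ MvPolynomial.X := by
    ext (i | i) <;> rfl
  rw [h1, MvPolynomial.aeval_algebraMap_apply, MvPolynomial.aeval_X_left_apply]
  exact (map_ne_zero_iff _ (IsFractionRing.injective _ _)).2 h0

theorem isSymplectic [Infinite F] (hp : p ∈ admissible F) (hq : q ∈ admissible F) :
    IsSymplectic p q := by
  have h := genericPt_mem_ybDomain hp hq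
  have hp' := base_mem_admissible (K := FunField F) hp
  have hq' := base_mem_admissible (K := FunField F) hq
  obtain ⟨hU, hV, hD, -, -⟩ := (mem_ybDomain_iff hp' hq').1 h
  exact ⟨h, (isImage_ybMap hp' hq' h).symplectic (KaehlerDifferential.D F (FunField F))
    ((LinearMap.mul (FunField F) (ExteriorAlgebra (FunField F) (Ω[FunField F⁄F]))).compl₁₂
      (ExteriorAlgebra.ι (FunField F)) (ExteriorAlgebra.ι (FunField F)))
    (fun x => ExteriorAlgebra.ι_sq_zero x) hp hq hU hV hD⟩

end Generic

end YangBaxter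

end

theorem proposition2 {F : Type*} [Field F] [CharZero F] :
    YangBaxter.IsParametricYangBaxter (YangBaxter.admissible F)
      YangBaxter.ybDomain YangBaxter.ybMap ∧
    (∀ p ∈ YangBaxter.admissible F, ∀ q ∈ YangBaxter.admissible F,
      YangBaxter.IsBirationalPair (YangBaxter.ybDomain p q) (YangBaxter.ybMap p q)) ∧
    (∀ p ∈ YangBaxter.admissible F, ∀ q ∈ YangBaxter.admissible F,
      YangBaxter.DisjointSpectra p q →
        YangBaxter.IsQuadrirational (YangBaxter.ybDomain p q) (YangBaxter.ybMap p q)) ∧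
    (∀ p ∈ YangBaxter.admissible F, ∀ q ∈ YangBaxter.admissible F,
      YangBaxter.IsStrongLax p q) ∧
    (∀ p ∈ YangBaxter.admissible F, ∀ q ∈ YangBaxter.admissible F,
      YangBaxter.IsSymplectic p q) :=
  ⟨YangBaxter.isParametricYangBaxter_ybMap,
    fun _ hp _ hq => YangBaxter.isBirationalPair_ybMap hp hq,
    fun _ hp _ hq hs => YangBaxter.isQuadrirational_ybMap hp hq hs,
    fun _ hp _ hq => YangBaxter.isStrongLax hp hq,
    fun _ hp _ hq => YangBaxter.isSymplectic hp hq⟩
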